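/- There are a word-RAM query algorithm and absolute constants $C$ and $c$ such that the following holds. Let $S[1,n]$ be a sequence over the alphabet $[1,\sigma]$ that contains exactly $u$ distinct values. Then $S$ can be represented by a string of at most $n\log_2\sigma + Cn$ bits such that, on a word RAM with word length $w\ge c\log_2(n+\sigma)$ that has this bit string as read-only memory, the algorithm, given $n$, $\sigma$ and a query $(i,j,x)$ with $1\le i\le j\le n$ and $0\le x<2^w$, answers the range next value query in time at most $C\max(1,\log_2 u)$: it returns the smallest value $v=S[r]\ge x$ with $i\le r\le j$, or reports that there is none. Within the same time it also returns the position of the first occurrence of $v$ in the range, that is, the smallest $p$ with $i\le p\le j$ and $S[p]=v$, and the smallest rank of $v$ in the multiset $S[i,j]$, that is, $1+|\{r : i\le r\le j,\ S[r]<v\}|$. (The word RAM executes in unit time: arithmetic modulo $2^w$, integer division and remainder, bitwise logic, shifts, comparisons, the most significant bit of a word, reading at most $w$ consecutive bits of the read-only memory, and reading or writing a word of a working memory that is zero at the start of each query.) -/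

import Mathlib

/-! A word RAM whose words are the natural numbers below `2 ^ w`. A program has finitely many
registers, a read-only data memory (the bits of the data structure) and a read-write working
memory. Programs are built from unit-cost instructions by sequencing, branching and looping.
One program is used for all inputs and all word sizes. -/

namespace WordRAM

/-- Binary operations on words. -/
inductive BinOp : Type
  | add | sub | mul | div | mod | and | or | xor | shl | shr

/-- The value of a binary operation on `w`-bit words: unsigned integer arithmetic modulo `2 ^ w`,
bitwise logic, and shifts. -/
def BinOp.eval (w : ℕ) : BinOp → ℕ → ℕ → ℕ
  | .add, a, b => (a + b) % 2 ^ w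
  | .sub, a, b => (a + 2 ^ w - b) % 2 ^ w
  | .mul, a, b => (a * b) % 2 ^ w
  | .div, a, b => a / b
  | .mod, a, b => a % b
  | .and, a, b => a &&& b
  | .or, a, b => a ||| b
  | .xor, a, b => a ^^^ b
  | .shl, a, b => (a <<< b) % 2 ^ w
  | .shr, a, b => a >>> b

/-- Comparisons of two registers. -/
inductive Test : Type
  | lt (a b : ℕ)
  | eq (a b : ℕ)

/-- Primitive instructions. All arguments are register numbers, except for the literal `k` in
`const`. -/
inductive Instr : Type
  /-- `dst := k` -/
  | const (dst k : ℕ)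
  /-- `dst := a op b` -/
  | op (o : BinOp) (dst a b : ℕ)
  /-- `dst :=` index of the most significant set bit of `a` -/
  | log2 (dst a : ℕ)
  /-- `dst :=` the number formed by `len` consecutive data bits (at most one word of them)
  starting at bit address `addr` -/
  | fetch (dst addr len : ℕ)
  /-- `dst := work[addr]` -/
  | load (dst addr : ℕ)
  /-- `work[addr] := src` -/
  | store (addr src : ℕ)

/-- Programs. -/
inductive Prog : Type
  | skip
  | instr (I : Instr)
  | seq (P Q : Prog)
  | ite (b : Test) (P Q : Prog)
  | loop (b : Test) (P : Prog)

/-- The part of the machine that a program can change: registers and working memory. -/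
structure State where
  reg : ℕ → ℕ
  work : ℕ → ℕ

/-- The number whose binary digits, least significant first, are the `len` bits of `D` that start
at position `a`; positions beyond the end of `D` read as `0`. -/
def readBits (D : List Bool) (a len : ℕ) : ℕ :=
  ∑ t ∈ Finset.range len, if D.getD (a + t) false then 2 ^ t else 0

def State.setReg (s : State) (r v : ℕ) : State :=
  { s with reg := Function.update s.reg r v }

def State.setWork (s : State) (a v : ℕ) : State :=
  { s with work := Function.update s.work a v }

def Test.Holds (s : State) : Test → Prop
  | .lt a b => s.reg a < s.reg b
  | .eq a b => s.reg a = s.reg b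

/-- The effect of one instruction with word size `w` and read-only data `D`. -/
def Instr.step (w : ℕ) (D : List Bool) (s : State) : Instr → State
  | .const dst k => s.setReg dst (k % 2 ^ w)
  | .op o dst a b => s.setReg dst (o.eval w (s.reg a) (s.reg b))
  | .log2 dst a => s.setReg dst (Nat.log2 (s.reg a))
  | .fetch dst addr len => s.setReg dst (readBits D (s.reg addr) (min (s.reg len) w))
  | .load dst addr => s.setReg dst (s.work (s.reg addr))
  | .store addr src => s.setWork (s.reg addr) (s.reg src)

/-- `Exec w D P s s' t`: with word size `w` and read-only data `D`, the program `P` started in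
state `s` halts in state `s'` after `t` time steps. Every instruction and every evaluation of a
test takes one step. -/
inductive Exec (w : ℕ) (D : List Bool) : Prog → State → State → ℕ → Prop
  | skip (s : State) : Exec w D .skip s s 0
  | instr (I : Instr) (s : State) : Exec w D (.instr I) s (I.step w D s) 1
  | seq {P Q : Prog} {s₁ s₂ s₃ : State} {t₁ t₂ : ℕ} :
      Exec w D P s₁ s₂ t₁ → Exec w D Q s₂ s₃ t₂ → Exec w D (.seq P Q) s₁ s₃ (t₁ + t₂)
  | ite_true {b : Test} {P Q : Prog} {s s₁ : State} {t : ℕ} :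
      b.Holds s → Exec w D P s s₁ t → Exec w D (.ite b P Q) s s₁ (t + 1)
  | ite_false {b : Test} {P Q : Prog} {s s₁ : State} {t : ℕ} :
      ¬ b.Holds s → Exec w D Q s s₁ t → Exec w D (.ite b P Q) s s₁ (t + 1)
  | loop_false {b : Test} {P : Prog} {s : State} :
      ¬ b.Holds s → Exec w D (.loop b P) s s 1
  | loop_true {b : Test} {P : Prog} {s₁ s₂ s₃ : State} {t₁ t₂ : ℕ} :
      b.Holds s₁ → Exec w D P s₁ s₂ t₁ → Exec w D (.loop b P) s₂ s₃ t₂ →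
      Exec w D (.loop b P) s₁ s₃ (t₁ + t₂ + 1)

/-- The initial state: the arguments are in registers `0, 1, 2, …` (as `w`-bit words), all other
registers and the working memory are zero. -/
def initState (w : ℕ) (args : List ℕ) : State where
  reg := fun r => args.getD r 0 % 2 ^ w
  work := fun _ => 0

end WordRAM

namespace RangeNextValue

/-- The number of distinct values in `S[1, n]`. -/
def numDistinct (S : ℕ → ℕ) (n : ℕ) : ℕ :=
  ((Finset.Icc 1 n).image S).card

/-- `v` is the smallest value `S[r] ≥ x` with `i ≤ r ≤ j`. -/
def IsNextValue (S : ℕ → ℕ) (i j x v : ℕ) : Prop :=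
  IsLeast {y | x ≤ y ∧ ∃ r, i ≤ r ∧ r ≤ j ∧ S r = y} v

/-- `p` is the position of the first occurrence of `v` in `S[i, j]`. -/
def IsFirstOccurrence (S : ℕ → ℕ) (i j v p : ℕ) : Prop :=
  IsLeast {r | i ≤ r ∧ r ≤ j ∧ S r = v} p

/-- The smallest rank (counted from `1`) of `v` in the multiset `S[i, j]` in sorted order. -/
def smallestRank (S : ℕ → ℕ) (i j v : ℕ) : ℕ :=
  ((Finset.Icc i j).filter (fun r => S r < v)).card + 1

/-- The final registers answer the query `(i, j, x)`: either register `0` is `1`, and registers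
`1`, `2`, `3` hold the next value, the position of its first occurrence in the range, and its
smallest rank in the range; or register `0` is `0` and no element of the range is `≥ x`. -/
def Answers (S : ℕ → ℕ) (i j x : ℕ) (reg : ℕ → ℕ) : Prop :=
  (reg 0 = 1 ∧ IsNextValue S i j x (reg 1) ∧ IsFirstOccurrence S i j (reg 1) (reg 2) ∧
      reg 3 = smallestRank S i j (reg 1)) ∨
    (reg 0 = 0 ∧ ∀ r, i ≤ r → r ≤ j → S r < x)

end RangeNextValue

/-! Replace the entries of `S` by their dense ranks among the `u` distinct values (`exists_ranks`).
The ranks are kept in a wavelet matrix with `ℓ = clog 2 u` levels of `n` bits. The increasing map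
`val` from ranks to values is kept in Elias–Fano form: `log2 (σ / u)` low bits per value verbatim,
the high parts in unary within `3 * u` bits. Since `u ≤ n`, the sum `n * ℓ + u * log2 (σ / u)` is at
most `n (log u + 1) + n (log σ - log u)`, which is `n log σ + n`; everything else only has to be
`O(n)`.

A binary search in `val` gives the number `a` of values below `x`. A descent through the wavelet
matrix along the bits of `a` counts the elements of the range with rank below `a`; let `c` be this
count. If `c` is less than the length of the range, the element at index `c` of the sorted range is
the next value, and `c + 1` is its smallest rank. A second descent finds this element `v`. At the
last level the range consists of the occurrences of `v` in their original order, so its left end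
belongs to the first occurrence, and selection leads from there back to a position of `S`
(`count_runs`, `find_runs`, `path_eq_of_first`, `ascent_runs`). Each level and each step of the
binary search takes a bounded number of rank and selection operations.

The crux is therefore constant-time rank and selection on a string `B` of about `n * ℓ` bits with
only `O(n)` additional bits, that is, `O(1)` bits per cell of about `log n` bits (`exists_bitIndex`,
`rank_eval`, `sel_runs`). Here `F` is about a quarter of `√(log n)`, a cell has `F ^ 2` bits, and
nodes of fan-out `F` lead from cells up to regions of `F ^ 8` bits. A separate counter for each cell
would cost about `log F` bits, which is too much. Instead `exists_split` recodes a cell as a pair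
`(hi, lo)` that is one bit longer than the cell and whose short part `hi` already determines the
number of ones. From `F ^ 3` bits upwards counters of `O(F)` bits are affordable. Whatever depends
only on the content of a cell or a node is tabulated; these tables have `2 ^ (8 * F ^ 2 + O(F))`
bits, which is `O(n)` by the choice of `F`. -/

namespace WordRAM

/-! ### Compiling word expressions, and a calculus of timed runs -/

/-- The number of steps of a loop-free program, at most. -/
def Prog.cost : Prog → ℕ
  | .skip => 0
  | .instr _ => 1
  | .seq P Q => P.cost + Q.cost
  | .ite _ P Q => P.cost + Q.cost + 1
  -- Loops contribute nothing here: their time is added separately, with the number of iterations,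
  -- by `Runs.loop`.
  | .loop _ _ => 0

/-- Word expressions over variables. Variable `x` lives in register `2 * x`; the registers with
odd numbers hold intermediate results. -/
inductive Expr : Type
  | var (x : ℕ)
  | lit (k : ℕ)
  | bin (o : BinOp) (a b : Expr)
  | log (a : Expr)
  | fetch (a l : Expr)
  | cond (a b c d : Expr)

namespace Expr

instance : Add Expr := ⟨bin .add⟩
instance : Sub Expr := ⟨bin .sub⟩
instance : Mul Expr := ⟨bin .mul⟩
instance : Div Expr := ⟨bin .div⟩
instance : Mod Expr := ⟨bin .mod⟩

/-- The value of an expression; `cond a b c d` is `c` if `a < b` and `d` otherwise. -/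
def eval (w : ℕ) (D : List Bool) (ρ : ℕ → ℕ) : Expr → ℕ
  | var x => ρ x
  | lit k => k % 2 ^ w
  | bin o a b => o.eval w (a.eval w D ρ) (b.eval w D ρ)
  | log a => Nat.log2 (a.eval w D ρ)
  | fetch a l => readBits D (a.eval w D ρ) (min (l.eval w D ρ) w)
  | cond a b c d => if a.eval w D ρ < b.eval w D ρ then c.eval w D ρ else d.eval w D ρ

/-- Code that leaves the value of an expression in register `2 * t + 1`. -/
def code : Expr → ℕ → Prog
  | var x, t => .instr (.op .or (2 * t + 1) (2 * x) (2 * x))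
  | lit k, t => .instr (.const (2 * t + 1) k)
  | bin o a b, t => .seq (a.code t) (.seq (b.code (t + 1))
      (.instr (.op o (2 * t + 1) (2 * t + 1) (2 * (t + 1) + 1))))
  | log a, t => .seq (a.code t) (.instr (.log2 (2 * t + 1) (2 * t + 1)))
  | fetch a l, t => .seq (a.code t) (.seq (l.code (t + 1))
      (.instr (.fetch (2 * t + 1) (2 * t + 1) (2 * (t + 1) + 1))))
  | cond a b c d, t => .seq (a.code t) (.seq (b.code (t + 1))
      (.ite (.lt (2 * t + 1) (2 * (t + 1) + 1)) (c.code t) (d.code t)))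

end Expr

/-- The variables of a state. -/
def State.env (s : State) : ℕ → ℕ := fun x => s.reg (2 * x)

/-- `s'` differs from `s` only in odd registers from `2 * t + 1` on. -/
def SameBelow (t : ℕ) (s s' : State) : Prop :=
  s'.env = s.env ∧ ∀ r < t, s'.reg (2 * r + 1) = s.reg (2 * r + 1)

theorem SameBelow.trans {t t' : ℕ} {s s' s'' : State} (h : SameBelow t s s')
    (h' : SameBelow t' s' s'') (ht : t ≤ t') : SameBelow t s s'' :=
  ⟨h'.1.trans h.1, fun r hr => (h'.2 r (hr.trans_le ht)).trans (h.2 r hr)⟩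

theorem sameBelow_setReg (t : ℕ) (s : State) (v : ℕ) :
    SameBelow t s (s.setReg (2 * t + 1) v) := by
  refine ⟨?_, fun r hr => ?_⟩
  · funext x
    have : 2 * x ≠ 2 * t + 1 := by omega
    simp [State.env, State.setReg, Function.update_of_ne this]
  · have : 2 * r + 1 ≠ 2 * t + 1 := by omega
    simp only [State.setReg, Function.update_of_ne this]

theorem setReg_self (s : State) (r v : ℕ) : (s.setReg r v).reg r = v := by
  simp [State.setReg]

/-- The odd registers act as a stack of height `t`. Code at height `t` never writes below `2 * t +
1`, so a first operand survives the evaluation of the second one at height `t + 1`. -/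
theorem Expr.exec_code (w : ℕ) (D : List Bool) (e : Expr) : ∀ (t : ℕ) (s : State),
    ∃ s' k, Exec w D (e.code t) s s' k ∧ k ≤ (e.code t).cost ∧
      s'.reg (2 * t + 1) = e.eval w D s.env ∧ SameBelow t s s' := by
  induction e with
  | var x =>
    intro t s
    exact ⟨_, _, .instr _ _, le_rfl, by simp [Instr.step, setReg_self, eval, BinOp.eval, State.env],
      sameBelow_setReg _ _ _⟩
  | lit k =>
    intro t s
    exact ⟨_, _, .instr _ _, le_rfl, by simp [Instr.step, setReg_self, eval],
      sameBelow_setReg _ _ _⟩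
  | bin o a b iha ihb =>
    intro t s
    obtain ⟨s1, k1, e1, c1, v1, f1⟩ := iha t s
    obtain ⟨s2, k2, e2, c2, v2, f2⟩ := ihb (t + 1) s1
    refine ⟨_, _, .seq e1 (.seq e2 (.instr _ _)), by simp only [code, Prog.cost]; omega, ?_,
      (f1.trans f2 (by omega)).trans (sameBelow_setReg _ _ _) le_rfl⟩
    simp only [Instr.step, setReg_self, eval]
    rw [v2, f2.2 t (by omega), v1, f1.1]
  | log a iha =>
    intro t s
    obtain ⟨s1, k1, e1, c1, v1, f1⟩ := iha t s
    refine ⟨_, _, .seq e1 (.instr _ _), by simp only [code, Prog.cost]; omega, ?_,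
      f1.trans (sameBelow_setReg _ _ _) le_rfl⟩
    simp only [Instr.step, setReg_self, eval, v1]
  | fetch a b iha ihb =>
    intro t s
    obtain ⟨s1, k1, e1, c1, v1, f1⟩ := iha t s
    obtain ⟨s2, k2, e2, c2, v2, f2⟩ := ihb (t + 1) s1
    refine ⟨_, _, .seq e1 (.seq e2 (.instr _ _)), by simp only [code, Prog.cost]; omega, ?_,
      (f1.trans f2 (by omega)).trans (sameBelow_setReg _ _ _) le_rfl⟩
    simp only [Instr.step, setReg_self, eval]
    rw [v2, f2.2 t (by omega), v1, f1.1]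
  | cond a b c d iha ihb ihc ihd =>
    intro t s
    obtain ⟨s1, k1, e1, c1, v1, f1⟩ := iha t s
    obtain ⟨s2, k2, e2, c2, v2, f2⟩ := ihb (t + 1) s1
    have f12 := f1.trans f2 (by omega)
    by_cases hb : a.eval w D s.env < b.eval w D s.env
    · obtain ⟨s3, k3, e3, c3, v3, f3⟩ := ihc t s2
      refine ⟨_, _, .seq e1 (.seq e2 (.ite_true ?_ e3)), by simp only [code, Prog.cost]; omega, ?_,
        f12.trans f3 le_rfl⟩
      · simp only [Test.Holds]
        rwa [v2, f2.2 t (by omega), v1, f1.1]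
      · rw [v3, f12.1]; simp only [eval, if_pos hb]
    · obtain ⟨s3, k3, e3, c3, v3, f3⟩ := ihd t s2
      refine ⟨_, _, .seq e1 (.seq e2 (.ite_false ?_ e3)), by simp only [code, Prog.cost]; omega, ?_,
        f12.trans f3 le_rfl⟩
      · simp only [Test.Holds]
        rwa [v2, f2.2 t (by omega), v1, f1.1]
      · rw [v3, f12.1]; simp only [eval, if_neg hb]

/-- The assignment `x := e`. -/
def asg (x : ℕ) (e : Expr) : Prog := .seq (e.code 0) (.instr (.op .or (2 * x) 1 1))

/-- The program takes variables `ρ` to variables `ρ'` within time `T`. -/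
def Runs (w : ℕ) (D : List Bool) (P : Prog) (ρ ρ' : ℕ → ℕ) (T : ℕ) : Prop :=
  ∀ s : State, s.env = ρ → ∃ s' t, Exec w D P s s' t ∧ t ≤ T ∧ s'.env = ρ'

section
variable {w : ℕ} {D : List Bool} {P Q : Prog} {ρ ρ' ρ'' : ℕ → ℕ} {T T' : ℕ}

theorem Runs.mono (h : Runs w D P ρ ρ' T) (hT : T ≤ T') : Runs w D P ρ ρ' T' := fun s hs => by
  obtain ⟨s', t, h1, h2, h3⟩ := h s hs
  exact ⟨s', t, h1, h2.trans hT, h3⟩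

theorem Runs.skip : Runs w D .skip ρ ρ 0 := fun s hs => ⟨s, 0, .skip s, le_rfl, hs⟩

theorem Runs.seq (h : Runs w D P ρ ρ' T) (h' : Runs w D Q ρ' ρ'' T') :
    Runs w D (.seq P Q) ρ ρ'' (T + T') := fun s hs => by
  obtain ⟨s1, t1, e1, l1, a1⟩ := h s hs
  obtain ⟨s2, t2, e2, l2, a2⟩ := h' s1 a1
  exact ⟨s2, _, .seq e1 e2, by omega, a2⟩

theorem Runs.asg {x v : ℕ} {e : Expr} (hv : e.eval w D ρ = v) :
    Runs w D (asg x e) ρ (Function.update ρ x v) (asg x e).cost := fun s hs => by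
  obtain ⟨s1, t1, e1, l1, v1, f1⟩ := e.exec_code w D 0 s
  refine ⟨_, _, .seq e1 (.instr _ _), by simp only [WordRAM.asg, Prog.cost]; omega, ?_⟩
  funext y
  have h1 : s1.reg 1 = v := by rw [← hv, ← hs]; exact v1
  by_cases hy : y = x
  · subst hy
    simp [Instr.step, State.env, setReg_self, BinOp.eval, h1]
  · have h2 : 2 * y ≠ 2 * x := by omega
    rw [Function.update_of_ne hy, ← hs, ← f1.1]
    simp [Instr.step, State.env, State.setReg, Function.update_of_ne h2]

theorem Runs.asg_seq {x v : ℕ} {e : Expr} (hv : e.eval w D ρ = v)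
    (h : Runs w D P (Function.update ρ x v) ρ' P.cost) :
    Runs w D (.seq (WordRAM.asg x e) P) ρ ρ' (Prog.seq (WordRAM.asg x e) P).cost :=
  (Runs.asg hv).seq h

/-- A loop whose invariant carries a decreasing measure. -/
theorem Runs.loop {a b : ℕ} {T : ℕ} (Inv : ℕ → (ℕ → ℕ) → Prop)
    (step : ∀ m ρ, Inv m ρ → ρ a < ρ b → ∃ ρ' m', m' < m ∧ Runs w D P ρ ρ' T ∧ Inv m' ρ')
    (m : ℕ) (hρ : Inv m ρ) :
    ∃ ρ' m', Runs w D (.loop (.lt (2 * a) (2 * b)) P) ρ ρ' (m * (T + 1) + 1) ∧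
      Inv m' ρ' ∧ ¬ ρ' a < ρ' b := by
  induction m using Nat.strong_induction_on generalizing ρ with
  | _ m ih =>
    by_cases hb : ρ a < ρ b
    · obtain ⟨ρ1, m1, hm, h1, h2⟩ := step m ρ hρ hb
      obtain ⟨ρ2, m2, h3, h4⟩ := ih m1 hm h2
      refine ⟨ρ2, m2, fun s hs => ?_, h4⟩
      obtain ⟨s1, t1, e1, l1, a1⟩ := h1 s hs
      obtain ⟨s2, t2, e2, l2, a2⟩ := h3 s1 a1
      refine ⟨s2, _, .loop_true ?_ e1 e2, ?_, a2⟩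
      · subst hs; exact hb
      · have := Nat.mul_le_mul_right (T + 1) hm
        rw [Nat.succ_mul] at this
        omega
    · refine ⟨ρ, m, fun s hs => ⟨s, _, .loop_false ?_, by omega, hs⟩, hρ, hb⟩
      subst hs; exact hb

theorem Runs.ite_true {a b : ℕ} (hb : ρ a < ρ b) (h : Runs w D P ρ ρ' T) :
    Runs w D (.ite (.lt (2 * a) (2 * b)) P Q) ρ ρ' (T + 1) := fun s hs => by
  obtain ⟨s1, t1, e1, l1, a1⟩ := h s hs
  exact ⟨s1, _, .ite_true (by subst hs; exact hb) e1, by omega, a1⟩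

theorem Runs.ite_false {a b : ℕ} (hb : ¬ ρ a < ρ b) (h : Runs w D Q ρ ρ' T) :
    Runs w D (.ite (.lt (2 * a) (2 * b)) P Q) ρ ρ' (T + 1) := fun s hs => by
  obtain ⟨s1, t1, e1, l1, a1⟩ := h s hs
  exact ⟨s1, _, .ite_false (by subst hs; exact hb) e1, by omega, a1⟩

variable {a b c d : Expr} {x y z : ℕ}

theorem eval_add (ha : a.eval w D ρ = x) (hb : b.eval w D ρ = y) (h : x + y < 2 ^ w) :
    (a + b).eval w D ρ = x + y := by
  change BinOp.eval w .add (a.eval w D ρ) (b.eval w D ρ) = _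
  rw [ha, hb]; exact Nat.mod_eq_of_lt h

theorem eval_mul (ha : a.eval w D ρ = x) (hb : b.eval w D ρ = y) (h : x * y < 2 ^ w) :
    (a * b).eval w D ρ = x * y := by
  change BinOp.eval w .mul (a.eval w D ρ) (b.eval w D ρ) = _
  rw [ha, hb]; exact Nat.mod_eq_of_lt h

theorem eval_sub (ha : a.eval w D ρ = x) (hb : b.eval w D ρ = y) (h : x < 2 ^ w) (hyx : y ≤ x) :
    (a - b).eval w D ρ = x - y := by
  change BinOp.eval w .sub (a.eval w D ρ) (b.eval w D ρ) = _
  rw [ha, hb]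
  simp only [BinOp.eval]
  rw [show x + 2 ^ w - y = (x - y) + 2 ^ w by omega, Nat.add_mod_right]
  exact Nat.mod_eq_of_lt (by omega)

theorem eval_div (ha : a.eval w D ρ = x) (hb : b.eval w D ρ = y) :
    (a / b).eval w D ρ = x / y := by
  change BinOp.eval w .div (a.eval w D ρ) (b.eval w D ρ) = _
  rw [ha, hb]; rfl

theorem eval_mod (ha : a.eval w D ρ = x) (hb : b.eval w D ρ = y) :
    (a % b).eval w D ρ = x % y := by
  change BinOp.eval w .mod (a.eval w D ρ) (b.eval w D ρ) = _
  rw [ha, hb]; rfl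

theorem eval_shr (ha : a.eval w D ρ = x) (hb : b.eval w D ρ = y) :
    (Expr.bin .shr a b).eval w D ρ = x / 2 ^ y := by
  change BinOp.eval w .shr (a.eval w D ρ) (b.eval w D ρ) = _
  rw [ha, hb]; exact Nat.shiftRight_eq_div_pow _ _

theorem eval_shl (ha : a.eval w D ρ = x) (hb : b.eval w D ρ = y) (h : x * 2 ^ y < 2 ^ w) :
    (Expr.bin .shl a b).eval w D ρ = x * 2 ^ y := by
  change BinOp.eval w .shl (a.eval w D ρ) (b.eval w D ρ) = _
  rw [ha, hb]
  simp only [BinOp.eval, Nat.shiftLeft_eq]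
  exact Nat.mod_eq_of_lt h

theorem eval_lit {k : ℕ} (h : k < 2 ^ w) : (Expr.lit k).eval w D ρ = k := Nat.mod_eq_of_lt h

theorem eval_var {k : ℕ} : (Expr.var k).eval w D ρ = ρ k := rfl

theorem eval_log (ha : a.eval w D ρ = x) : (Expr.log a).eval w D ρ = Nat.log2 x := by
  simp only [Expr.eval, ha]

theorem eval_cond (ha : a.eval w D ρ = x) (hb : b.eval w D ρ = y) {u v : ℕ}
    (hc : x < y → c.eval w D ρ = u) (hd : ¬ x < y → d.eval w D ρ = v) :
    (Expr.cond a b c d).eval w D ρ = if x < y then u else v := by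
  simp only [Expr.eval, ha, hb]
  split_ifs with h
  exacts [hc h, hd h]

theorem eval_fetch (ha : a.eval w D ρ = x) (hb : b.eval w D ρ = y) (h : y ≤ w) :
    (Expr.fetch a b).eval w D ρ = readBits D x y := by
  simp only [Expr.eval, ha, hb, min_eq_left h]

end

/-! ### Arrays of fixed-width numbers in the read-only memory -/

theorem sum_testBit (v b : ℕ) :
    (∑ t ∈ Finset.range b, if v.testBit t then 2 ^ t else 0) = v % 2 ^ b := by
  induction b with
  | zero => simp [Nat.mod_one]
  | succ b ih =>
    rw [Finset.sum_range_succ, ih, Nat.mod_pow_succ, ← Nat.toNat_testBit]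
    cases v.testBit b <;> simp

theorem readBits_eq {D : List Bool} {a b v : ℕ} (hv : v < 2 ^ b)
    (h : ∀ t < b, D.getD (a + t) false = v.testBit t) : readBits D a b = v := by
  rw [readBits, ← Nat.mod_eq_of_lt hv, ← sum_testBit]
  refine Finset.sum_congr rfl fun t ht => ?_
  rw [h t (Finset.mem_range.1 ht)]

/-- An array of numbers of equal width. -/
structure Arr where
  len : ℕ
  width : ℕ
  val : ℕ → ℕ

def Arr.bits (A : Arr) : List Bool :=
  (List.range (A.len * A.width)).map fun p => (A.val (p / A.width)).testBit (p % A.width)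

theorem Arr.length_bits (A : Arr) : A.bits.length = A.len * A.width := by simp [Arr.bits]

theorem Arr.getD_bits (A : Arr) {k t : ℕ} (hk : k < A.len) (ht : t < A.width) :
    A.bits.getD (k * A.width + t) false = (A.val k).testBit t := by
  have h : k * A.width + t < A.len * A.width := by
    have := Nat.mul_le_mul_right A.width hk
    rw [Nat.succ_mul] at this
    omega
  have hw : 0 < A.width := by omega
  rw [List.getD_eq_getElem _ _ (by rwa [Arr.length_bits])]
  simp only [Arr.bits, List.getElem_map, List.getElem_range]
  rw [mul_comm, Nat.mul_add_div hw, Nat.mul_add_mod, Nat.mod_eq_of_lt ht, Nat.div_eq_of_lt ht,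
    add_zero]

theorem getD_append_right' {α : Type*} (l l' : List α) (p : ℕ) (d : α) :
    (l ++ l').getD (l.length + p) d = l'.getD p d := by
  rw [List.getD_eq_getElem?_getD, List.getElem?_append_right (Nat.le_add_right _ _),
    Nat.add_sub_cancel_left, List.getD_eq_getElem?_getD]

theorem getD_append_left' {α : Type*} (l l' : List α) (p : ℕ) (d : α) (h : p < l.length) :
    (l ++ l').getD p d = l.getD p d := by
  simp [List.getD_eq_getElem?_getD, List.getElem?_append_left h]

def arrsBits (arr : ℕ → Arr) (T : ℕ) : List Bool := (List.range T).flatMap fun t => (arr t).bits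

theorem arrsBits_succ (arr : ℕ → Arr) (T : ℕ) :
    arrsBits arr (T + 1) = arrsBits arr T ++ (arr T).bits := by
  simp [arrsBits, List.range_succ]

theorem length_arrsBits (arr : ℕ → Arr) (T : ℕ) :
    (arrsBits arr T).length = ∑ t ∈ Finset.range T, (arr t).len * (arr t).width := by
  induction T with
  | zero => simp [arrsBits]
  | succ T ih => rw [arrsBits_succ, List.length_append, ih, Finset.sum_range_succ, Arr.length_bits]

theorem getD_arrsBits (arr : ℕ → Arr) {T t p : ℕ} (ht : t < T)
    (hp : p < (arr t).len * (arr t).width) :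
    (arrsBits arr T).getD ((arrsBits arr t).length + p) false = (arr t).bits.getD p false := by
  induction T with
  | zero => omega
  | succ T ih =>
    rw [arrsBits_succ]
    rcases Nat.lt_succ_iff_lt_or_eq.1 ht with h | rfl
    · rw [getD_append_left', ih h]
      have h1 : (arrsBits arr (t + 1)).length ≤ (arrsBits arr T).length := by
        rw [length_arrsBits, length_arrsBits]
        exact Finset.sum_le_sum_of_subset (Finset.range_mono h)
      rw [arrsBits_succ, List.length_append, Arr.length_bits] at h1
      omega
    · rw [getD_append_right']

/-- The header entries `2 * t` and `2 * t + 1` are the address and the width of array `t`. -/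
def header (W : ℕ) (arr : ℕ → Arr) (T : ℕ) : Arr where
  len := 2 * T
  width := W
  val k := if k % 2 = 0 then 2 * T * W + (arrsBits arr (k / 2)).length else (arr (k / 2)).width

/-- Arrays in consecutive data bits, after a header with their addresses and widths. -/
def memory (W : ℕ) (arr : ℕ → Arr) (T : ℕ) : List Bool := (header W arr T).bits ++ arrsBits arr T

theorem length_memory (W : ℕ) (arr : ℕ → Arr) (T : ℕ) : (memory W arr T).length =
    2 * T * W + ∑ t ∈ Finset.range T, (arr t).len * (arr t).width := by
  rw [memory, List.length_append, Arr.length_bits, length_arrsBits]; rfl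

section
variable {W T : ℕ} {arr : ℕ → Arr} {t : ℕ}

theorem readBits_header (k : ℕ) (hk : k < 2 * T) (hv : (header W arr T).val k < 2 ^ W) :
    readBits (memory W arr T) (k * W) W = (header W arr T).val k := by
  refine readBits_eq hv fun b hb => ?_
  rw [memory, getD_append_left', ← (header W arr T).getD_bits hk hb]
  · rfl
  · rw [Arr.length_bits]
    have := Nat.mul_le_mul_right W hk
    rw [Nat.succ_mul] at this
    change _ < 2 * T * W
    omega

theorem readBits_array (ht : t < T) {k : ℕ} (hk : k < (arr t).len)
    (hv : (arr t).val k < 2 ^ (arr t).width) :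
    readBits (memory W arr T) (2 * T * W + (arrsBits arr t).length + k * (arr t).width)
      (arr t).width = (arr t).val k := by
  refine readBits_eq hv fun b hb => ?_
  have h1 : k * (arr t).width + b < (arr t).len * (arr t).width := by
    have := Nat.mul_le_mul_right (arr t).width hk
    rw [Nat.succ_mul] at this
    omega
  have h2 : (header W arr T).bits.length = 2 * T * W := Arr.length_bits _
  rw [memory, ← h2, add_assoc, add_assoc, getD_append_right', getD_arrsBits arr ht h1,
    Arr.getD_bits _ hk hb]

theorem array_end_le (ht : t < T) : 2 * T * W + (arrsBits arr t).length +
    (arr t).len * (arr t).width ≤ (memory W arr T).length := by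
  rw [length_memory, length_arrsBits, add_assoc, ← Finset.sum_range_succ]
  exact Nat.add_le_add_left (Finset.sum_le_sum_of_subset (Finset.range_mono ht)) _

theorem array_start_le (ht : t < T) : (arrsBits arr t).length ≤ (arrsBits arr (T - 1)).length := by
  rw [length_arrsBits, length_arrsBits]
  exact Finset.sum_le_sum_of_subset (Finset.range_mono (by omega))

end

/-- The header entry `k`; variable `5` is the width of the header entries. -/
def hdr (k : ℕ) : Expr := .fetch (.lit k * .var 5) (.var 5)

/-- The element with index `e` of array `t`, which has width `wd`. -/
def tabW (t : ℕ) (wd e : Expr) : Expr := .fetch (hdr (2 * t) + e * wd) wd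

/-- The element with index `e` of array `t`. -/
def tab (t : ℕ) (e : Expr) : Expr := tabW t (hdr (2 * t + 1)) e

/-- `tab t` reads the elements of `A` in every environment with header width `W`. -/
def IsTab (w : ℕ) (D : List Bool) (W t : ℕ) (A : Arr) : Prop :=
  ∀ (ρ : ℕ → ℕ) (e : Expr) (k : ℕ), ρ 5 = W → e.eval w D ρ = k → k < A.len →
    (tab t e).eval w D ρ = A.val k

section
variable {w W T : ℕ} {arr : ℕ → Arr} {t : ℕ}

theorem hdr_eval (hWw : W ≤ w) (hlen : (memory W arr T).length < 2 ^ w) {ρ : ℕ → ℕ}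
    (hρ : ρ 5 = W) {k : ℕ} (hk : k < 2 * T) (hv : (header W arr T).val k < 2 ^ W)
    (hT : 2 * T < 2 ^ w) :
    (hdr k).eval w (memory W arr T) ρ = (header W arr T).val k := by
  rw [← readBits_header k hk hv]
  refine eval_fetch (eval_mul (eval_lit (by omega)) hρ ?_) hρ hWw
  refine lt_of_le_of_lt ?_ hlen
  rw [length_memory]
  exact (Nat.mul_le_mul_right W hk.le).trans (Nat.le_add_right _ _)

/-- Only the start of the last array has to fit into a header word of `W` bits; its end merely has
to be below `2 ^ w`. The width comes from a separate expression. Both liberties are needed for the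
low bits of the values, whose size depends on `σ` while `W` is of order `log n`. -/
theorem tabW_eval (hWw : W ≤ w) (hlen : (memory W arr T).length < 2 ^ w)
    (hT : 2 * T < 2 ^ w) (ht : t < T)
    (hbase : 2 * T * W + (arrsBits arr (T - 1)).length < 2 ^ W)
    (hw : (arr t).width ≤ w) {ρ : ℕ → ℕ} {e wd : Expr} {k : ℕ} (hρ : ρ 5 = W)
    (he : e.eval w (memory W arr T) ρ = k)
    (hwd : wd.eval w (memory W arr T) ρ = (arr t).width)
    (hk : k < (arr t).len) (hv : (arr t).val k < 2 ^ (arr t).width) :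
    (tabW t wd e).eval w (memory W arr T) ρ = (arr t).val k := by
  rw [← readBits_array (W := W) ht hk hv]
  have h1 := array_end_le (W := W) (arr := arr) ht
  have h2 := array_start_le (arr := arr) ht
  have h3 : k * (arr t).width ≤ (arr t).len * (arr t).width := Nat.mul_le_mul_right _ hk.le
  have h0 : (header W arr T).val (2 * t) = 2 * T * W + (arrsBits arr t).length := by
    simp [header]
  refine eval_fetch (eval_add ?_ (eval_mul he hwd (by omega)) (by omega)) hwd hw
  rw [hdr_eval hWw hlen hρ (by omega) (by omega) hT, h0]

theorem isTab_memory (hWw : W ≤ w) (hlen : (memory W arr T).length < 2 ^ w)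
    (hT : 2 * T < 2 ^ w) (ht : t < T)
    (hbase : 2 * T * W + (arrsBits arr (T - 1)).length < 2 ^ W)
    (hw : (arr t).width ≤ W)
    (hv : ∀ k < (arr t).len, (arr t).val k < 2 ^ (arr t).width) :
    IsTab w (memory W arr T) W t (arr t) := by
  intro ρ e k hρ he hk
  have h0 : (header W arr T).val (2 * t + 1) = (arr t).width := by
    simp only [header]
    rw [if_neg (by omega), show (2 * t + 1) / 2 = t by omega]
  refine tabW_eval hWw hlen hT ht hbase (hw.trans hWw) hρ he ?_ hk (hv k hk)
  rw [hdr_eval hWw hlen hρ (by omega) _ hT, h0]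
  rw [h0]
  exact hw.trans_lt Nat.lt_two_pow_self

end

end WordRAM

namespace RangeNextValue

open WordRAM

/-! ### Counting bits -/

/-- The number of positions below `p` at which `B` is `b`. -/
def cnt (B : ℕ → Bool) (b : Bool) (p : ℕ) : ℕ := Nat.count (fun q => B q = b) p

section
variable {B : ℕ → Bool} {b : Bool} {p q : ℕ}

theorem cnt_zero : cnt B b 0 = 0 := Nat.count_zero _

theorem cnt_succ (B : ℕ → Bool) (b : Bool) (p : ℕ) :
    cnt B b (p + 1) = cnt B b p + if B p = b then 1 else 0 := Nat.count_succ _ _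

theorem cnt_mono (B : ℕ → Bool) (b : Bool) (h : p ≤ q) : cnt B b p ≤ cnt B b q :=
  Nat.count_monotone _ h

theorem cnt_add (B : ℕ → Bool) (b : Bool) (s p : ℕ) :
    cnt B b (s + p) = cnt B b s + cnt (fun t => B (s + t)) b p := Nat.count_add _ _ _

theorem cnt_le (B : ℕ → Bool) (b : Bool) (p : ℕ) : cnt B b p ≤ p := Nat.count_le _

theorem cnt_add_le (B : ℕ → Bool) (b : Bool) (s p : ℕ) : cnt B b (s + p) ≤ cnt B b s + p := by
  rw [cnt_add]; exact Nat.add_le_add_left (cnt_le _ _ _) _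

theorem cnt_false_add_true (B : ℕ → Bool) (p : ℕ) : cnt B false p + cnt B true p = p := by
  induction p with
  | zero => rfl
  | succ p ih =>
    rw [cnt_succ, cnt_succ]
    cases B p <;> simp <;> omega

theorem cnt_lt_cnt (hp : B p = b) (h : p < q) : cnt B b p < cnt B b q := by
  have h1 := cnt_mono B b (show p + 1 ≤ q from h)
  rw [cnt_succ, if_pos hp] at h1
  omega

theorem cnt_injective (hp : B p = b) (hq : B q = b) (h : cnt B b p = cnt B b q) : p = q := by
  rcases lt_trichotomy p q with h1 | h1 | h1
  · exact absurd h (cnt_lt_cnt hp h1).ne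
  · exact h1
  · exact absurd h (cnt_lt_cnt hq h1).ne'

theorem cnt_congr {B' : ℕ → Bool} (h : ∀ t < p, B t = B' t) : cnt B b p = cnt B' b p := by
  induction p with
  | zero => rfl
  | succ p ih =>
    rw [cnt_succ, cnt_succ, h p (by omega), ih fun t ht => h t (by omega)]

end

/-! ### Tabulation, packing and recoding -/

/-- A function that depends only on a numerical key can be tabulated. -/
theorem exists_table {X : Type*} (p : X → Prop) (key val : X → ℕ) {M : ℕ} (hM : 0 < M)
    (h : ∀ x y, p x → p y → key x = key y → val x = val y) (hb : ∀ x, p x → val x < M) :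
    ∃ T : ℕ → ℕ, (∀ k, T k < M) ∧ ∀ x, p x → T (key x) = val x := by
  classical
  -- Keys that do not occur get the entry `0`, which is admissible because `0 < M`.
  refine ⟨fun k => if hk : ∃ x, p x ∧ key x = k then val hk.choose else 0, fun k => ?_,
    fun x hx => ?_⟩
  · dsimp only
    split_ifs with hk
    exacts [hb _ hk.choose_spec.1, hM]
  · have hk : ∃ y, p y ∧ key y = key x := ⟨x, hx, rfl⟩
    dsimp only
    rw [dif_pos hk]
    exact h _ _ hk.choose_spec.1 hx hk.choose_spec.2

/-- Tuples of `F` numbers of `lam` bits can be packed into `F * lam` bits. -/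
theorem exists_pack (F lam : ℕ) : ∃ pk : (ℕ → ℕ) → ℕ, (∀ g, pk g < 2 ^ (F * lam)) ∧
    ∀ g g', (∀ j, g j < 2 ^ lam) → (∀ j, g' j < 2 ^ lam) → pk g = pk g' →
      ∀ j < F, g j = g' j := by
  have h0 : 0 < 2 ^ lam := Nat.two_pow_pos _
  -- The reduction makes packing total. Only injectivity on tuples of small numbers matters, because
  -- packed nodes are never unpacked by arithmetic but serve as keys of tables.
  let tup (g : ℕ → ℕ) : Fin F → Fin (2 ^ lam) := fun j => ⟨g j % 2 ^ lam, Nat.mod_lt _ h0⟩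
  refine ⟨fun g => finFunctionFinEquiv (tup g), fun g => ?_, fun g g' hg hg' h j hj => ?_⟩
  · rw [mul_comm, pow_mul]; exact (finFunctionFinEquiv (tup g)).2
  · have h1 := finFunctionFinEquiv.injective (Fin.ext h)
    have h2 := congrArg Fin.val (congrFun h1 ⟨j, hj⟩)
    simpa [tup, Nat.mod_eq_of_lt (hg j), Nat.mod_eq_of_lt (hg' j)] using h2

/-- An almost non-redundant split of the elements of `X` into two parts, such that the first part
determines the class of the element. -/
theorem exists_split {X : Type*} [Fintype X] (cls : X → ℕ) (m P : ℕ) (hP : 0 < P)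
    (hcls : ∀ x, cls x < m) : ∃ hi lo : X → ℕ,
      (∀ x, hi x < Fintype.card X / P + m) ∧ (∀ x, lo x < P) ∧
      (∀ x y, hi x = hi y → cls x = cls y) ∧
      ∀ x y, hi x = hi y → lo x = lo y → x = y := by
  classical
  let e := Fintype.equivFin X
  let N : ℕ → ℕ := fun c => (Finset.univ.filter fun y => cls y = c).card
  let R : X → ℕ := fun x => (Finset.univ.filter fun y => cls y = cls x ∧ e y < e x).card
  -- Within a class, elements are numbered by `R` and this number is divided by `P`. A class with `N
  -- c` elements reserves `N c / P + 1` consecutive codes for the quotient, so different classes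
  -- never share one. Rounding up costs at most one code per class, which gives the summand `m`.
  let base : ℕ → ℕ := fun c => ∑ c' ∈ Finset.range c, (N c' / P + 1)
  have hR : ∀ x, R x < N (cls x) := fun x => by
    refine Finset.card_lt_card (Finset.ssubset_iff_subset_ne.2 ⟨fun y hy => ?_, fun h => ?_⟩)
    · simp only [Finset.mem_filter, Finset.mem_univ, true_and] at hy ⊢
      exact hy.1
    · have : x ∈ Finset.univ.filter fun y => cls y = cls x ∧ e y < e x := by rw [h]; simp
      simp at this
  have hRlt : ∀ x y, cls x = cls y → e x < e y → R x < R y := fun x y hc hxy => by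
    refine Finset.card_lt_card (Finset.ssubset_iff_subset_ne.2 ⟨fun z hz => ?_, fun h => ?_⟩)
    · simp only [Finset.mem_filter, Finset.mem_univ, true_and] at hz ⊢
      exact ⟨hz.1.trans hc, hz.2.trans hxy⟩
    · have : x ∈ Finset.univ.filter fun z => cls z = cls x ∧ e z < e x := by
        rw [h]; simp [hc, hxy]
      simp at this
  have hRinj : ∀ x y, cls x = cls y → R x = R y → x = y := fun x y hc h => by
    rcases lt_trichotomy (e x) (e y) with h1 | h1 | h1
    · exact absurd h (hRlt x y hc h1).ne
    · exact e.injective h1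
    · exact absurd h (hRlt y x hc.symm h1).ne'
  have hbase : ∀ c c', c ≤ c' → base c ≤ base c' := fun c c' h =>
    Finset.sum_le_sum_of_subset (Finset.range_mono h)
  have hup : ∀ x, base (cls x) + R x / P < base (cls x + 1) := fun x => by
    have h1 : R x / P ≤ N (cls x) / P := Nat.div_le_div_right (hR x).le
    simp only [base, Finset.sum_range_succ]
    omega
  have hclass : ∀ x y, base (cls x) + R x / P = base (cls y) + R y / P → cls x = cls y :=
    fun x y h => by
      have hx := hup x
      have hy := hup y
      generalize R x / P = i at *
      generalize R y / P = k at *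
      rcases lt_trichotomy (cls x) (cls y) with h1 | h1 | h1
      · have := hbase _ _ (show cls x + 1 ≤ cls y from h1); omega
      · exact h1
      · have := hbase _ _ (show cls y + 1 ≤ cls x from h1); omega
  refine ⟨fun x => base (cls x) + R x / P, fun x => R x % P, fun x => ?_,
    fun x => Nat.mod_lt _ hP, hclass, fun x y h h' => ?_⟩
  · refine (hup x).trans_le ((hbase _ _ (hcls x)).trans ?_)
    have h1 : ∑ c ∈ Finset.range m, N c = Fintype.card X :=
      (Finset.card_eq_sum_card_fiberwise (s := Finset.univ) (t := Finset.range m) (f := cls)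
        fun x _ => by simpa using hcls x).symm
    have h2 : ∑ c ∈ Finset.range m, N c / P ≤ Fintype.card X / P := by
      rw [Nat.le_div_iff_mul_le hP, Finset.sum_mul, ← h1]
      exact Finset.sum_le_sum fun c _ => Nat.div_mul_le_self _ _
    simp only [base, Finset.sum_add_distrib, Finset.sum_const, Finset.card_range, smul_eq_mul,
      mul_one]
    omega
  · have hc := hclass x y h
    dsimp only at h h'
    rw [hc] at h
    refine hRinj x y hc ?_
    rw [← Nat.div_add_mod (R x) P, ← Nat.div_add_mod (R y) P, h', Nat.add_left_cancel h]

section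
variable {B : ℕ → Bool} {F s : ℕ}

/-- The counts of ones in corresponding children agree, hence so do the counts of ones in all
prefixes. For zeros this follows because every child has exactly `s` bits. Differences are written
as sums to avoid truncated subtraction. -/
theorem cnt_prefix_congr {c c' : ℕ}
    (h : ∀ j < F, cnt B true ((c + j + 1) * s) + cnt B true ((c' + j) * s) =
      cnt B true ((c' + j + 1) * s) + cnt B true ((c + j) * s)) (b : Bool) :
    ∀ j ≤ F, cnt B b ((c + j) * s) + cnt B b (c' * s) =
      cnt B b ((c' + j) * s) + cnt B b (c * s) := by
  intro j
  induction j with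
  | zero => intro _; simp [add_comm]
  | succ j ih =>
    intro hj
    have h1 := h j hj
    have h2 := ih (by omega)
    have h3 := cnt_false_add_true B ((c + j + 1) * s)
    have h4 := cnt_false_add_true B ((c' + j) * s)
    have h5 := cnt_false_add_true B ((c' + j + 1) * s)
    have h6 := cnt_false_add_true B ((c + j) * s)
    have h7 : (c + j + 1) * s = (c + j) * s + s := by ring
    have h8 : (c' + j + 1) * s = (c' + j) * s + s := by ring
    rw [← add_assoc, ← add_assoc]
    cases b <;> omega

/-- The child of a node that contains a given occurrence of `b` is determined by the number of
preceding occurrences in the node and the counts of the children. -/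
theorem child_congr {b : Bool} {q q' ν ν' : ℕ} (hs : 0 < s) (hF : 0 < F)
    (hν : q / s / F = ν) (hν' : q' / s / F = ν') (hq : B q = b) (hq' : B q' = b)
    (h : ∀ j < F, cnt B true ((ν * F + j + 1) * s) + cnt B true ((ν' * F + j) * s) =
      cnt B true ((ν' * F + j + 1) * s) + cnt B true ((ν * F + j) * s))
    (hr : cnt B b q + cnt B b (ν' * F * s) = cnt B b q' + cnt B b (ν * F * s)) :
    q / s % F = q' / s % F := by
  have hp := cnt_prefix_congr h b
  have e1 : q / s = ν * F + q / s % F := by rw [← hν, mul_comm]; exact (Nat.div_add_mod _ _).symm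
  have e2 : q' / s = ν' * F + q' / s % F := by
    rw [← hν', mul_comm]; exact (Nat.div_add_mod _ _).symm
  have l1 : q / s % F < F := Nat.mod_lt _ hF
  have l2 : q' / s % F < F := Nat.mod_lt _ hF
  have a1 : q / s * s ≤ q := Nat.div_mul_le_self _ _
  have a2 : q' / s * s ≤ q' := Nat.div_mul_le_self _ _
  have b1 : q < (q / s + 1) * s := by rw [mul_comm]; exact Nat.lt_mul_div_succ _ hs
  have b2 : q' < (q' / s + 1) * s := by rw [mul_comm]; exact Nat.lt_mul_div_succ _ hs
  generalize q / s % F = j at *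
  generalize q' / s % F = j' at *
  rw [e1] at a1 b1
  rw [e2] at a2 b2
  rcases lt_trichotomy j j' with h1 | h1 | h1
  · exfalso
    have c1 := cnt_lt_cnt hq b1
    have c2 := cnt_mono B b a2
    have c3 := cnt_mono B b (Nat.mul_le_mul_right s (show ν' * F + (j + 1) ≤ ν' * F + j' by omega))
    have c4 := hp (j + 1) (by omega)
    rw [← add_assoc] at c3 c4
    rw [← add_assoc] at c4
    omega
  · exact h1
  · exfalso
    have c1 := cnt_lt_cnt hq' b2
    have c2 := cnt_mono B b a1
    have c3 := cnt_mono B b (Nat.mul_le_mul_right s (show ν * F + (j' + 1) ≤ ν * F + j by omega))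
    have c4 := hp (j' + 1) (by omega)
    rw [← add_assoc] at c3 c4
    rw [← add_assoc] at c4
    omega

end

/-! ### The index for rank and selection -/

/-- The bit length of `F`. -/
def bitLen (F : ℕ) : ℕ := Nat.log2 F + 1

/-- The width of counters that are relative to a region of `F ^ 8` bits. -/
def relWidth (F : ℕ) : ℕ := 8 * bitLen F

/-- The width of the labels of the children of the nodes of level `e`. -/
def labWidth (F e : ℕ) : ℕ := if e = 0 then 2 * bitLen F + 1 else relWidth F

theorem lt_two_pow_bitLen (F : ℕ) : F < 2 ^ bitLen F := Nat.lt_log2_self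

theorem bitLen_le {F : ℕ} (hF : 0 < F) : bitLen F ≤ F := (Nat.log2_lt hF.ne').2 Nat.lt_two_pow_self

theorem pow_lt_relWidth {F k : ℕ} (hF : 0 < F) (hk : k ≤ 8) : F ^ k < 2 ^ relWidth F := by
  refine (Nat.pow_le_pow_right hF hk).trans_lt ?_
  rw [relWidth, mul_comm, pow_mul]
  exact Nat.pow_lt_pow_left (lt_two_pow_bitLen F) (by norm_num)

theorem mul_add_inj {F a a' r r' : ℕ} (hr : r < F) (hr' : r' < F) (h : a * F + r = a' * F + r') :
    a = a' ∧ r = r' := by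
  have h0 : 0 < F := by omega
  have h1 := congrArg (· / F) h
  have h2 := congrArg (· % F) h
  simp only [mul_comm _ F, Nat.mul_add_div h0, Nat.div_eq_of_lt hr, Nat.div_eq_of_lt hr',
    Nat.mul_add_mod, Nat.mod_eq_of_lt hr, Nat.mod_eq_of_lt hr', add_zero] at h1 h2
  exact ⟨h1, h2⟩

theorem two_mul_add_toNat_inj {a a' : ℕ} {b b' : Bool} (h : 2 * a + b.toNat = 2 * a' + b'.toNat) :
    a = a' ∧ b = b' := by
  cases b <;> cases b' <;> simp at h ⊢ <;> omega

/-- The rank of position `q` among the bits with the value of bit `q`, relative to the aligned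
segment of `F ^ k` bits that contains `q`. -/
def relRank (B : ℕ → Bool) (F k q : ℕ) : ℕ :=
  cnt B (B q) q - cnt B (B q) (q / F ^ k * F ^ k)

theorem relRank_add (B : ℕ → Bool) (F k q : ℕ) :
    relRank B F k q + cnt B (B q) (q / F ^ k * F ^ k) = cnt B (B q) q :=
  Nat.sub_add_cancel (cnt_mono _ _ (Nat.div_mul_le_self _ _))

theorem relRank_lt {B : ℕ → Bool} {F k q : ℕ} (hF : 0 < F) (hk : k ≤ 8) :
    relRank B F k q < 2 ^ relWidth F := by
  refine lt_of_le_of_lt ?_ (pow_lt_relWidth hF hk)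
  have h1 := cnt_add_le B (B q) (q / F ^ k * F ^ k) (q % F ^ k)
  rw [mul_comm, Nat.div_add_mod, mul_comm] at h1
  have h2 : q % F ^ k < F ^ k := Nat.mod_lt _ (Nat.pow_pos hF)
  rw [relRank]
  omega

/-- Tables for rank and selection queries on the bits `B`, of which positions below `M` are
selected. Bits are grouped into cells of `F ^ 2` bits; a cell is represented by the two parts
`hi` and `lo`. Nodes of level `e` consist of `F ^ (e + 3)` bits and have `F` children. -/
structure BitIndex (B : ℕ → Bool) (F M : ℕ) where
  hi : ℕ → ℕ
  lo : ℕ → ℕ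
  node : ℕ → ℕ → ℕ
  pre : ℕ → ℕ
  hiOf : ℕ → ℕ
  inCell : ℕ → ℕ
  selRegion : ℕ → ℕ
  selExtra : ℕ → ℕ
  selCell : ℕ → ℕ
  child : ℕ → ℕ → ℕ
  childPre : ℕ → ℕ → ℕ
  hi_lt : ∀ c, hi c < 2 ^ (2 * bitLen F + 1)
  lo_lt : ∀ c, lo c < 2 ^ (F ^ 2 - 2 * bitLen F)
  node_lt : ∀ e ν, node e ν < 2 ^ (F * labWidth F e)
  pre_lt : ∀ k, pre k < 2 ^ relWidth F
  hiOf_lt : ∀ k, hiOf k < 2 ^ (2 * bitLen F + 1)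
  inCell_lt : ∀ k, inCell k < 2 ^ relWidth F
  selRegion_lt : ∀ k, selRegion k < M + 1
  selExtra_lt : ∀ k, selExtra k < M + 1
  selCell_lt : ∀ k, selCell k < 2 ^ relWidth F
  child_lt : ∀ e k, child e k < 2 ^ relWidth F
  childPre_lt : ∀ e k, childPre e k < 2 ^ relWidth F
  pre_spec : ∀ c, pre (node 0 (c / F) * F + c % F) =
    cnt B true (c * F ^ 2) - cnt B true (c / F * F * F ^ 2)
  hiOf_spec : ∀ c, hiOf (node 0 (c / F) * F + c % F) = hi c
  inCell_spec : ∀ q, inCell ((hi (q / F ^ 2) * 2 ^ (F ^ 2 - 2 * bitLen F) + lo (q / F ^ 2)) *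
    F ^ 2 + q % F ^ 2) = cnt B true q - cnt B true (q / F ^ 2 * F ^ 2)
  selRegion_spec : ∀ q < M, cnt B (B q) q % F ^ 4 = 0 →
    selRegion (2 * (cnt B (B q) q / F ^ 4) + (B q).toNat) = q / F ^ 8
  selExtra_spec : ∀ q < M, ∀ q', B q' = B q → cnt B (B q) q' = cnt B (B q) q / F ^ 4 * F ^ 4 →
    cnt B (B q) ((q' / F ^ 8 + 1) * F ^ 8) ≤ cnt B (B q) q →
    selExtra (2 * (q' / F ^ 8 * F ^ 4 + cnt B (B q) q % F ^ 4) + (B q).toNat) = q / F ^ 8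
  selCell_spec : ∀ q, selCell (2 * ((hi (q / F ^ 2) * 2 ^ (F ^ 2 - 2 * bitLen F) + lo (q / F ^ 2)) *
    2 ^ relWidth F + relRank B F 2 q) + (B q).toNat) = q % F ^ 2
  child_spec : ∀ e < 6, ∀ q, child e (2 * (node e (q / F ^ (e + 3)) * 2 ^ relWidth F +
    relRank B F (e + 3) q) + (B q).toNat) = q / F ^ (e + 2) % F
  childPre_spec : ∀ e < 6, ∀ q, childPre e (2 * (node e (q / F ^ (e + 3)) * 2 ^ relWidth F +
    relRank B F (e + 3) q) + (B q).toNat) = relRank B F (e + 3) q - relRank B F (e + 2) q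

section
variable (B : ℕ → Bool) (F M : ℕ)

/-- The representation of cells by two parts, the first of which determines the number of ones. -/
theorem exists_cell_split (hF : 2 ≤ F) : ∃ hi lo : ℕ → ℕ,
    (∀ c, hi c < 2 ^ (2 * bitLen F + 1)) ∧ (∀ c, lo c < 2 ^ (F ^ 2 - 2 * bitLen F)) ∧
    (∀ c c', hi c = hi c' → cnt B true ((c + 1) * F ^ 2) + cnt B true (c' * F ^ 2) =
      cnt B true ((c' + 1) * F ^ 2) + cnt B true (c * F ^ 2)) ∧
    ∀ c c', hi c = hi c' → lo c = lo c' → ∀ t < F ^ 2, B (c * F ^ 2 + t) = B (c' * F ^ 2 + t) := by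
  have hsq : 2 * bitLen F ≤ F ^ 2 := by
    have := bitLen_le (show 0 < F by omega)
    nlinarith
  let ext : (Fin (F ^ 2) → Bool) → ℕ → Bool := fun x t => if h : t < F ^ 2 then x ⟨t, h⟩ else false
  let con : ℕ → Fin (F ^ 2) → Bool := fun c t => B (c * F ^ 2 + t)
  have hcon : ∀ c, cnt (ext (con c)) true (F ^ 2) + cnt B true (c * F ^ 2) =
      cnt B true ((c + 1) * F ^ 2) := fun c => by
    rw [add_mul, one_mul, cnt_add, add_comm]
    congr 1
    refine cnt_congr fun t ht => ?_
    simp only [ext, con, dif_pos ht]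
  -- There are `2 ^ (F ^ 2)` cell contents in `F ^ 2 + 1` classes. With this divisor the first part
  -- has at most `2 ^ (2 * bitLen F) + F ^ 2 + 1` values, and `F ^ 2 < 2 ^ (2 * bitLen F)`. Both
  -- parts together take one bit more than the cell.
  obtain ⟨hi, lo, h1, h2, h3, h4⟩ := exists_split (fun x => cnt (ext x) true (F ^ 2)) (F ^ 2 + 1)
    (2 ^ (F ^ 2 - 2 * bitLen F)) (Nat.two_pow_pos _) fun x => Nat.lt_succ_of_le (cnt_le _ _ _)
  refine ⟨fun c => hi (con c), fun c => lo (con c), fun c => ?_, fun c => h2 _, fun c c' h => ?_,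
    fun c c' h h' t ht => ?_⟩
  · refine (h1 _).trans_le ?_
    have e1 : Fintype.card (Fin (F ^ 2) → Bool) = 2 ^ (F ^ 2) := by simp
    have e2 : F ^ 2 < 2 ^ (2 * bitLen F) := by
      rw [mul_comm, pow_mul]
      exact Nat.pow_lt_pow_left (lt_two_pow_bitLen F) (by norm_num)
    rw [e1, Nat.pow_div (Nat.sub_le _ _) (by norm_num), Nat.sub_sub_self hsq,
      pow_succ 2 (2 * bitLen F)]
    omega
  · have a1 := hcon c
    have a2 := hcon c'
    have a3 : cnt (ext (con c)) true (F ^ 2) = cnt (ext (con c')) true (F ^ 2) := h3 _ _ h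
    omega
  · exact congrFun (h4 _ _ h h') ⟨t, ht⟩

/-- The contents of nodes: a number that determines the counts of the children. -/
theorem exists_node (hF : 2 ≤ F) (hi : ℕ → ℕ) (hhi : ∀ c, hi c < 2 ^ (2 * bitLen F + 1))
    (hcnt : ∀ c c', hi c = hi c' → cnt B true ((c + 1) * F ^ 2) + cnt B true (c' * F ^ 2) =
      cnt B true ((c' + 1) * F ^ 2) + cnt B true (c * F ^ 2)) :
    ∃ node : ℕ → ℕ → ℕ, (∀ e ν, node e ν < 2 ^ (F * labWidth F e)) ∧
      (∀ ν ν', node 0 ν = node 0 ν' → ∀ j < F, hi (ν * F + j) = hi (ν' * F + j)) ∧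
      ∀ e < 6, ∀ ν ν', node e ν = node e ν' → ∀ j < F,
        cnt B true ((ν * F + j + 1) * F ^ (e + 2)) + cnt B true ((ν' * F + j) * F ^ (e + 2)) =
        cnt B true ((ν' * F + j + 1) * F ^ (e + 2)) + cnt B true ((ν * F + j) * F ^ (e + 2)) := by
  choose pk hpk hinj using exists_pack F
  -- On the lowest level the label of a child is the first part of its cell, which is part of the
  -- data itself and not an addition to it; above, it is the number of ones in the child.
  let lab : ℕ → ℕ → ℕ := fun e c => if e = 0 then hi c else
    cnt B true ((c + 1) * F ^ (e + 2)) - cnt B true (c * F ^ (e + 2))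
  have hlab : ∀ e < 6, ∀ c, lab e c < 2 ^ labWidth F e := fun e he c => by
    by_cases h0 : e = 0
    · simp only [lab, labWidth, if_pos h0]; exact hhi c
    · simp only [lab, labWidth, if_neg h0]
      refine lt_of_le_of_lt ?_ (pow_lt_relWidth (k := e + 2) (by omega) (by omega))
      have := cnt_add_le B true (c * F ^ (e + 2)) (F ^ (e + 2))
      rw [add_mul, one_mul]
      omega
  refine ⟨fun e ν => pk (labWidth F e) fun j => lab e (ν * F + j), fun e ν => hpk _ _,
    fun ν ν' h j hj => ?_, fun e he ν ν' h j hj => ?_⟩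
  · have := hinj _ _ _ (fun j => hlab 0 (by omega) _) (fun j => hlab 0 (by omega) _) h j hj
    simpa [lab] using this
  · have h1 := hinj _ _ _ (fun j => hlab e he _) (fun j => hlab e he _) h j hj
    by_cases h0 : e = 0
    · subst h0
      exact hcnt _ _ (by simpa [lab] using h1)
    · simp only [lab, if_neg h0] at h1
      have m1 := cnt_mono B true (Nat.mul_le_mul_right (F ^ (e + 2))
        (Nat.le_succ (ν * F + j)))
      have m2 := cnt_mono B true (Nat.mul_le_mul_right (F ^ (e + 2))
        (Nat.le_succ (ν' * F + j)))
      simp only [Nat.succ_eq_add_one] at m1 m2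
      omega

/-- If an occurrence belongs to an earlier group of `F ^ 4` occurrences than `q'`, and the group of
`q'` starts in region `ρ`, then it precedes the end of that region. So of all groups of one bit that
start in a region only the last can leave it. -/
theorem cnt_lt_of_div_lt {b : Bool} {q q' : ℕ} (hF : 0 < F)
    (h : cnt B b q / F ^ 4 < cnt B b q' / F ^ 4) {q₁ : ℕ} (h₁ : B q₁ = b)
    (hc : cnt B b q₁ = cnt B b q' / F ^ 4 * F ^ 4) {ρ : ℕ} (hρ : q₁ / F ^ 8 = ρ) :
    cnt B b q < cnt B b ((ρ + 1) * F ^ 8) := by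
  have h4 : 0 < F ^ 4 := Nat.pow_pos hF
  have h8 : 0 < F ^ 8 := Nat.pow_pos hF
  have e1 : cnt B b q < (cnt B b q / F ^ 4 + 1) * F ^ 4 := by
    rw [mul_comm]; exact Nat.lt_mul_div_succ _ h4
  have e2 := Nat.mul_le_mul_right (F ^ 4) (show cnt B b q / F ^ 4 + 1 ≤ cnt B b q' / F ^ 4 from h)
  have e3 : q₁ < (ρ + 1) * F ^ 8 := by
    rw [← hρ, mul_comm]; exact Nat.lt_mul_div_succ _ h8
  have := cnt_lt_cnt h₁ e3
  omega

end

/-- For each table it has to be checked that the key determines the entry. For `pre`, `hiOf`,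
`child` and `childPre` this is so because a node content determines the labels of its children, for
`inCell` and `selCell` because both parts of a cell determine its bits, and for `selRegion` because
bit and rank determine the position. -/
theorem exists_bitIndex (B : ℕ → Bool) (F M : ℕ) (hF : 2 ≤ F) : Nonempty (BitIndex B F M) := by
  have hF0 : 0 < F := by omega
  have hW : 0 < 2 ^ relWidth F := Nat.two_pow_pos _
  have hpow : ∀ k, 0 < F ^ k := fun k => Nat.pow_pos hF0
  obtain ⟨hi, lo, hhi, hlo, hones, hcell⟩ := exists_cell_split B F hF
  obtain ⟨node, hnode, hnhi, hncnt⟩ := exists_node B F hF hi hhi hones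
  have hmod : ∀ c, c / F * F + c % F = c := fun c => by rw [mul_comm]; exact Nat.div_add_mod _ _
  obtain ⟨pre, hpre, pre_spec⟩ := exists_table (fun _ : ℕ => True)
    (fun c => node 0 (c / F) * F + c % F)
    (fun c => cnt B true (c * F ^ 2) - cnt B true (c / F * F * F ^ 2)) hW
    (fun c c' _ _ h => by
      obtain ⟨h1, h2⟩ := mul_add_inj (Nat.mod_lt _ hF0) (Nat.mod_lt _ hF0) h
      have h3 := cnt_prefix_congr (hncnt 0 (by omega) _ _ h1) true (c % F) (Nat.mod_lt _ hF0).le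
      have h4 := hmod c'
      rw [← h2] at h4
      rw [hmod, h4] at h3
      have m1 := cnt_mono B true (Nat.mul_le_mul_right (F ^ 2) (Nat.div_mul_le_self c F))
      have m2 := cnt_mono B true (Nat.mul_le_mul_right (F ^ 2) (Nat.div_mul_le_self c' F))
      simp only [zero_add] at h3
      omega)
    (fun c _ => by
      have h1 := cnt_add_le B true (c / F * F * F ^ 2) (c % F * F ^ 2)
      rw [← add_mul, hmod] at h1
      have h2 : c % F * F ^ 2 ≤ F ^ 3 := by
        rw [pow_succ' F 2]; exact Nat.mul_le_mul_right _ (Nat.mod_lt _ hF0).le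
      have := pow_lt_relWidth (k := 3) hF0 (by omega)
      omega)
  obtain ⟨hiOf, hhiOf, hiOf_spec⟩ := exists_table (fun _ : ℕ => True)
    (fun c => node 0 (c / F) * F + c % F) hi (Nat.two_pow_pos (2 * bitLen F + 1))
    (fun c c' _ _ h => by
      obtain ⟨h1, h2⟩ := mul_add_inj (Nat.mod_lt _ hF0) (Nat.mod_lt _ hF0) h
      have := hnhi _ _ h1 _ (Nat.mod_lt c hF0)
      rw [hmod, h2, hmod] at this
      exact this) (fun c _ => hhi c)
  have hcode : ∀ c c', hi c * 2 ^ (F ^ 2 - 2 * bitLen F) + lo c =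
      hi c' * 2 ^ (F ^ 2 - 2 * bitLen F) + lo c' →
      ∀ t < F ^ 2, B (c * F ^ 2 + t) = B (c' * F ^ 2 + t) := fun c c' h => by
    obtain ⟨h1, h2⟩ := mul_add_inj (hlo c) (hlo c') h
    exact hcell c c' h1 h2
  have hincell : ∀ b q, cnt B b (q / F ^ 2 * F ^ 2) +
      cnt (fun t => B (q / F ^ 2 * F ^ 2 + t)) b (q % F ^ 2) = cnt B b q := fun b q => by
    rw [← cnt_add, mul_comm, Nat.div_add_mod]
  obtain ⟨inCell, hinCell, inCell_spec⟩ := exists_table (fun _ : ℕ => True)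
    (fun q => (hi (q / F ^ 2) * 2 ^ (F ^ 2 - 2 * bitLen F) + lo (q / F ^ 2)) * F ^ 2 + q % F ^ 2)
    (fun q => cnt B true q - cnt B true (q / F ^ 2 * F ^ 2)) hW
    (fun q q' _ _ h => by
      have l1 := Nat.mod_lt q (hpow 2)
      obtain ⟨h1, h2⟩ := mul_add_inj l1 (Nat.mod_lt q' (hpow 2)) h
      have h3 := hincell true q
      have h4 := hincell true q'
      rw [cnt_congr fun t ht => hcode _ _ h1 t (ht.trans l1), h2] at h3
      omega)
    (fun q _ => by
      have h3 := hincell true q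
      have h4 := cnt_le (fun t => B (q / F ^ 2 * F ^ 2 + t)) true (q % F ^ 2)
      have l1 := Nat.mod_lt q (hpow 2)
      have := pow_lt_relWidth (k := 2) hF0 (by omega)
      omega)
  obtain ⟨selRegion, hselRegion, selRegion_spec⟩ := exists_table
    (fun q : ℕ => q < M ∧ cnt B (B q) q % F ^ 4 = 0)
    (fun q => 2 * (cnt B (B q) q / F ^ 4) + (B q).toNat) (fun q => q / F ^ 8) (Nat.succ_pos M)
    (fun q q' hq hq' h => by
      obtain ⟨h1, h2⟩ := two_mul_add_toNat_inj h
      have h3 := Nat.div_add_mod (cnt B (B q) q) (F ^ 4)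
      rw [h1, hq.2, add_zero] at h3
      have h4 := Nat.div_add_mod (cnt B (B q') q') (F ^ 4)
      rw [hq'.2, add_zero] at h4
      rw [cnt_injective h2 rfl (by rw [← h4, h3, ← h2])])
    (fun q hq => (Nat.div_le_self _ _).trans_lt (hq.1.trans (Nat.lt_succ_self M)))
  -- The first component is the selected position, the second the first occurrence in its group. The
  -- condition restricts the table to positions outside the region in which the group starts; the
  -- key then needs only that region and the offset within the group.
  obtain ⟨selExtra, hselExtra, selExtra_spec⟩ := exists_table
    (fun p : ℕ × ℕ => p.1 < M ∧ B p.2 = B p.1 ∧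
      cnt B (B p.1) p.2 = cnt B (B p.1) p.1 / F ^ 4 * F ^ 4 ∧
      cnt B (B p.1) ((p.2 / F ^ 8 + 1) * F ^ 8) ≤ cnt B (B p.1) p.1)
    (fun p => 2 * (p.2 / F ^ 8 * F ^ 4 + cnt B (B p.1) p.1 % F ^ 4) + (B p.1).toNat)
    (fun p => p.1 / F ^ 8) (Nat.succ_pos M)
    (fun ⟨q, q₁⟩ ⟨q', q₁'⟩ ⟨_, a2, a3, a4⟩ ⟨_, a2', a3', a4'⟩ h => by
      dsimp only at *
      obtain ⟨h1, h2⟩ := two_mul_add_toNat_inj h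
      obtain ⟨h3, h4⟩ := mul_add_inj (Nat.mod_lt _ (hpow 4)) (Nat.mod_lt _ (hpow 4)) h1
      rw [← h2] at a2' a3' a4' h4
      -- Two different groups of one bit starting in the same region cannot both extend beyond it.
      have h5 : cnt B (B q) q / F ^ 4 = cnt B (B q) q' / F ^ 4 := by
        rcases lt_trichotomy (cnt B (B q) q / F ^ 4) (cnt B (B q) q' / F ^ 4) with h | h | h
        · have := cnt_lt_of_div_lt B F hF0 h a2' a3' h3.symm
          omega
        · exact h
        · have := cnt_lt_of_div_lt B F hF0 h a2 a3 h3
          omega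
      rw [cnt_injective (p := q) (q := q') rfl h2.symm]
      rw [← Nat.div_add_mod (cnt B (B q) q) (F ^ 4), h5, h4, Nat.div_add_mod])
    (fun p hp => (Nat.div_le_self _ _).trans_lt (hp.1.trans (Nat.lt_succ_self M)))
  obtain ⟨selCell, hselCell, selCell_spec⟩ := exists_table (fun _ : ℕ => True)
    (fun q => 2 * ((hi (q / F ^ 2) * 2 ^ (F ^ 2 - 2 * bitLen F) + lo (q / F ^ 2)) *
      2 ^ relWidth F + relRank B F 2 q) + (B q).toNat) (fun q => q % F ^ 2) hW
    (fun q q' _ _ h => by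
      obtain ⟨h1, h2⟩ := two_mul_add_toNat_inj h
      obtain ⟨h3, h4⟩ := mul_add_inj (relRank_lt hF0 (by omega)) (relRank_lt hF0 (by omega)) h1
      have l1 := Nat.mod_lt q (hpow 2)
      have l2 := Nat.mod_lt q' (hpow 2)
      have h5 := relRank_add B F 2 q
      have h6 := relRank_add B F 2 q'
      have h7 := hincell (B q) q
      have h8 := hincell (B q') q'
      set B' : ℕ → Bool := fun t => B (q' / F ^ 2 * F ^ 2 + t) with hB'
      have e1 : B' (q' % F ^ 2) = B q' := by
        simp only [hB']; rw [mul_comm, Nat.div_add_mod]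
      have e2 : B' (q % F ^ 2) = B q' := by
        simp only [hB']
        rw [← hcode _ _ h3 _ l1, mul_comm, Nat.div_add_mod, h2]
      rw [cnt_congr (B' := B') fun t ht => hcode _ _ h3 t (ht.trans l1)] at h7
      refine cnt_injective e2 e1 ?_
      rw [h2] at h5 h7
      omega)
    (fun q _ => (Nat.mod_lt _ (hpow 2)).trans (pow_lt_relWidth hF0 (by omega)))
  -- The key consists of node content, rank within the node and bit. It fixes the child by
  -- `child_congr`; the entry of `childPre` is then the prefix count up to that child.
  have hchild : ∀ e < 6, ∀ q q', 2 * (node e (q / F ^ (e + 3)) * 2 ^ relWidth F +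
      relRank B F (e + 3) q) + (B q).toNat = 2 * (node e (q' / F ^ (e + 3)) * 2 ^ relWidth F +
      relRank B F (e + 3) q') + (B q').toNat → q / F ^ (e + 2) % F = q' / F ^ (e + 2) % F ∧
      relRank B F (e + 3) q - relRank B F (e + 2) q =
        relRank B F (e + 3) q' - relRank B F (e + 2) q' := by
    intro e he q q' h
    obtain ⟨h1, h2⟩ := two_mul_add_toNat_inj h
    obtain ⟨h3, h4⟩ := mul_add_inj (relRank_lt hF0 (by omega)) (relRank_lt hF0 (by omega)) h1
    have h5 := hncnt e he _ _ h3
    have hd : ∀ q, q / F ^ (e + 2) / F = q / F ^ (e + 3) := fun q => by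
      rw [Nat.div_div_eq_div_mul, ← pow_succ]
    have hm : ∀ ν, ν * F * F ^ (e + 2) = ν * F ^ (e + 3) := fun ν => by
      rw [mul_assoc, ← pow_succ']
    have a1 := relRank_add B F (e + 3) q
    have a2 := relRank_add B F (e + 3) q'
    have a3 := relRank_add B F (e + 2) q
    have a4 := relRank_add B F (e + 2) q'
    have h6 : q / F ^ (e + 2) % F = q' / F ^ (e + 2) % F := by
      refine child_congr (hpow _) hF0 (hd q) (hd q') rfl h2.symm h5 ?_
      rw [hm, hm]
      rw [h2] at a1 ⊢
      omega
    refine ⟨h6, ?_⟩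
    have h7 := cnt_prefix_congr h5 (B q) _ (Nat.mod_lt (q / F ^ (e + 2)) hF0).le
    have e1 : q / F ^ (e + 3) * F + q / F ^ (e + 2) % F = q / F ^ (e + 2) := by
      rw [← hd]; exact hmod _
    have e2 : q' / F ^ (e + 3) * F + q / F ^ (e + 2) % F = q' / F ^ (e + 2) := by
      rw [← hd, h6]; exact hmod _
    rw [e1, e2, hm, hm] at h7
    rw [h2] at a1 a3 h7
    omega
  have hchild' := fun e (he : e < 6) => exists_table (fun _ : ℕ => True)
    (fun q => 2 * (node e (q / F ^ (e + 3)) * 2 ^ relWidth F + relRank B F (e + 3) q) +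
      (B q).toNat) (fun q => q / F ^ (e + 2) % F) hW (fun q q' _ _ h => (hchild e he q q' h).1)
      (fun q _ => (Nat.mod_lt _ hF0).trans (by simpa using pow_lt_relWidth (k := 1) hF0 (by omega)))
  have hchildPre' := fun e (he : e < 6) => exists_table (fun _ : ℕ => True)
    (fun q => 2 * (node e (q / F ^ (e + 3)) * 2 ^ relWidth F + relRank B F (e + 3) q) +
      (B q).toNat) (fun q => relRank B F (e + 3) q - relRank B F (e + 2) q) hW
      (fun q q' _ _ h => (hchild e he q q' h).2)
      (fun q _ => (Nat.sub_le _ _).trans_lt (relRank_lt hF0 (by omega)))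
  choose child hch child_spec using hchild'
  choose childPre hchp childPre_spec using hchildPre'
  exact ⟨{
    hi := hi, lo := lo, node := node, pre := pre, hiOf := hiOf, inCell := inCell,
    selRegion := selRegion, selExtra := selExtra, selCell := selCell
    child := fun e k => if h : e < 6 then child e h k else 0
    childPre := fun e k => if h : e < 6 then childPre e h k else 0
    hi_lt := hhi, lo_lt := hlo, node_lt := hnode, pre_lt := hpre, hiOf_lt := hhiOf
    inCell_lt := hinCell, selRegion_lt := hselRegion, selExtra_lt := hselExtra
    selCell_lt := hselCell
    child_lt := fun e k => by split_ifs with h; exacts [hch e h k, hW]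
    childPre_lt := fun e k => by split_ifs with h; exacts [hchp e h k, hW]
    pre_spec := fun c => pre_spec c trivial
    hiOf_spec := fun c => hiOf_spec c trivial
    inCell_spec := fun q => inCell_spec q trivial
    selRegion_spec := fun q hq h => selRegion_spec q ⟨hq, h⟩
    selExtra_spec := fun q hq q' h1 h2 h3 => selExtra_spec (q, q') ⟨hq, h1, h2, h3⟩
    selCell_spec := fun q => selCell_spec q trivial
    child_spec := fun e he q => by rw [dif_pos he]; exact child_spec e he q trivial
    childPre_spec := fun e he q => by rw [dif_pos he]; exact childPre_spec e he q trivial }⟩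

/-! ### Layout of the index in memory, and rank queries -/

/-- The arrays of the data structure, except for the header. -/
def arrays {B : ℕ → Bool} {F M : ℕ} (I : BitIndex B F M) (W : ℕ) (par : ℕ → ℕ) (low : Arr) :
    ℕ → Arr
  | 0 => ⟨9, W, par⟩
  | 1 => ⟨2 * (M / F ^ 8 + 2), W, fun k => cnt B (k % 2 == 1) (k / 2 * F ^ 8)⟩
  | 2 => ⟨(M / F ^ 8 + 1) * F ^ 5, relWidth F, fun k =>
      cnt B true (k * F ^ 3) - cnt B true (k / F ^ 5 * F ^ 8)⟩
  | 3 => ⟨2 ^ (F * labWidth F 0) * F, relWidth F, I.pre⟩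
  | 4 => ⟨2 ^ (F * labWidth F 0) * F, 2 * bitLen F + 1, I.hiOf⟩
  | 5 => ⟨(M / F ^ 8 + 1) * F ^ 6, F ^ 2 - 2 * bitLen F, I.lo⟩
  | 6 => ⟨2 ^ (2 * bitLen F + 1) * 2 ^ (F ^ 2 - 2 * bitLen F) * F ^ 2, relWidth F, I.inCell⟩
  | 7 => ⟨2 * (M / F ^ 4 + 1), W, I.selRegion⟩
  | 8 => ⟨2 * ((M / F ^ 8 + 1) * F ^ 4), W, I.selExtra⟩
  | 9 => ⟨2 * (2 ^ (2 * bitLen F + 1) * 2 ^ (F ^ 2 - 2 * bitLen F) * 2 ^ relWidth F), relWidth F,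
      I.selCell⟩
  | 28 => low
  | t + 10 => if t < 6 then ⟨(M / F ^ 8 + 1) * F ^ (5 - t), F * labWidth F t, I.node t⟩ else
      if t < 12 then ⟨2 * (2 ^ (F * labWidth F (t - 6)) * 2 ^ relWidth F), relWidth F,
        I.child (t - 6)⟩ else
      ⟨2 * (2 ^ (F * labWidth F (t - 12)) * 2 ^ relWidth F), relWidth F, I.childPre (t - 12)⟩

theorem mul_add_lt {a r A F : ℕ} (ha : a < A) (hr : r < F) : a * F + r < A * F := by
  have := Nat.mul_le_mul_right F ha
  rw [Nat.succ_mul] at this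
  omega

theorem two_mul_add_toNat_lt {a A : ℕ} (b : Bool) (ha : a < A) : 2 * a + b.toNat < 2 * A := by
  have := b.toNat_lt
  omega

/-- Counts grow by at most one, so every smaller rank is attained. This supplies the first
occurrence of a group in the analysis of selection. -/
theorem exists_cnt_eq {B : ℕ → Bool} {b : Bool} {q k : ℕ} (hq : B q = b) (hk : k ≤ cnt B b q) :
    ∃ q₀ ≤ q, B q₀ = b ∧ cnt B b q₀ = k := by
  induction q using Nat.strong_induction_on generalizing k with
  | _ q ih =>
    rcases hk.lt_or_eq with h | h
    · have : ∃ p < q, B p = b ∧ k ≤ cnt B b p := by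
        clear ih hq hk
        induction q with
        | zero => simp [cnt_zero] at h
        | succ p ihp =>
          rw [cnt_succ] at h
          split_ifs at h with hb
          · exact ⟨p, by omega, hb, by omega⟩
          · obtain ⟨p', h1, h2⟩ := ihp (by omega)
            exact ⟨p', by omega, h2⟩
      obtain ⟨p, h1, h2, h3⟩ := this
      obtain ⟨q₀, h4, h5⟩ := ih p h1 h2 h3
      exact ⟨q₀, by omega, h5⟩
    · exact ⟨q, le_rfl, hq, h.symm⟩

/-- The data contains the arrays, and the word size is sufficient for all indices. -/
structure Served (w : ℕ) (D : List Bool) (W : ℕ) (arr : ℕ → Arr) (M : ℕ) : Prop where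
  isTab : ∀ t < 28, IsTab w D W t (arr t)
  len_lt : ∀ t < 28, (arr t).len < 2 ^ w
  lit_lt : 100 < 2 ^ w
  size_lt : M < 2 ^ w

/-- A parameter of the data structure. -/
def par (k : ℕ) : Expr := tab 0 (.lit k)

/-- The parameters of the index. -/
structure IsParam (F : ℕ) (pv : ℕ → ℕ) : Prop where
  par0 : pv 0 = F
  par1 : pv 1 = F ^ 2
  par2 : pv 2 = F ^ 3
  par3 : pv 3 = F ^ 4
  par4 : pv 4 = F ^ 8
  par5 : pv 5 = 2 ^ (F ^ 2 - 2 * bitLen F)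
  par6 : pv 6 = 2 ^ relWidth F

/-- The index for the tables of the block that contains position `p`. -/
def keyE (p : Expr) : Expr := tab 10 (p / par 2) * par 0 + p / par 1 % par 0

/-- The number of ones before position `p`. -/
def rankE (p : Expr) : Expr :=
  tab 1 (.lit 2 * (p / par 4) + .lit 1) + tab 2 (p / par 2) + tab 3 (keyE p) +
    tab 6 ((tab 4 (keyE p) * par 5 + tab 5 (p / par 1)) * par 1 + p % par 1)

section
variable {B : ℕ → Bool} {F M W w : ℕ} {D : List Bool} {I : BitIndex B F M} {pv : ℕ → ℕ} {low : Arr}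
  {ρ : ℕ → ℕ}

theorem par_eval (hS : Served w D W (arrays I W pv low) M) (hρ : ρ 5 = W) {k : ℕ} (hk : k < 9) :
    (par k).eval w D ρ = pv k := by
  have := hS.lit_lt
  exact hS.isTab 0 (by omega) ρ _ k hρ (eval_lit (by omega)) hk

theorem key_eval (hS : Served w D W (arrays I W pv low) M) (hP : IsParam F pv) (hF : 2 ≤ F)
    (hρ : ρ 5 = W) {p : Expr} {q : ℕ} (hp : p.eval w D ρ = q) (hq : q ≤ M) :
    (keyE p).eval w D ρ = I.node 0 (q / F ^ 3) * F + q / F ^ 2 % F ∧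
    I.node 0 (q / F ^ 3) * F + q / F ^ 2 % F < 2 ^ (F * labWidth F 0) * F := by
  have p0 : (par 0).eval w D ρ = F := by rw [par_eval hS hρ (by omega), hP.par0]
  have p1 : (par 1).eval w D ρ = F ^ 2 := by rw [par_eval hS hρ (by omega), hP.par1]
  have p2 : (par 2).eval w D ρ = F ^ 3 := by rw [par_eval hS hρ (by omega), hP.par2]
  have hlt := mul_add_lt (I.node_lt 0 (q / F ^ 3)) (Nat.mod_lt (q / F ^ 2) (show F > 0 by omega))
  have hw : 2 ^ (F * labWidth F 0) * F < 2 ^ w := hS.len_lt 3 (by omega)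
  have hblk : q / F ^ 3 < (M / F ^ 8 + 1) * F ^ 5 := by
    have h1 : q / F ^ 3 / F ^ 5 = q / F ^ 8 := by rw [Nat.div_div_eq_div_mul, ← pow_add]
    have h2 : q / F ^ 8 ≤ M / F ^ 8 := Nat.div_le_div_right hq
    rw [← Nat.div_lt_iff_lt_mul (Nat.pow_pos (by omega)), h1]
    omega
  have e1 : (tab 10 (p / par 2)).eval w D ρ = I.node 0 (q / F ^ 3) :=
    hS.isTab 10 (by omega) ρ _ _ hρ (eval_div hp p2) hblk
  exact ⟨eval_add (eval_mul e1 p0 (by omega)) (eval_mod (eval_div hp p1) p0) (by omega), hlt⟩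

/-- The count telescopes over four aligned boundaries: the region of `F ^ 8` bits, the block of `F ^
3` bits, the cell of `F ^ 2` bits, and `q` itself. The first two counts are stored, the last two
follow from the content of block and cell. -/
theorem rank_eval (hS : Served w D W (arrays I W pv low) M) (hP : IsParam F pv) (hF : 2 ≤ F)
    (hρ : ρ 5 = W) {p : Expr} {q : ℕ} (hp : p.eval w D ρ = q) (hq : q ≤ M) :
    (rankE p).eval w D ρ = cnt B true q := by
  have hF0 : 0 < F := by omega
  have p1 : (par 1).eval w D ρ = F ^ 2 := by rw [par_eval hS hρ (by omega), hP.par1]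
  have p2 : (par 2).eval w D ρ = F ^ 3 := by rw [par_eval hS hρ (by omega), hP.par2]
  have p4 : (par 4).eval w D ρ = F ^ 8 := by rw [par_eval hS hρ (by omega), hP.par4]
  have p5 : (par 5).eval w D ρ = 2 ^ (F ^ 2 - 2 * bitLen F) := by
    rw [par_eval hS hρ (by omega), hP.par5]
  obtain ⟨hk, hklt⟩ := key_eval hS hP hF hρ hp hq
  have hlit := hS.lit_lt
  have hreg : q / F ^ 8 ≤ M / F ^ 8 := Nat.div_le_div_right hq
  have d35 : q / F ^ 3 / F ^ 5 = q / F ^ 8 := by rw [Nat.div_div_eq_div_mul, ← pow_add]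
  have d26 : q / F ^ 2 / F ^ 6 = q / F ^ 8 := by rw [Nat.div_div_eq_div_mul, ← pow_add]
  have d21 : q / F ^ 2 / F = q / F ^ 3 := by rw [Nat.div_div_eq_div_mul, ← pow_succ]
  have hblk : q / F ^ 3 < (M / F ^ 8 + 1) * F ^ 5 := by
    rw [← Nat.div_lt_iff_lt_mul (Nat.pow_pos hF0), d35]; omega
  have hcell : q / F ^ 2 < (M / F ^ 8 + 1) * F ^ 6 := by
    rw [← Nat.div_lt_iff_lt_mul (Nat.pow_pos hF0), d26]; omega
  have hw1 : 2 * (M / F ^ 8 + 2) < 2 ^ w := hS.len_lt 1 (by omega)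
  -- Array `1` interleaves counts of zeros (even index) and of ones (odd index).
  have e1 : (tab 1 (.lit 2 * (p / par 4) + .lit 1)).eval w D ρ = cnt B true (q / F ^ 8 * F ^ 8) := by
    rw [hS.isTab 1 (by omega) ρ _ (2 * (q / F ^ 8) + 1) hρ (eval_add (eval_mul (eval_lit (by omega))
      (eval_div hp p4) (by omega)) (eval_lit (by omega)) (by omega))
      (show 2 * (q / F ^ 8) + 1 < 2 * (M / F ^ 8 + 2) by omega)]
    simp only [arrays]
    rw [show (2 * (q / F ^ 8) + 1) % 2 = 1 by omega, show (2 * (q / F ^ 8) + 1) / 2 = q / F ^ 8 by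
      omega]
    rfl
  have e2 : (tab 2 (p / par 2)).eval w D ρ =
      cnt B true (q / F ^ 3 * F ^ 3) - cnt B true (q / F ^ 8 * F ^ 8) := by
    rw [hS.isTab 2 (by omega) ρ _ (q / F ^ 3) hρ (eval_div hp p2) hblk]
    simp only [arrays]
    rw [d35]
  have e3 : (tab 3 (keyE p)).eval w D ρ =
      cnt B true (q / F ^ 2 * F ^ 2) - cnt B true (q / F ^ 3 * F ^ 3) := by
    rw [hS.isTab 3 (by omega) ρ _ _ hρ hk hklt]
    have := I.pre_spec (q / F ^ 2)
    rwa [d21, mul_assoc, ← pow_succ'] at this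
  have e4 : (tab 4 (keyE p)).eval w D ρ = I.hi (q / F ^ 2) := by
    rw [hS.isTab 4 (by omega) ρ _ _ hρ hk hklt]
    have := I.hiOf_spec (q / F ^ 2)
    rwa [d21] at this
  have e5 : (tab 5 (p / par 1)).eval w D ρ = I.lo (q / F ^ 2) :=
    hS.isTab 5 (by omega) ρ _ _ hρ (eval_div hp p1) hcell
  have hc := mul_add_lt (I.hi_lt (q / F ^ 2)) (I.lo_lt (q / F ^ 2))
  have hc2 := mul_add_lt hc (Nat.mod_lt q (show F ^ 2 > 0 from Nat.pow_pos hF0))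
  have hw6 : 2 ^ (2 * bitLen F + 1) * 2 ^ (F ^ 2 - 2 * bitLen F) * F ^ 2 < 2 ^ w :=
    hS.len_lt 6 (by omega)
  have hsq : 1 ≤ F ^ 2 := Nat.pow_pos hF0
  have hmod := Nat.zero_le (q % F ^ 2)
  have hc3 := Nat.mul_le_mul_left (I.hi (q / F ^ 2) * 2 ^ (F ^ 2 - 2 * bitLen F) +
    I.lo (q / F ^ 2)) hsq
  have e6 : (tab 6 ((tab 4 (keyE p) * par 5 + tab 5 (p / par 1)) * par 1 + p % par 1)).eval w D ρ =
      cnt B true q - cnt B true (q / F ^ 2 * F ^ 2) := by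
    rw [hS.isTab 6 (by omega) ρ _ _ hρ (eval_add (eval_mul (eval_add (eval_mul e4 p5 (by omega)) e5
      (by omega)) p1 (by omega)) (eval_mod hp p1) (by omega)) hc2]
    exact I.inCell_spec q
  have m1 := cnt_mono B true (Nat.div_mul_le_self q (F ^ 2))
  have m2 : cnt B true (q / F ^ 3 * F ^ 3) ≤ cnt B true (q / F ^ 2 * F ^ 2) := by
    refine cnt_mono _ _ ?_
    rw [← d21, pow_succ' F 2, ← mul_assoc]
    exact Nat.mul_le_mul_right _ (Nat.div_mul_le_self _ _)
  have m3 : cnt B true (q / F ^ 8 * F ^ 8) ≤ cnt B true (q / F ^ 3 * F ^ 3) := by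
    refine cnt_mono _ _ ?_
    rw [← d35, show F ^ 8 = F ^ 5 * F ^ 3 by ring, ← mul_assoc]
    exact Nat.mul_le_mul_right _ (Nat.div_mul_le_self _ _)
  have m4 := cnt_le B true q
  have hM := hS.size_lt
  have := eval_add (eval_add (eval_add e1 e2 (by omega)) e3 (by omega)) e6 (by omega)
  rw [rankE, this]
  omega

/-! ### Selection queries -/

/-- The code value of cell `c` from variables `23`, `25` (block contents and cell in the block)
and `22` (the cell). -/
def cellE : Expr :=
  tab 4 (.var 23 * par 0 + .var 25) * par 5 + tab 5 (.var 22)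

/-- One step from a node of level `e` to the child that contains the selected bit. -/
def stepP (e : ℕ) : Prog :=
  .seq (asg 23 (tab (10 + e) (.var 22))) <|
  .seq (asg 24 (.lit 2 * (.var 23 * par 6 + .var 21) + .var 20)) <|
  .seq (asg 25 (tab (16 + e) (.var 24))) <|
  .seq (asg 21 (.var 21 - tab (22 + e) (.var 24))) <|
  .seq (asg 22 (.var 22 * par 0 + .var 25)) .skip

def descendP : ℕ → Prog
  | 0 => .skip
  | e + 1 => .seq (stepP e) (descendP e)

/-- Selection of the bit with value `20` and rank `21`; the position is left in variable `21`. -/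
def selP : Prog :=
  .seq (asg 22 (tab 7 (.lit 2 * (.var 21 / par 3) + .var 20))) <|
  .seq (asg 22 (.cond (.var 21) (tab 1 (.lit 2 * (.var 22 + .lit 1) + .var 20)) (.var 22)
    (tab 8 (.lit 2 * (.var 22 * par 3 + .var 21 % par 3) + .var 20)))) <|
  .seq (asg 21 (.var 21 - tab 1 (.lit 2 * .var 22 + .var 20))) <|
  .seq (descendP 6) <|
  .seq (asg 21 (.var 22 * par 1 + tab 9 (.lit 2 * (cellE * par 6 + .var 21) + .var 20))) .skip

/-- The state of the selection of bit `q` after it has been narrowed to an aligned segment of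
`F ^ k` bits. -/
structure SelState (B : ℕ → Bool) (F : ℕ) (ρ₀ : ℕ → ℕ) (k q : ℕ) (ρ : ℕ → ℕ) : Prop where
  frame : ∀ x, x < 20 ∨ 25 < x → ρ x = ρ₀ x
  bit : ρ 20 = (B q).toNat
  rank : ρ 21 = relRank B F k q
  seg : ρ 22 = q / F ^ k

theorem arrays_node (e : ℕ) (he : e < 6) : arrays I W pv low (10 + e) =
    ⟨(M / F ^ 8 + 1) * F ^ (5 - e), F * labWidth F e, I.node e⟩ := by
  interval_cases e <;> rfl

theorem arrays_child (e : ℕ) (he : e < 6) : arrays I W pv low (16 + e) =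
    ⟨2 * (2 ^ (F * labWidth F e) * 2 ^ relWidth F), relWidth F, I.child e⟩ := by
  interval_cases e <;> rfl

theorem arrays_childPre (e : ℕ) (he : e < 6) : arrays I W pv low (22 + e) =
    ⟨2 * (2 ^ (F * labWidth F e) * 2 ^ relWidth F), relWidth F, I.childPre e⟩ := by
  interval_cases e <;> rfl

/-- The final values of variables `23` and `25` are recorded because, after the last step, they
address the first part of the selected cell. -/
theorem step_runs (hS : Served w D W (arrays I W pv low) M) (hP : IsParam F pv) (hF : 2 ≤ F)
    {ρ₀ : ℕ → ℕ} (hρ₀ : ρ₀ 5 = W) {e q : ℕ} (he : e < 6) (hq : q ≤ M)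
    (h : SelState B F ρ₀ (e + 3) q ρ) :
    ∃ ρ', Runs w D (stepP e) ρ ρ' (stepP e).cost ∧ SelState B F ρ₀ (e + 2) q ρ' ∧
      ρ' 23 = I.node e (q / F ^ (e + 3)) ∧ ρ' 25 = q / F ^ (e + 2) % F := by
  have hF0 : 0 < F := by omega
  have hρ : ρ 5 = W := by rw [h.frame 5 (by omega), hρ₀]
  have hlit := hS.lit_lt
  have hM := hS.size_lt
  have hr := h.rank
  have hb := h.bit
  have hν := h.seg
  have hd : q / F ^ (e + 3) / F ^ (5 - e) = q / F ^ 8 := by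
    rw [Nat.div_div_eq_div_mul, ← pow_add]; congr 2; omega
  have hd' : q / F ^ (e + 2) / F = q / F ^ (e + 3) := by rw [Nat.div_div_eq_div_mul, ← pow_succ]
  have hnode : q / F ^ (e + 3) < (M / F ^ 8 + 1) * F ^ (5 - e) := by
    rw [← Nat.div_lt_iff_lt_mul (Nat.pow_pos hF0), hd]
    exact Nat.lt_succ_of_le (Nat.div_le_div_right hq)
  have hidx := two_mul_add_toNat_lt (B q) (mul_add_lt (I.node_lt e (q / F ^ (e + 3)))
    (relRank_lt (B := B) (F := F) (k := e + 3) (q := q) hF0 (by omega)))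
  have hw16 := hS.len_lt (16 + e) (by omega)
  have hA := arrays_node (I := I) (W := W) (pv := pv) (low := low) e he
  have hC := arrays_child (I := I) (W := W) (pv := pv) (low := low) e he
  have hCP := arrays_childPre (I := I) (W := W) (pv := pv) (low := low) e he
  rw [hC] at hw16
  dsimp only at hw16
  have hrr : relRank B F (e + 2) q ≤ relRank B F (e + 3) q := by
    refine Nat.sub_le_sub_left (cnt_mono _ _ ?_) _
    rw [← hd', pow_succ' F (e + 2), ← mul_assoc]
    exact Nat.mul_le_mul_right _ (Nat.div_mul_le_self _ _)
  have hpos : (1 : ℕ) ≤ 2 ^ relWidth F := Nat.two_pow_pos _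
  have hrle : relRank B F (e + 3) q ≤ M :=
    (Nat.sub_le _ _).trans ((cnt_le _ _ _).trans hq)
  have hdm : q / F ^ (e + 3) * F + q / F ^ (e + 2) % F = q / F ^ (e + 2) := by
    rw [← hd', mul_comm]; exact Nat.div_add_mod _ _
  have hqle : q / F ^ (e + 2) ≤ M := (Nat.div_le_self _ _).trans hq
  refine ⟨_, Runs.asg_seq (v := I.node e (q / F ^ (e + 3))) ?_ <|
    Runs.asg_seq (v := 2 * (I.node e (q / F ^ (e + 3)) * 2 ^ relWidth F +
      relRank B F (e + 3) q) + (B q).toNat) ?_ <|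
    Runs.asg_seq (v := q / F ^ (e + 2) % F) ?_ <|
    Runs.asg_seq (v := relRank B F (e + 2) q) ?_ <|
    Runs.asg_seq (v := q / F ^ (e + 2)) ?_ Runs.skip, ⟨fun x hx => ?_, ?_, ?_, ?_⟩, ?_, ?_⟩
  · rw [hS.isTab (10 + e) (by omega) ρ (.var 22) _ hρ hν (by rw [hA]; exact hnode), hA]
  · exact eval_add (eval_mul (eval_lit (by omega)) (eval_add (eval_mul (by simp [Expr.eval])
      (by rw [par_eval hS (by simpa using hρ) (by omega), hP.par6]) (by omega))
      (by simpa [Expr.eval] using hr) (by omega)) (by omega)) (by simpa [Expr.eval] using hb)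
      (by omega)
  · rw [hS.isTab (16 + e) (by omega) _ _ _ (by simpa using hρ) (by simp [Expr.eval]; rfl)
      (by rw [hC]; exact hidx), hC]
    exact I.child_spec e he q
  · have := hS.isTab (22 + e) (by omega) (Function.update (Function.update (Function.update ρ 23
      (I.node e (q / F ^ (e + 3)))) 24 (2 * (I.node e (q / F ^ (e + 3)) * 2 ^ relWidth F +
      relRank B F (e + 3) q) + (B q).toNat)) 25 (q / F ^ (e + 2) % F)) (.var 24) _
      (by simpa using hρ) (by simp [Expr.eval]; rfl) (by rw [hCP]; exact hidx)
    rw [hCP] at this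
    dsimp only at this
    rw [I.childPre_spec e he q] at this
    rw [eval_sub (x := relRank B F (e + 3) q) (by simpa [Expr.eval] using hr) this (by omega)
      (by omega)]
    omega
  · rw [← hdm]
    exact eval_add (eval_mul (by simpa [Expr.eval] using hν)
      (by rw [par_eval hS (by simpa using hρ) (by omega), hP.par0]) (by omega))
      (by simp [Expr.eval]) (by omega)
  · simp [show x ≠ 22 by omega, show x ≠ 21 by omega, show x ≠ 25 by omega,
      show x ≠ 24 by omega, show x ≠ 23 by omega, h.frame x hx]
  · simpa using hb
  · simp
  · simp
  · simp
  · simp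

theorem descend_runs (hS : Served w D W (arrays I W pv low) M) (hP : IsParam F pv) (hF : 2 ≤ F)
    {ρ₀ : ℕ → ℕ} (hρ₀ : ρ₀ 5 = W) {q : ℕ} (hq : q ≤ M) (e : ℕ) (he : e ≤ 6)
    (h : SelState B F ρ₀ (e + 2) q ρ) : ∃ ρ', Runs w D (descendP e) ρ ρ' (descendP e).cost ∧
      SelState B F ρ₀ 2 q ρ' ∧
      (0 < e → ρ' 23 = I.node 0 (q / F ^ 3) ∧ ρ' 25 = q / F ^ 2 % F) := by
  induction e generalizing ρ with
  | zero => exact ⟨ρ, Runs.skip, h, by simp⟩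
  | succ e ih =>
    obtain ⟨ρ₁, h1, h2, h3⟩ := step_runs hS hP hF hρ₀ (by omega) hq h
    rcases e with _ | e
    · exact ⟨ρ₁, h1.seq Runs.skip, h2, fun _ => h3⟩
    · obtain ⟨ρ₂, h4, h5, h6⟩ := ih (by omega) h2
      exact ⟨ρ₂, h1.seq h4, h5, fun _ => h6 (Nat.succ_pos e)⟩

/-- The region of the group's first occurrence is looked up and corrected if the wanted occurrence
lies in a later region. Then six nodes, of `F ^ 8` down to `F ^ 3` bits, narrow the position to a
cell, and the last table places it within the cell. -/
theorem sel_runs (hS : Served w D W (arrays I W pv low) M) (hP : IsParam F pv) (hF : 2 ≤ F)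
    (hρ : ρ 5 = W) {q : ℕ} (hq : q < M) (h20 : ρ 20 = (B q).toNat) (h21 : ρ 21 = cnt B (B q) q) :
    ∃ ρ', Runs w D selP ρ ρ' selP.cost ∧ (∀ x, x < 20 ∨ 25 < x → ρ' x = ρ x) ∧ ρ' 21 = q := by
  have hF0 : 0 < F := by omega
  have hlit := hS.lit_lt
  have hM := hS.size_lt
  have h4 : 0 < F ^ 4 := Nat.pow_pos hF0
  have h8 : 0 < F ^ 8 := Nat.pow_pos hF0
  have hcq : cnt B (B q) q ≤ q := cnt_le _ _ _
  have hbit := (B q).toNat_lt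
  have p3 : ∀ ρ : ℕ → ℕ, ρ 5 = W → (par 3).eval w D ρ = F ^ 4 := fun ρ hρ => by
    rw [par_eval hS hρ (by omega), hP.par3]
  obtain ⟨q₀, hq₀, hB₀, hc₀⟩ := exists_cnt_eq (B := B) (q := q) rfl
    (Nat.div_mul_le_self (cnt B (B q) q) (F ^ 4))
  have hreg₀ : q₀ / F ^ 8 ≤ q / F ^ 8 := Nat.div_le_div_right hq₀
  have hreg : q / F ^ 8 ≤ M / F ^ 8 := Nat.div_le_div_right hq.le
  have hdiv4 : cnt B (B q) q / F ^ 4 ≤ M / F ^ 4 := Nat.div_le_div_right (by omega)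
  have hmod := Nat.zero_le (cnt B (B q) q % F ^ 4)
  have hw1 : 2 * (M / F ^ 8 + 2) < 2 ^ w := hS.len_lt 1 (by omega)
  have hw7 : 2 * (M / F ^ 4 + 1) < 2 ^ w := hS.len_lt 7 (by omega)
  have hw8 : 2 * ((M / F ^ 8 + 1) * F ^ 4) < 2 ^ w := hS.len_lt 8 (by omega)
  have hw9 : 2 * (2 ^ (2 * bitLen F + 1) * 2 ^ (F ^ 2 - 2 * bitLen F) * 2 ^ relWidth F) < 2 ^ w :=
    hS.len_lt 9 (by omega)
  have hregion := I.selRegion_spec q₀ (by omega) (by rw [hB₀, hc₀]; exact Nat.mul_mod_left _ _)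
  rw [hB₀, hc₀, Nat.mul_div_cancel _ h4] at hregion
  have abs_eval : ∀ (ρ : ℕ → ℕ) (e : Expr) (k : ℕ), ρ 5 = W → k < M / F ^ 8 + 2 →
      e.eval w D ρ = 2 * k + (B q).toNat → (tab 1 e).eval w D ρ = cnt B (B q) (k * F ^ 8) :=
    fun ρ e k hρ hk he => by
      rw [hS.isTab 1 (by omega) ρ e _ hρ he (two_mul_add_toNat_lt _ hk)]
      simp only [arrays]
      rw [show (2 * k + (B q).toNat) / 2 = k by omega]
      congr 1
      cases B q <;> simp
  have hidx8 := two_mul_add_toNat_lt (B q) (mul_add_lt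
    (show q₀ / F ^ 8 < M / F ^ 8 + 1 by omega) (Nat.mod_lt (cnt B (B q) q) h4))
  have hlt8 : q < (q / F ^ 8 + 1) * F ^ 8 := by rw [mul_comm]; exact Nat.lt_mul_div_succ _ h8
  let ρ₁ := Function.update ρ 22 (q₀ / F ^ 8)
  let ρ₂ := Function.update ρ₁ 22 (q / F ^ 8)
  let ρ₃ := Function.update ρ₂ 21 (relRank B F 8 q)
  have v20 : (Expr.var 20).eval w D ρ = (B q).toNat := h20
  have v21 : (Expr.var 21).eval w D ρ = cnt B (B q) q := h21
  have r1 : (tab 7 (.lit 2 * (.var 21 / par 3) + .var 20)).eval w D ρ = q₀ / F ^ 8 := by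
    rw [hS.isTab 7 (by omega) ρ _ (2 * (cnt B (B q) q / F ^ 4) + (B q).toNat) hρ
      (eval_add (eval_mul (eval_lit (by omega)) (eval_div v21 (p3 ρ hρ)) (by omega)) v20 (by omega))
      (two_mul_add_toNat_lt _ (by omega))]
    exact hregion
  have r2 : (Expr.cond (.var 21) (tab 1 (.lit 2 * (.var 22 + .lit 1) + .var 20)) (.var 22)
      (tab 8 (.lit 2 * (.var 22 * par 3 + .var 21 % par 3) + .var 20))).eval w D ρ₁ =
      q / F ^ 8 := by
    have e5 : ρ₁ 5 = W := by simpa [ρ₁] using hρ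
    have e20 : (Expr.var 20).eval w D ρ₁ = (B q).toNat := by simpa [ρ₁, Expr.eval] using h20
    have e21 : (Expr.var 21).eval w D ρ₁ = cnt B (B q) q := by simpa [ρ₁, Expr.eval] using h21
    have e22 : (Expr.var 22).eval w D ρ₁ = q₀ / F ^ 8 := by simp [ρ₁, Expr.eval]
    have eA := abs_eval ρ₁ (.lit 2 * (.var 22 + .lit 1) + .var 20) (q₀ / F ^ 8 + 1) e5 (by omega)
      (eval_add (eval_mul (eval_lit (by omega)) (eval_add e22 (eval_lit (by omega)) (by omega))
      (by omega)) e20 (by omega))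
    -- The wanted occurrence lies in the region of the sample exactly when its rank is below the
    -- count at the end of that region.
    refine (eval_cond e21 eA (v := q / F ^ 8) (fun hlt => e22) (fun hlt => ?_)).trans ?_
    · rw [hS.isTab 8 (by omega) ρ₁ _ _ e5 (eval_add (eval_mul (eval_lit (by omega))
        (eval_add (eval_mul e22 (p3 _ e5) (by omega)) (eval_mod e21 (p3 _ e5)) (by omega))
        (by omega)) e20 (by omega)) hidx8]
      exact I.selExtra_spec q hq q₀ hB₀ hc₀ (by omega)
    · split_ifs with hlt
      · refine le_antisymm hreg₀ (Nat.le_of_lt_succ ?_)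
        rw [Nat.div_lt_iff_lt_mul h8]
        by_contra hcon
        exact absurd hlt (not_lt.2 (cnt_mono B (B q) (not_lt.1 hcon)))
      · rfl
  have r3 : (Expr.var 21 - tab 1 (.lit 2 * .var 22 + .var 20)).eval w D ρ₂ = relRank B F 8 q := by
    have e5 : ρ₂ 5 = W := by simpa [ρ₂, ρ₁] using hρ
    have e20 : (Expr.var 20).eval w D ρ₂ = (B q).toNat := by simpa [ρ₂, ρ₁, Expr.eval] using h20
    have e21 : (Expr.var 21).eval w D ρ₂ = cnt B (B q) q := by simpa [ρ₂, ρ₁, Expr.eval] using h21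
    have e22 : (Expr.var 22).eval w D ρ₂ = q / F ^ 8 := by simp [ρ₂, Expr.eval]
    exact eval_sub e21 (abs_eval ρ₂ _ (q / F ^ 8) e5 (by omega) (eval_add (eval_mul
      (eval_lit (by omega)) e22 (by omega)) e20 (by omega))) (by omega)
      (cnt_mono _ _ (Nat.div_mul_le_self _ _))
  have hst : SelState B F ρ (6 + 2) q ρ₃ := by
    refine ⟨fun x hx => ?_, ?_, ?_, ?_⟩
    · simp [ρ₃, ρ₂, ρ₁, show x ≠ 22 by omega, show x ≠ 21 by omega]
    · simpa [ρ₃, ρ₂, ρ₁] using h20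
    · simp [ρ₃]
    · simp [ρ₃, ρ₂]
  obtain ⟨ρ₄, h4r, h4s, h4n⟩ := descend_runs hS hP hF hρ hq.le 6 le_rfl hst
  obtain ⟨h23, h25⟩ := h4n (by omega)
  have e5 : ρ₄ 5 = W := by rw [h4s.frame 5 (by omega), hρ]
  have p0 : (par 0).eval w D ρ₄ = F := by rw [par_eval hS e5 (by omega), hP.par0]
  have p1 : (par 1).eval w D ρ₄ = F ^ 2 := by rw [par_eval hS e5 (by omega), hP.par1]
  have p5 : (par 5).eval w D ρ₄ = 2 ^ (F ^ 2 - 2 * bitLen F) := by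
    rw [par_eval hS e5 (by omega), hP.par5]
  have p6 : (par 6).eval w D ρ₄ = 2 ^ relWidth F := by rw [par_eval hS e5 (by omega), hP.par6]
  have d26 : q / F ^ 2 / F ^ 6 = q / F ^ 8 := by rw [Nat.div_div_eq_div_mul, ← pow_add]
  have d21 : q / F ^ 2 / F = q / F ^ 3 := by rw [Nat.div_div_eq_div_mul, ← pow_succ]
  have hcell : q / F ^ 2 < (M / F ^ 8 + 1) * F ^ 6 := by
    rw [← Nat.div_lt_iff_lt_mul (Nat.pow_pos hF0), d26]; omega
  have hklt := mul_add_lt (I.node_lt 0 (q / F ^ 3)) (Nat.mod_lt (q / F ^ 2) hF0)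
  have hw4 : 2 ^ (F * labWidth F 0) * F < 2 ^ w := hS.len_lt 4 (by omega)
  have hm0 := Nat.zero_le (q / F ^ 2 % F)
  have e20 : (Expr.var 20).eval w D ρ₄ = (B q).toNat := h4s.bit
  have e21 : (Expr.var 21).eval w D ρ₄ = relRank B F 2 q := h4s.rank
  have e22 : (Expr.var 22).eval w D ρ₄ = q / F ^ 2 := h4s.seg
  have v23 : (Expr.var 23).eval w D ρ₄ = I.node 0 (q / F ^ 3) := h23
  have v25 : (Expr.var 25).eval w D ρ₄ = q / F ^ 2 % F := h25
  have e4 : (tab 4 (.var 23 * par 0 + .var 25)).eval w D ρ₄ = I.hi (q / F ^ 2) := by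
    rw [hS.isTab 4 (by omega) ρ₄ _ _ e5 (eval_add (eval_mul v23 p0 (by omega)) v25 (by omega)) hklt]
    have := I.hiOf_spec (q / F ^ 2)
    rwa [d21] at this
  have elo : (tab 5 (.var 22)).eval w D ρ₄ = I.lo (q / F ^ 2) :=
    hS.isTab 5 (by omega) ρ₄ _ _ e5 e22 hcell
  have hc := mul_add_lt (I.hi_lt (q / F ^ 2)) (I.lo_lt (q / F ^ 2))
  have hc2 := mul_add_lt hc (relRank_lt (B := B) (F := F) (k := 2) (q := q) hF0 (by omega))
  have hc3 := Nat.mul_le_mul_left (I.hi (q / F ^ 2) * 2 ^ (F ^ 2 - 2 * bitLen F) +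
    I.lo (q / F ^ 2)) (show 1 ≤ 2 ^ relWidth F from Nat.two_pow_pos _)
  have hqd : q / F ^ 2 * F ^ 2 + q % F ^ 2 = q := by rw [mul_comm]; exact Nat.div_add_mod _ _
  have hm1 := Nat.zero_le (q % F ^ 2)
  have r5 : (Expr.var 22 * par 1 + tab 9 (.lit 2 * (cellE * par 6 + .var 21) + .var 20)).eval w D ρ₄
      = q := by
    have e9 : (tab 9 (.lit 2 * (cellE * par 6 + .var 21) + .var 20)).eval w D ρ₄ = q % F ^ 2 := by
      rw [cellE, hS.isTab 9 (by omega) ρ₄ _ _ e5 (eval_add (eval_mul (eval_lit (by omega))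
        (eval_add (eval_mul (eval_add (eval_mul e4 p5 (by omega)) elo (by omega)) p6 (by omega))
        e21 (by omega)) (by omega)) e20 (by omega)) (two_mul_add_toNat_lt (B q) hc2)]
      exact I.selCell_spec q
    rw [eval_add (eval_mul e22 p1 (by omega)) e9 (by omega), hqd]
  refine ⟨_, Runs.asg_seq r1 <| Runs.asg_seq r2 <| Runs.asg_seq r3 <| h4r.seq <|
    Runs.asg_seq r5 Runs.skip, fun x hx => ?_, by simp⟩
  rw [Function.update_of_ne (by omega), h4s.frame x hx]

end

/-! ### The wavelet matrix -/

section
variable (n ℓ : ℕ) (S : ℕ → ℕ)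

/-- The sequence at level `d` of the wavelet matrix of `S[0, n)`: the elements are stably
partitioned by their bits, from the most significant one on. -/
noncomputable def levelSeq : ℕ → ℕ → ℕ
  | 0 => S
  | d + 1 => fun k =>
    let g : ℕ → Bool := fun q => (levelSeq d q).testBit (ℓ - 1 - d)
    if k < cnt g false n then levelSeq d (Nat.nth (fun q => g q = false) k)
    else levelSeq d (Nat.nth (fun q => g q = true) (k - cnt g false n))

/-- The bits stored for level `d`. -/
noncomputable def levelBit (d q : ℕ) : Bool := (levelSeq n ℓ S d q).testBit (ℓ - 1 - d)

/-- The position in level `d + 1` that corresponds to position `p` of level `d` in the part of the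
elements with bit `b`. -/
noncomputable def down (d : ℕ) (b : Bool) (p : ℕ) : ℕ :=
  if b then cnt (levelBit n ℓ S d) false n + cnt (levelBit n ℓ S d) true p
  else cnt (levelBit n ℓ S d) false p

/-- The position in level `d` that corresponds to position `p` of `S`, on the path of `v`. -/
noncomputable def path (v : ℕ) : ℕ → ℕ → ℕ
  | 0, p => p
  | d + 1, p => down n ℓ S d (v.testBit (ℓ - 1 - d)) (path v d p)

variable {n ℓ S} {d v p q l r : ℕ} {b : Bool}

/-- `Nat.nth` inverts `Nat.count` at positions with the given bit, and comparing with the number of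
zeros recovers which half the position belongs to. -/
theorem levelSeq_down (hq : q < n) :
    levelSeq n ℓ S (d + 1) (down n ℓ S d (levelBit n ℓ S d q) q) = levelSeq n ℓ S d q := by
  have hg : (fun q => (levelSeq n ℓ S d q).testBit (ℓ - 1 - d)) = levelBit n ℓ S d := rfl
  simp only [levelSeq, hg]
  cases hb : levelBit n ℓ S d q
  · have h1 : cnt (levelBit n ℓ S d) false q < cnt (levelBit n ℓ S d) false n := cnt_lt_cnt hb hq
    simp only [down, Bool.false_eq_true, if_false]
    rw [if_pos h1]
    exact congrArg _ (Nat.nth_count (p := fun q => levelBit n ℓ S d q = false) hb)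
  · simp only [down, if_true]
    rw [if_neg (by omega), Nat.add_sub_cancel_left]
    exact congrArg _ (Nat.nth_count (p := fun q => levelBit n ℓ S d q = true) hb)

theorem down_lt (hq : q < n) : down n ℓ S d (levelBit n ℓ S d q) q < n := by
  have h0 := cnt_false_add_true (levelBit n ℓ S d) n
  cases hb : levelBit n ℓ S d q
  · have h1 := cnt_lt_cnt hb hq
    simp only [down, Bool.false_eq_true, if_false]
    omega
  · have h1 := cnt_lt_cnt hb hq
    simp only [down, if_true]
    omega

theorem down_mono (h : l ≤ r) : down n ℓ S d b l ≤ down n ℓ S d b r := by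
  cases b
  · simpa [down] using cnt_mono _ _ h
  · simpa [down] using cnt_mono _ _ h

theorem down_le (h : p ≤ n) : down n ℓ S d b p ≤ n := by
  have h0 := cnt_false_add_true (levelBit n ℓ S d) n
  have h1 := cnt_mono (levelBit n ℓ S d) b h
  cases b
  · simp only [down, Bool.false_eq_true, if_false]; omega
  · simp only [down, if_true]; omega

theorem down_succ (h : levelBit n ℓ S d q = b) :
    down n ℓ S d b (q + 1) = down n ℓ S d b q + 1 := by
  cases b <;> simp [down, cnt_succ, h, add_assoc]

theorem down_succ_of_ne (h : levelBit n ℓ S d q ≠ b) :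
    down n ℓ S d b (q + 1) = down n ℓ S d b q := by
  cases b <;> simp [down, cnt_succ, h]

theorem path_mono (h : l ≤ r) : path n ℓ S v d l ≤ path n ℓ S v d r := by
  induction d with
  | zero => exact h
  | succ d ih => exact down_mono ih

theorem path_le (h : p ≤ n) : path n ℓ S v d p ≤ n := by
  induction d with
  | zero => exact h
  | succ d ih => exact down_le ih

/-- When the right end grows by one, its image advances exactly if the new element has bit `b`, and
then it passes that same element. The predicate is arbitrary so that bit conditions can be
accumulated over the levels. -/
theorem card_filter_down (φ : ℕ → Prop) [DecidablePred φ] (hlr : l ≤ r) (hr : r ≤ n) :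
    ((Finset.Ico (down n ℓ S d b l) (down n ℓ S d b r)).filter
      fun k => φ (levelSeq n ℓ S (d + 1) k)).card =
    ((Finset.Ico l r).filter fun q => φ (levelSeq n ℓ S d q) ∧ levelBit n ℓ S d q = b).card := by
  induction r, hlr using Nat.le_induction with
  | base => simp
  | succ r hlr ih =>
    rw [Finset.Ico_add_one_right_eq_Icc, ← Finset.Ico_insert_right hlr, Finset.filter_insert]
    by_cases hb : levelBit n ℓ S d r = b
    · have h1 : levelSeq n ℓ S (d + 1) (down n ℓ S d b r) = levelSeq n ℓ S d r := by
        rw [← hb]; exact levelSeq_down (by omega)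
      rw [down_succ hb, Finset.Ico_add_one_right_eq_Icc, ← Finset.Ico_insert_right (down_mono hlr),
        Finset.filter_insert, h1]
      by_cases hφ : φ (levelSeq n ℓ S d r)
      · rw [if_pos hφ, if_pos ⟨hφ, hb⟩, Finset.card_insert_of_notMem (by simp),
          Finset.card_insert_of_notMem (by simp), ih (by omega)]
      · rw [if_neg hφ, if_neg fun h => hφ h.1, ih (by omega)]
    · rw [down_succ_of_ne hb, if_neg fun h => hb h.2, ih (by omega)]

theorem div_two_pow_eq_iff (a c k : ℕ) : a / 2 ^ k = c / 2 ^ k ↔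
    a / 2 ^ (k + 1) = c / 2 ^ (k + 1) ∧ a.testBit k = c.testBit k := by
  rw [pow_succ, ← Nat.div_div_eq_div_mul, ← Nat.div_div_eq_div_mul,
    Nat.testBit_eq_decide_div_mod_eq, Nat.testBit_eq_decide_div_mod_eq]
  generalize a / 2 ^ k = a'
  generalize c / 2 ^ k = c'
  rw [decide_eq_decide]
  omega

/-- The elements in a range of level `d` are those in the range of `S` with the same leading
bits as `v`. -/
theorem card_filter_path (φ : ℕ → Prop) [DecidablePred φ] (hlr : l ≤ r) (hr : r ≤ n)
    (hS : ∀ p < n, S p < 2 ^ ℓ) (hv : v < 2 ^ ℓ) (hd : d ≤ ℓ) :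
    ((Finset.Ico (path n ℓ S v d l) (path n ℓ S v d r)).filter
      fun k => φ (levelSeq n ℓ S d k)).card =
    ((Finset.Ico l r).filter fun p => φ (S p) ∧ S p / 2 ^ (ℓ - d) = v / 2 ^ (ℓ - d)).card := by
  induction d generalizing φ with
  | zero =>
    simp only [path, levelSeq]
    congr 1
    refine Finset.filter_congr fun p hp => ?_
    rw [Finset.mem_Ico] at hp
    rw [Nat.sub_zero, Nat.div_eq_of_lt (hS p (by omega)), Nat.div_eq_of_lt hv]
    simp
  | succ d ih =>
    have hk : ℓ - d = (ℓ - 1 - d) + 1 := by omega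
    have hk' : ℓ - (d + 1) = ℓ - 1 - d := by omega
    rw [path, path, card_filter_down φ (path_mono hlr) (path_le hr)]
    -- The bit condition of this level is moved into the predicate; together with agreement in the
    -- earlier bits it gives agreement in one more leading bit.
    refine (ih (φ := fun y => φ y ∧ y.testBit (ℓ - 1 - d) = v.testBit (ℓ - 1 - d))
      (by omega)).trans ?_
    congr 1
    refine Finset.filter_congr fun p _ => ?_
    rw [hk, hk', div_two_pow_eq_iff (S p) v (ℓ - 1 - d)]
    tauto

theorem path_spec (hp : p < n) (hv : S p = v) :
    path n ℓ S v d p < n ∧ levelSeq n ℓ S d (path n ℓ S v d p) = v := by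
  induction d with
  | zero => exact ⟨hp, hv⟩
  | succ d ih =>
    have hb : levelBit n ℓ S d (path n ℓ S v d p) = v.testBit (ℓ - 1 - d) := by
      rw [levelBit, ih.2]
    rw [path, ← hb]
    exact ⟨down_lt ih.1, (levelSeq_down ih.1).trans ih.2⟩

theorem levelBit_path (hp : p < n) (hv : S p = v) :
    levelBit n ℓ S d (path n ℓ S v d p) = v.testBit (ℓ - 1 - d) := by
  rw [levelBit, (path_spec hp hv).2]

/-- At the last level the distance of the two images is the number of occurrences of `v` in `[l,
p)`, which is zero. Hence the left end of the final range represents the first occurrence. -/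
theorem path_eq_of_first (hlp : l ≤ p) (hp : p < n) (hS : ∀ p < n, S p < 2 ^ ℓ) (hv : v < 2 ^ ℓ)
    (hfirst : ∀ q, l ≤ q → q < p → S q ≠ v) : path n ℓ S v ℓ l = path n ℓ S v ℓ p := by
  have h := card_filter_path (fun _ => True) hlp hp.le hS hv le_rfl
  simp only [Finset.filter_true, true_and, Nat.card_Ico, Nat.sub_self, pow_zero, Nat.div_one] at h
  rw [Finset.filter_false_of_mem, Finset.card_empty] at h
  · have := path_mono (n := n) (ℓ := ℓ) (S := S) (v := v) (d := ℓ) hlp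
    omega
  · intro q hq
    rw [Finset.mem_Ico] at hq
    exact hfirst q hq.1 hq.2

variable (S)

/-- The number of elements of `S[l, r)` that are less than `v` with respect to all but the last `k`
bits. -/
def lessCnt (l r v k : ℕ) : ℕ := ((Finset.Ico l r).filter fun p => S p / 2 ^ k < v / 2 ^ k).card

variable {S}

/-- The number of elements in a range of level `d` with bit `0`. -/
theorem zeros_path (hlr : l ≤ r) (hr : r ≤ n) (hS : ∀ p < n, S p < 2 ^ ℓ) (hv : v < 2 ^ ℓ)
    (hd : d < ℓ) :
    cnt (levelBit n ℓ S d) false (path n ℓ S v d l) +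
      ((Finset.Ico l r).filter fun p => (S p).testBit (ℓ - 1 - d) = false ∧
        S p / 2 ^ (ℓ - d) = v / 2 ^ (ℓ - d)).card =
    cnt (levelBit n ℓ S d) false (path n ℓ S v d r) := by
  rw [← card_filter_path (fun y => y.testBit (ℓ - 1 - d) = false) hlr hr hS hv hd.le]
  have hm := path_mono (n := n) (ℓ := ℓ) (S := S) (v := v) (d := d) hlr
  generalize path n ℓ S v d r = m at hm ⊢
  generalize path n ℓ S v d l = k at hm ⊢
  clear hlr hr
  induction m, hm using Nat.le_induction with
  | base => simp
  | succ r hlr ih =>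
    rw [Finset.Ico_add_one_right_eq_Icc, ← Finset.Ico_insert_right hlr, Finset.filter_insert,
      cnt_succ, ← ih]
    by_cases h : levelBit n ℓ S d r = false
    · have h' : (levelSeq n ℓ S d r).testBit (ℓ - 1 - d) = false := h
      rw [if_pos h, if_pos h', Finset.card_insert_of_notMem (by simp), add_assoc]
    · have h' : ¬ (levelSeq n ℓ S d r).testBit (ℓ - 1 - d) = false := h
      rw [if_neg h, if_neg h', add_zero]

/-- With one more bit taken into account, exactly those elements become smaller than `v` that agreed
with it so far and have `0` where `v` has `1`. If `v` has `0` there, none do. -/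
theorem lessCnt_of_true (hd : d < ℓ) (hb : v.testBit (ℓ - 1 - d) = true) :
    lessCnt S l r v (ℓ - (d + 1)) = lessCnt S l r v (ℓ - d) +
      ((Finset.Ico l r).filter fun p => (S p).testBit (ℓ - 1 - d) = false ∧
        S p / 2 ^ (ℓ - d) = v / 2 ^ (ℓ - d)).card := by
  rw [lessCnt, lessCnt, ← Finset.card_union_of_disjoint, ← Finset.filter_or]
  · congr 1
    refine Finset.filter_congr fun p _ => ?_
    rw [show ℓ - (d + 1) = ℓ - 1 - d by omega, show ℓ - d = (ℓ - 1 - d) + 1 by omega, pow_succ,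
      ← Nat.div_div_eq_div_mul, ← Nat.div_div_eq_div_mul, Nat.testBit_eq_decide_div_mod_eq]
    rw [Nat.testBit_eq_decide_div_mod_eq] at hb
    generalize S p / 2 ^ (ℓ - 1 - d) = a at *
    generalize v / 2 ^ (ℓ - 1 - d) = c at *
    simp only [decide_eq_true_eq, decide_eq_false_iff_not] at *
    omega
  · refine Finset.disjoint_filter.2 fun p _ h1 h2 => ?_
    omega

theorem lessCnt_of_false (hd : d < ℓ) (hb : v.testBit (ℓ - 1 - d) = false) :
    lessCnt S l r v (ℓ - (d + 1)) = lessCnt S l r v (ℓ - d) := by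
  rw [lessCnt, lessCnt]
  congr 1
  refine Finset.filter_congr fun p _ => ?_
  rw [show ℓ - (d + 1) = ℓ - 1 - d by omega, show ℓ - d = (ℓ - 1 - d) + 1 by omega, pow_succ,
    ← Nat.div_div_eq_div_mul, ← Nat.div_div_eq_div_mul]
  rw [Nat.testBit_eq_decide_div_mod_eq] at hb
  generalize S p / 2 ^ (ℓ - 1 - d) = a at *
  generalize v / 2 ^ (ℓ - 1 - d) = c at *
  simp only [decide_eq_false_iff_not] at *
  omega

theorem lessCnt_anti {k k' : ℕ} (h : k ≤ k') : lessCnt S l r v k' ≤ lessCnt S l r v k := by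
  refine Finset.card_le_card (Finset.monotone_filter_right _ fun p _ hp => ?_)
  by_contra hcon
  have := Nat.div_le_div_right (c := 2 ^ (k' - k)) (not_lt.1 hcon)
  rw [Nat.div_div_eq_div_mul, Nat.div_div_eq_div_mul, ← pow_add, Nat.add_sub_cancel' h] at this
  exact absurd hp (not_lt.2 this)

theorem lessCnt_zero (hS : ∀ p < n, S p < 2 ^ ℓ) (hv : v < 2 ^ ℓ) (hr : r ≤ n) :
    lessCnt S l r v ℓ = 0 := by
  rw [lessCnt, Finset.card_eq_zero, Finset.filter_eq_empty_iff]
  intro p hp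
  rw [Finset.mem_Ico] at hp
  rw [Nat.div_eq_of_lt (hS p (by omega)), Nat.div_eq_of_lt hv]
  omega

/-- The search for the element `v` of a given rank goes to the elements with bit `0` if `v` has
bit `0`. -/
theorem lessCnt_lt (hd : d < ℓ) (hb : v.testBit (ℓ - 1 - d) = false) (hp : p ∈ Finset.Ico l r)
    (hv : S p = v) : lessCnt S l r v 0 < lessCnt S l r v (ℓ - d) +
      ((Finset.Ico l r).filter fun p => (S p).testBit (ℓ - 1 - d) = false ∧
        S p / 2 ^ (ℓ - d) = v / 2 ^ (ℓ - d)).card := by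
  rw [lessCnt, lessCnt, ← Finset.card_union_of_disjoint, ← Finset.filter_or]
  · refine Finset.card_lt_card (Finset.ssubset_iff_subset_ne.2 ⟨?_, fun h => ?_⟩)
    · refine Finset.monotone_filter_right _ fun q _ hq => ?_
      rw [pow_zero, Nat.div_one, Nat.div_one] at hq
      have h1 := Nat.div_le_div_right (c := 2 ^ (ℓ - 1 - d)) hq.le
      rw [show ℓ - d = (ℓ - 1 - d) + 1 by omega, pow_succ, ← Nat.div_div_eq_div_mul,
        ← Nat.div_div_eq_div_mul, Nat.testBit_eq_decide_div_mod_eq]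
      rw [Nat.testBit_eq_decide_div_mod_eq] at hb
      generalize S q / 2 ^ (ℓ - 1 - d) = a at *
      generalize v / 2 ^ (ℓ - 1 - d) = c at *
      simp only [decide_eq_false_iff_not] at *
      omega
    -- The inclusion is strict because the occurrence `p` of `v` itself is among the elements that
    -- agree so far and have bit `0`, but is not less than `v`.
    · have : p ∈ (Finset.Ico l r).filter fun p => S p / 2 ^ 0 < v / 2 ^ 0 := by
        rw [h, Finset.mem_filter]
        exact ⟨hp, Or.inr ⟨by rw [hv]; exact hb, by rw [hv]⟩⟩
      rw [Finset.mem_filter, hv] at this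
      exact lt_irrefl _ this.2
  · refine Finset.disjoint_filter.2 fun p _ h1 h2 => ?_
    omega

end

/-! ### Programs for a single level -/

/-- The bits of the wavelet matrix are stored level by level in `B`. -/
structure Levels (B : ℕ → Bool) (n ℓ : ℕ) (S : ℕ → ℕ) (M : ℕ) : Prop where
  bit : ∀ d < ℓ, ∀ q < n, B (d * n + q) = levelBit n ℓ S d q
  size : ℓ * n ≤ M

/-- Counts in the level with number `7`: `15` is the number of zeros in the level, `16` and `17` are
the numbers of ones before the positions `8` and `9`. -/
def levelP : Prog :=
  .seq (asg 14 (rankE (.var 7 * .var 0))) <|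
  .seq (asg 15 (.var 0 - (rankE (.var 7 * .var 0 + .var 0) - .var 14))) <|
  .seq (asg 16 (rankE (.var 7 * .var 0 + .var 8) - .var 14)) <|
  .seq (asg 17 (rankE (.var 7 * .var 0 + .var 9) - .var 14)) .skip

/-- Descent of the range from `8` to `9` to the elements with bit `18`. -/
def descentP : Prog :=
  .seq (asg 8 (.cond (.var 18) (.lit 1) (.var 8 - .var 16) (.var 15 + .var 16))) <|
  .seq (asg 9 (.cond (.var 18) (.lit 1) (.var 9 - .var 17) (.var 15 + .var 17))) <|
  .seq (asg 7 (.var 7 + .lit 1)) .skip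

/-- The bit of `e` that is relevant at the level with number `7`. -/
def bitE (e : Expr) : Expr := .bin .shr e (.var 13 - .lit 1 - .var 7) % .lit 2

/-- One level of counting the elements in a range that are less than `6`. -/
def countBody : Prog :=
  .seq levelP <|
  .seq (.seq (asg 18 (bitE (.var 6))) <|
    .seq (asg 10 (.cond (.var 18) (.lit 1) (.var 10)
      (.var 10 + ((.var 9 - .var 17) - (.var 8 - .var 16))))) .skip)
  descentP

/-- One level of finding the element with rank `12` in a range. -/
def findBody : Prog :=
  .seq levelP <|
  .seq (.seq (asg 19 ((.var 9 - .var 17) - (.var 8 - .var 16))) <|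
    .seq (asg 18 (.cond (.var 12) (.var 19) (.lit 0) (.lit 1))) <|
    .seq (asg 12 (.cond (.var 18) (.lit 1) (.var 12) (.var 12 - .var 19))) <|
    .seq (asg 11 (.lit 2 * .var 11 + .var 18)) .skip)
  descentP

/-- One level of the way back from a position in the last level. -/
def ascentBody : Prog :=
  .seq (.seq (asg 7 (.var 7 - .lit 1)) <|
    .seq (asg 14 (rankE (.var 7 * .var 0))) <|
    .seq (asg 15 (.var 0 - (rankE (.var 7 * .var 0 + .var 0) - .var 14))) <|
    .seq (asg 20 (bitE (.var 11))) <|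
    .seq (asg 21 (.cond (.var 20) (.lit 1) ((.var 7 * .var 0 - .var 14) + .var 8)
      (.var 14 + (.var 8 - .var 15)))) .skip) <|
  .seq selP (asg 8 (.var 21 - .var 7 * .var 0))

section
variable {B : ℕ → Bool} {F M W w : ℕ} {D : List Bool} {I : BitIndex B F M} {pv : ℕ → ℕ} {low : Arr}
  {ρ : ℕ → ℕ} {n ℓ : ℕ} {S : ℕ → ℕ} {d : ℕ}

theorem Levels.cnt_add (hL : Levels B n ℓ S M) (hd : d < ℓ) (b : Bool) {p : ℕ} (hp : p ≤ n) :
    cnt B b (d * n + p) = cnt B b (d * n) + cnt (levelBit n ℓ S d) b p := by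
  rw [RangeNextValue.cnt_add]
  congr 1
  exact cnt_congr fun t ht => hL.bit d hd t (by omega)

theorem Levels.le (hL : Levels B n ℓ S M) (hd : d < ℓ) : d * n + n ≤ M := by
  have := Nat.mul_le_mul_right n hd
  rw [Nat.succ_mul] at this
  exact this.trans hL.size

theorem bit_eval {x : ℕ} {e : Expr} (he : e.eval w D ρ = x) (hlit : 100 < 2 ^ w) (h7 : ρ 7 = d)
    (h13 : ρ 13 = ℓ) (hd : d < ℓ) (hℓ : ℓ < 2 ^ w) :
    (bitE e).eval w D ρ = (x.testBit (ℓ - 1 - d)).toNat := by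
  have v7 : (Expr.var 7).eval w D ρ = d := h7
  have v13 : (Expr.var 13).eval w D ρ = ℓ := h13
  rw [Nat.toNat_testBit]
  exact eval_mod (eval_shr he (eval_sub (eval_sub v13 (eval_lit (by omega)) (by omega) (by omega))
    v7 (by omega) (by omega))) (eval_lit (by omega))

/-- One index serves the concatenation of all levels; a count within a level is a difference of two
ranks in `B`. -/
theorem level_runs (hS : Served w D W (arrays I W pv low) M) (hP : IsParam F pv) (hF : 2 ≤ F)
    (hL : Levels B n ℓ S M) {l r : ℕ} (h0 : ρ 0 = n) (h5 : ρ 5 = W) (h7 : ρ 7 = d) (h8 : ρ 8 = l)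
    (h9 : ρ 9 = r) (hd : d < ℓ) (hl : l ≤ n) (hr : r ≤ n) :
    ∃ ρ', Runs w D levelP ρ ρ' levelP.cost ∧ (∀ x, x < 14 ∨ 17 < x → ρ' x = ρ x) ∧
      ρ' 15 = cnt (levelBit n ℓ S d) false n ∧ ρ' 16 = cnt (levelBit n ℓ S d) true l ∧
      ρ' 17 = cnt (levelBit n ℓ S d) true r := by
  have hM := hS.size_lt
  have hle := hL.le hd
  have c1 : ∀ p, cnt (levelBit n ℓ S d) true p ≤ p := cnt_le _ _
  have cl := c1 l
  have cr := c1 r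
  have cn := c1 n
  have cd := cnt_le B true (d * n)
  have hz := cnt_false_add_true (levelBit n ℓ S d) n
  have rk : ∀ (ρ' : ℕ → ℕ) (e : Expr) (p : ℕ), ρ' 0 = n → ρ' 5 = W → ρ' 7 = d →
      e.eval w D ρ' = p → p ≤ n → (rankE (.var 7 * .var 0 + e)).eval w D ρ' =
        cnt B true (d * n) + cnt (levelBit n ℓ S d) true p := by
    intro ρ' e p g0 g5 g7 he hp
    have v0 : (Expr.var 0).eval w D ρ' = n := g0
    have v7 : (Expr.var 7).eval w D ρ' = d := g7
    rw [rank_eval hS hP hF g5 (eval_add (eval_mul v7 v0 (by omega)) he (by omega)) (by omega),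
      hL.cnt_add hd true hp]
  let ρ₁ := Function.update ρ 14 (cnt B true (d * n))
  let ρ₂ := Function.update ρ₁ 15 (cnt (levelBit n ℓ S d) false n)
  let ρ₃ := Function.update ρ₂ 16 (cnt (levelBit n ℓ S d) true l)
  have e1 : (rankE (.var 7 * .var 0)).eval w D ρ = cnt B true (d * n) := by
    have v0 : (Expr.var 0).eval w D ρ = n := h0
    have v7 : (Expr.var 7).eval w D ρ = d := h7
    exact rank_eval hS hP hF h5 (eval_mul v7 v0 (by omega)) (by omega)
  have e2 : (Expr.var 0 - (rankE (.var 7 * .var 0 + .var 0) - .var 14)).eval w D ρ₁ =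
      cnt (levelBit n ℓ S d) false n := by
    have v0 : (Expr.var 0).eval w D ρ₁ = n := by simpa [ρ₁, Expr.eval] using h0
    have v14 : (Expr.var 14).eval w D ρ₁ = cnt B true (d * n) := by simp [ρ₁, Expr.eval]
    rw [eval_sub v0 (eval_sub (rk ρ₁ _ n v0 (by simpa [ρ₁] using h5) (by simpa [ρ₁] using h7) v0
      le_rfl) v14 (by omega) (by omega)) (by omega) (by omega)]
    omega
  have e3 : (rankE (.var 7 * .var 0 + .var 8) - .var 14).eval w D ρ₂ =
      cnt (levelBit n ℓ S d) true l := by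
    have v8 : (Expr.var 8).eval w D ρ₂ = l := by simpa [ρ₂, ρ₁, Expr.eval] using h8
    have v14 : (Expr.var 14).eval w D ρ₂ = cnt B true (d * n) := by simp [ρ₂, ρ₁, Expr.eval]
    rw [eval_sub (rk ρ₂ _ l (by simpa [ρ₂, ρ₁] using h0) (by simpa [ρ₂, ρ₁] using h5)
      (by simpa [ρ₂, ρ₁] using h7) v8 hl) v14 (by omega) (by omega)]
    omega
  have e4 : (rankE (.var 7 * .var 0 + .var 9) - .var 14).eval w D ρ₃ =
      cnt (levelBit n ℓ S d) true r := by
    have v9 : (Expr.var 9).eval w D ρ₃ = r := by simpa [ρ₃, ρ₂, ρ₁, Expr.eval] using h9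
    have v14 : (Expr.var 14).eval w D ρ₃ = cnt B true (d * n) := by
      simp [ρ₃, ρ₂, ρ₁, Expr.eval]
    rw [eval_sub (rk ρ₃ _ r (by simpa [ρ₃, ρ₂, ρ₁] using h0) (by simpa [ρ₃, ρ₂, ρ₁] using h5)
      (by simpa [ρ₃, ρ₂, ρ₁] using h7) v9 hr) v14 (by omega) (by omega)]
    omega
  refine ⟨_, Runs.asg_seq e1 <| Runs.asg_seq e2 <| Runs.asg_seq e3 <| Runs.asg_seq e4 Runs.skip,
    fun x hx => ?_, by simp, by simp, by simp⟩
  simp [show x ≠ 14 by omega, show x ≠ 15 by omega, show x ≠ 16 by omega, show x ≠ 17 by omega]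

theorem descent_runs {l r : ℕ} {b : Bool} (hlit : 100 < 2 ^ w) (hn : n < 2 ^ w) (h7 : ρ 7 = d)
    (h8 : ρ 8 = l) (h9 : ρ 9 = r) (hl : l ≤ n) (hr : r ≤ n) (hd : d < ℓ) (hℓ : ℓ < 2 ^ w)
    (h15 : ρ 15 = cnt (levelBit n ℓ S d) false n) (h16 : ρ 16 = cnt (levelBit n ℓ S d) true l)
    (h17 : ρ 17 = cnt (levelBit n ℓ S d) true r) (h18 : ρ 18 = b.toNat) :
    ∃ ρ', Runs w D descentP ρ ρ' descentP.cost ∧ (∀ x, x < 7 ∨ 9 < x → ρ' x = ρ x) ∧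
      ρ' 7 = d + 1 ∧ ρ' 8 = down n ℓ S d b l ∧ ρ' 9 = down n ℓ S d b r := by
  have hz := cnt_false_add_true (levelBit n ℓ S d) n
  have key : ∀ (ρ' : ℕ → ℕ) (p k m : ℕ), p ≤ n → ρ' k = p →
      ρ' m = cnt (levelBit n ℓ S d) true p → ρ' 18 = b.toNat →
      ρ' 15 = cnt (levelBit n ℓ S d) false n →
      (Expr.cond (.var 18) (.lit 1) (.var k - .var m) (.var 15 + .var m)).eval w D ρ' =
        down n ℓ S d b p := by
    intro ρ' p k m hp gk gm g18 g15
    have vk : (Expr.var k).eval w D ρ' = p := gk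
    have vm : (Expr.var m).eval w D ρ' = _ := gm
    have v18 : (Expr.var 18).eval w D ρ' = _ := g18
    have v15 : (Expr.var 15).eval w D ρ' = _ := g15
    have h1 := cnt_false_add_true (levelBit n ℓ S d) p
    have h2 := cnt_mono (levelBit n ℓ S d) true hp
    refine (eval_cond v18 (eval_lit (by omega)) (fun _ => eval_sub vk vm (by omega) (by omega))
      (fun _ => eval_add v15 vm (by omega))).trans ?_
    cases b
    · simp [down]; omega
    · simp [down]
  refine ⟨_, Runs.asg_seq (key ρ l 8 16 hl h8 h16 h18 h15) <| Runs.asg_seq (key _ r 9 17 hr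
    (by simpa using h9) (by simpa using h17) (by simpa using h18) (by simpa using h15)) <|
    Runs.asg_seq (v := d + 1) (eval_add (by simpa [Expr.eval] using h7) (eval_lit (by omega))
      (by omega)) Runs.skip, fun x hx => ?_, by simp, by simp, by simp⟩
  simp [show x ≠ 7 by omega, show x ≠ 8 by omega, show x ≠ 9 by omega]

theorem countBody_runs (hS : Served w D W (arrays I W pv low) M) (hP : IsParam F pv) (hF : 2 ≤ F)
    (hL : Levels B n ℓ S M) {l r c v : ℕ} (h0 : ρ 0 = n) (h5 : ρ 5 = W) (h7 : ρ 7 = d)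
    (h8 : ρ 8 = l) (h9 : ρ 9 = r) (h6 : ρ 6 = v) (h10 : ρ 10 = c) (h13 : ρ 13 = ℓ)
    (hd : d < ℓ) (hlr : l ≤ r) (hr : r ≤ n) (hc : c + n < 2 ^ w) (hℓ : ℓ < 2 ^ w) :
    ∃ ρ', Runs w D countBody ρ ρ' countBody.cost ∧
      (∀ x, x < 7 ∨ x = 13 ∨ 25 < x → ρ' x = ρ x) ∧
      ρ' 7 = d + 1 ∧ ρ' 8 = down n ℓ S d (v.testBit (ℓ - 1 - d)) l ∧
      ρ' 9 = down n ℓ S d (v.testBit (ℓ - 1 - d)) r ∧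
      ρ' 10 = if v.testBit (ℓ - 1 - d) = true then c + (cnt (levelBit n ℓ S d) false r -
        cnt (levelBit n ℓ S d) false l) else c := by
  have hlit := hS.lit_lt
  obtain ⟨ρ₁, r1, f1, h15, h16, h17⟩ := level_runs hS hP hF hL h0 h5 h7 h8 h9 hd (hlr.trans hr) hr
  have hfl := cnt_false_add_true (levelBit n ℓ S d) l
  have hfr := cnt_false_add_true (levelBit n ℓ S d) r
  have hm := cnt_mono (levelBit n ℓ S d) false hlr
  have g7 : ρ₁ 7 = d := by rw [f1 7 (by omega), h7]
  have g8 : ρ₁ 8 = l := by rw [f1 8 (by omega), h8]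
  have g9 : ρ₁ 9 = r := by rw [f1 9 (by omega), h9]
  have g10 : ρ₁ 10 = c := by rw [f1 10 (by omega), h10]
  have g13 : ρ₁ 13 = ℓ := by rw [f1 13 (by omega), h13]
  have e1 := bit_eval (D := D) (ρ := ρ₁) (e := .var 6) (x := v) (by rw [eval_var, f1 6 (by omega), h6]) hlit
    g7 g13 hd hℓ
  let b := v.testBit (ℓ - 1 - d)
  let ρ₂ := Function.update ρ₁ 18 b.toNat
  have e2 : (Expr.cond (.var 18) (.lit 1) (.var 10)
      (.var 10 + ((.var 9 - .var 17) - (.var 8 - .var 16)))).eval w D ρ₂ =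
      if b = true then c + (cnt (levelBit n ℓ S d) false r -
        cnt (levelBit n ℓ S d) false l) else c := by
    have v18 : (Expr.var 18).eval w D ρ₂ = b.toNat := by simp [ρ₂, Expr.eval]
    have v8 : (Expr.var 8).eval w D ρ₂ = l := by simpa [ρ₂, Expr.eval] using g8
    have v9 : (Expr.var 9).eval w D ρ₂ = r := by simpa [ρ₂, Expr.eval] using g9
    have v10 : (Expr.var 10).eval w D ρ₂ = c := by simpa [ρ₂, Expr.eval] using g10
    have v16 : (Expr.var 16).eval w D ρ₂ = cnt (levelBit n ℓ S d) true l := by simpa [ρ₂, Expr.eval] using h16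
    have v17 : (Expr.var 17).eval w D ρ₂ = cnt (levelBit n ℓ S d) true r := by simpa [ρ₂, Expr.eval] using h17
    refine (eval_cond v18 (eval_lit (by omega)) (fun _ => v10) (fun _ => eval_add v10 (eval_sub
      (eval_sub v9 v17 (by omega) (by omega)) (eval_sub v8 v16 (by omega) (by omega)) (by omega)
      (by omega)) (by omega))).trans ?_
    cases b
    · simp
    · simp; omega
  obtain ⟨ρ₃, r3, f3, k7, k8, k9⟩ := descent_runs (ρ := Function.update ρ₂ 10 (if b = true then
    c + (cnt (levelBit n ℓ S d) false r - cnt (levelBit n ℓ S d) false l) else c)) (D := D)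
    (b := b) (r := r) (l := l) (n := n) (S := S) hlit (by omega) (by simpa [ρ₂] using g7)
    (by simpa [ρ₂] using g8) (by simpa [ρ₂] using g9) (hlr.trans hr) hr hd hℓ (by simpa [ρ₂] using h15)
    (by simpa [ρ₂] using h16) (by simpa [ρ₂] using h17) (by simp [ρ₂])
  refine ⟨ρ₃, r1.seq ((Runs.asg_seq e1 <| Runs.asg_seq e2 Runs.skip).seq r3), fun x hx => ?_, k7, k8,
    k9, ?_⟩
  · rw [f3 x (by omega), Function.update_of_ne (by omega)]
    simp only [ρ₂]
    rw [Function.update_of_ne (by omega), f1 x (by omega)]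
  · rw [f3 10 (by omega), Function.update_self]

/-- The bit `b` is a parameter tied to the comparison by an equation, so that `find_runs` can insert
the bit of the element sought. -/
theorem findBody_runs (hS : Served w D W (arrays I W pv low) M) (hP : IsParam F pv) (hF : 2 ≤ F)
    (hL : Levels B n ℓ S M) {l r k v : ℕ} (h0 : ρ 0 = n) (h5 : ρ 5 = W) (h7 : ρ 7 = d)
    (h8 : ρ 8 = l) (h9 : ρ 9 = r) (h11 : ρ 11 = v) (h12 : ρ 12 = k) (b : Bool)
    (hb : b = decide (cnt (levelBit n ℓ S d) false r - cnt (levelBit n ℓ S d) false l ≤ k))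
    (hd : d < ℓ) (hlr : l ≤ r) (hr : r ≤ n) (hk : k < 2 ^ w) (hv : 2 * v + 1 < 2 ^ w)
    (hℓ : ℓ < 2 ^ w) :
    ∃ ρ', Runs w D findBody ρ ρ' findBody.cost ∧
      (∀ x, x < 7 ∨ x = 10 ∨ x = 13 ∨ 25 < x → ρ' x = ρ x) ∧
      ρ' 7 = d + 1 ∧ ρ' 8 = down n ℓ S d b l ∧ ρ' 9 = down n ℓ S d b r ∧
      ρ' 11 = 2 * v + b.toNat ∧
      ρ' 12 = if b = true then k - (cnt (levelBit n ℓ S d) false r -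
        cnt (levelBit n ℓ S d) false l) else k := by
  have hlit := hS.lit_lt
  have hM := hS.size_lt
  have hle := hL.le hd
  obtain ⟨ρ₁, r1, f1, h15, h16, h17⟩ := level_runs hS hP hF hL h0 h5 h7 h8 h9 hd (hlr.trans hr) hr
  have hfl := cnt_false_add_true (levelBit n ℓ S d) l
  have hfr := cnt_false_add_true (levelBit n ℓ S d) r
  have hm := cnt_mono (levelBit n ℓ S d) false hlr
  have g7 : ρ₁ 7 = d := by rw [f1 7 (by omega), h7]
  have g8 : ρ₁ 8 = l := by rw [f1 8 (by omega), h8]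
  have g9 : ρ₁ 9 = r := by rw [f1 9 (by omega), h9]
  have g11 : ρ₁ 11 = v := by rw [f1 11 (by omega), h11]
  have g12 : ρ₁ 12 = k := by rw [f1 12 (by omega), h12]
  let z := cnt (levelBit n ℓ S d) false r - cnt (levelBit n ℓ S d) false l
  let ρ₂ := Function.update ρ₁ 19 z
  let ρ₃ := Function.update ρ₂ 18 b.toNat
  let k' := if b = true then k - z else k
  let ρ₄ := Function.update ρ₃ 12 k'
  let ρ₅ := Function.update ρ₄ 11 (2 * v + b.toNat)
  have hz : z = cnt (levelBit n ℓ S d) false r - cnt (levelBit n ℓ S d) false l := rfl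
  have hbt := b.toNat_lt
  have e1 : ((Expr.var 9 - .var 17) - (.var 8 - .var 16)).eval w D ρ₁ = z := by
    have v8 : (Expr.var 8).eval w D ρ₁ = l := g8
    have v9 : (Expr.var 9).eval w D ρ₁ = r := g9
    have v16 : (Expr.var 16).eval w D ρ₁ = _ := h16
    have v17 : (Expr.var 17).eval w D ρ₁ = _ := h17
    rw [eval_sub (eval_sub v9 v17 (by omega) (by omega)) (eval_sub v8 v16 (by omega) (by omega))
      (by omega) (by omega)]
    omega
  have e2 : (Expr.cond (.var 12) (.var 19) (.lit 0) (.lit 1)).eval w D ρ₂ = b.toNat := by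
    have v12 : (Expr.var 12).eval w D ρ₂ = k := by simpa [ρ₂, Expr.eval] using g12
    have v19 : (Expr.var 19).eval w D ρ₂ = z := by simp [ρ₂, Expr.eval]
    refine (eval_cond v12 v19 (fun _ => eval_lit (by omega)) (fun _ => eval_lit (by omega))).trans ?_
    rw [hb]
    by_cases hkz : k < z
    · rw [if_pos hkz, decide_eq_false (by omega)]; rfl
    · rw [if_neg hkz, decide_eq_true (by omega)]; rfl
  have hzk : b = true → z ≤ k := fun h => by
    rw [hb, decide_eq_true_eq] at h; exact h
  have e3 : (Expr.cond (.var 18) (.lit 1) (.var 12) (.var 12 - .var 19)).eval w D ρ₃ = k' := by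
    have v12 : (Expr.var 12).eval w D ρ₃ = k := by simpa [ρ₃, ρ₂, Expr.eval] using g12
    have v18 : (Expr.var 18).eval w D ρ₃ = b.toNat := by simp [ρ₃, Expr.eval]
    have v19 : (Expr.var 19).eval w D ρ₃ = z := by simp [ρ₃, ρ₂, Expr.eval]
    have hb1 : ¬ b.toNat < 1 → b = true := fun h => by
      cases h' : b
      · rw [h'] at h; simp at h
      · rfl
    refine (eval_cond v18 (eval_lit (by omega)) (fun _ => v12) (fun h => eval_sub v12 v19 hk
      (hzk (hb1 h)))).trans ?_
    simp only [k']
    clear hb hzk hb1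
    cases b <;> simp
  have e4 : (Expr.lit 2 * .var 11 + .var 18).eval w D ρ₄ = 2 * v + b.toNat :=
    eval_add (eval_mul (eval_lit (by omega)) (by simpa [ρ₄, ρ₃, ρ₂, Expr.eval] using g11)
      (by omega)) (by simp [ρ₄, ρ₃, Expr.eval]) (by omega)
  obtain ⟨ρ₆, r3, f3, k7, k8, k9⟩ := descent_runs (ρ := ρ₅) (D := D)
    (b := b) (r := r) (l := l) (n := n) (S := S) hlit (by omega)
    (by simpa [ρ₅, ρ₄, ρ₃, ρ₂] using g7) (by simpa [ρ₅, ρ₄, ρ₃, ρ₂] using g8)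
    (by simpa [ρ₅, ρ₄, ρ₃, ρ₂] using g9) (hlr.trans hr) hr hd hℓ
    (by simpa [ρ₅, ρ₄, ρ₃, ρ₂] using h15) (by simpa [ρ₅, ρ₄, ρ₃, ρ₂] using h16)
    (by simpa [ρ₅, ρ₄, ρ₃, ρ₂] using h17) (by simp [ρ₅, ρ₄, ρ₃])
  refine ⟨ρ₆, r1.seq ((Runs.asg_seq e1 <| Runs.asg_seq e2 <| Runs.asg_seq e3 <|
    Runs.asg_seq e4 Runs.skip).seq r3), fun x hx => ?_, k7, k8, k9, ?_, ?_⟩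
  · rw [f3 x (by omega)]
    simp only [ρ₅, ρ₄, ρ₃, ρ₂]
    rw [Function.update_of_ne (by omega), Function.update_of_ne (by omega),
      Function.update_of_ne (by omega), Function.update_of_ne (by omega), f1 x (by omega)]
  · rw [f3 11 (by omega)]; simp [ρ₅]
  · rw [f3 12 (by omega)]; simp [ρ₅, ρ₄, k', z]

/-- The position below gives the rank of the element among the bits of its kind in level `d`. Adding
the number of such bits in the earlier levels makes it a rank in `B`, which is then selected. -/
theorem ascentBody_runs (hS : Served w D W (arrays I W pv low) M) (hP : IsParam F pv) (hF : 2 ≤ F)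
    (hL : Levels B n ℓ S M) {p v : ℕ} (h0 : ρ 0 = n) (h5 : ρ 5 = W) (h7 : ρ 7 = d + 1)
    (h8 : ρ 8 = path n ℓ S v (d + 1) p) (h11 : ρ 11 = v) (h13 : ρ 13 = ℓ)
    (hd : d < ℓ) (hp : p < n) (hv : S p = v) (hℓ : ℓ < 2 ^ w) :
    ∃ ρ', Runs w D ascentBody ρ ρ' ascentBody.cost ∧
      (∀ x, x < 7 ∨ 8 < x ∧ x < 14 ∨ x = 19 ∨ 25 < x → ρ' x = ρ x) ∧
      ρ' 7 = d ∧ ρ' 8 = path n ℓ S v d p := by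
  have hlit := hS.lit_lt
  have hM := hS.size_lt
  have hle := hL.le hd
  have cd := cnt_false_add_true B (d * n)
  have hz := cnt_false_add_true (levelBit n ℓ S d) n
  obtain ⟨hpn, -⟩ := path_spec (ℓ := ℓ) (d := d) hp hv
  have hbit := levelBit_path (ℓ := ℓ) (d := d) hp hv
  let b := v.testBit (ℓ - 1 - d)
  let q := d * n + path n ℓ S v d p
  have hq : q < M := by simp only [q]; omega
  have hBq : B q = b := by simp only [q]; rw [hL.bit d hd _ hpn, hbit]
  have hcq : cnt B (B q) q = cnt B b (d * n) + cnt (levelBit n ℓ S d) b (path n ℓ S v d p) := by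
    rw [hBq]; exact hL.cnt_add hd b hpn.le
  have hle1 := cnt_lt_cnt (hbit : _ = b) hpn
  have h8' : ρ 8 = if b = true then cnt (levelBit n ℓ S d) false n +
      cnt (levelBit n ℓ S d) true (path n ℓ S v d p)
      else cnt (levelBit n ℓ S d) false (path n ℓ S v d p) := by
    rw [h8, path, down]
  let ρ₁ := Function.update ρ 7 d
  let ρ₂ := Function.update ρ₁ 14 (cnt B true (d * n))
  let ρ₃ := Function.update ρ₂ 15 (cnt (levelBit n ℓ S d) false n)
  let ρ₄ := Function.update ρ₃ 20 b.toNat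
  let ρ₅ := Function.update ρ₄ 21 (cnt B (B q) q)
  have e1 : (Expr.var 7 - .lit 1).eval w D ρ = d := by
    have v7 : (Expr.var 7).eval w D ρ = d + 1 := h7
    rw [eval_sub v7 (eval_lit (by omega)) (by omega) (by omega)]
    omega
  have e2 : (rankE (.var 7 * .var 0)).eval w D ρ₁ = cnt B true (d * n) := by
    have v0 : (Expr.var 0).eval w D ρ₁ = n := by simpa [ρ₁, Expr.eval] using h0
    have v7 : (Expr.var 7).eval w D ρ₁ = d := by simp [ρ₁, Expr.eval]
    exact rank_eval hS hP hF (by simpa [ρ₁] using h5) (eval_mul v7 v0 (by omega)) (by omega)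
  have e3 : (Expr.var 0 - (rankE (.var 7 * .var 0 + .var 0) - .var 14)).eval w D ρ₂ =
      cnt (levelBit n ℓ S d) false n := by
    have v0 : (Expr.var 0).eval w D ρ₂ = n := by simpa [ρ₂, ρ₁, Expr.eval] using h0
    have v7 : (Expr.var 7).eval w D ρ₂ = d := by simp [ρ₂, ρ₁, Expr.eval]
    have v14 : (Expr.var 14).eval w D ρ₂ = cnt B true (d * n) := by simp [ρ₂, Expr.eval]
    rw [eval_sub v0 (eval_sub (rank_eval hS hP hF (by simpa [ρ₂, ρ₁] using h5)
      (eval_add (eval_mul v7 v0 (by omega)) v0 (by omega)) (by omega)) v14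
      ((cnt_le _ _ _).trans_lt (by omega)) (by rw [hL.cnt_add hd true le_rfl]; omega)) (by omega)
      (by rw [hL.cnt_add hd true le_rfl]; omega), hL.cnt_add hd true le_rfl]
    omega
  have e4 : (bitE (.var 11)).eval w D ρ₃ = b.toNat :=
    bit_eval (by simpa [ρ₃, ρ₂, ρ₁, Expr.eval] using h11) hlit (by simp [ρ₃, ρ₂, ρ₁])
      (by simpa [ρ₃, ρ₂, ρ₁] using h13) hd hℓ
  have e5 : (Expr.cond (.var 20) (.lit 1) ((.var 7 * .var 0 - .var 14) + .var 8)
      (.var 14 + (.var 8 - .var 15))).eval w D ρ₄ = cnt B (B q) q := by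
    have v20 : (Expr.var 20).eval w D ρ₄ = b.toNat := by simp [ρ₄, Expr.eval]
    have v0 : (Expr.var 0).eval w D ρ₄ = n := by simpa [ρ₄, ρ₃, ρ₂, ρ₁, Expr.eval] using h0
    have v7 : (Expr.var 7).eval w D ρ₄ = d := by simp [ρ₄, ρ₃, ρ₂, ρ₁, Expr.eval]
    have v8 : (Expr.var 8).eval w D ρ₄ = if b = true then cnt (levelBit n ℓ S d) false n +
        cnt (levelBit n ℓ S d) true (path n ℓ S v d p)
        else cnt (levelBit n ℓ S d) false (path n ℓ S v d p) := by
      have g8 : ρ₄ 8 = ρ 8 := by simp [ρ₄, ρ₃, ρ₂, ρ₁]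
      rw [eval_var, g8, h8']
    have hcf := cnt_le (levelBit n ℓ S d) false (path n ℓ S v d p)
    have hct := cnt_mono (levelBit n ℓ S d) true hpn.le
    have v14 : (Expr.var 14).eval w D ρ₄ = cnt B true (d * n) := by
      simp [ρ₄, ρ₃, ρ₂, ρ₁, Expr.eval]
    have v15 : (Expr.var 15).eval w D ρ₄ = cnt (levelBit n ℓ S d) false n := by
      simp [ρ₄, ρ₃, ρ₂, ρ₁, Expr.eval]
    rw [hcq]
    clear_value ρ₄ b
    clear h8'
    cases b
    · simp only [Bool.false_eq_true, if_false] at v8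
      -- The branch not taken gets the dummy value `0`: it needs no evaluation, and here its
      -- subtraction may wrap around.
      refine (eval_cond v20 (eval_lit (by omega)) (fun _ => eval_add (eval_sub (eval_mul v7 v0
        (by omega)) v14 (by omega) (by omega)) v8 (by omega))
        (v := 0) (fun h => absurd (by simp) h)).trans ?_
      simp; omega
    · simp only [if_true] at v8
      refine (eval_cond v20 (eval_lit (by omega)) (u := 0) (fun h => absurd h (by simp))
        (fun _ => eval_add v14 (eval_sub v8 v15 (by omega) (by omega)) (by omega))).trans ?_
      simp
  obtain ⟨ρ₆, r6, f6, h21⟩ := sel_runs (ρ := ρ₅) hS hP hF (by simpa [ρ₅, ρ₄, ρ₃, ρ₂, ρ₁] using h5)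
    hq (by rw [hBq]; simp [ρ₅, ρ₄]) (by simp [ρ₅])
  have g7 : ρ₆ 7 = d := by rw [f6 7 (by omega)]; simp [ρ₅, ρ₄, ρ₃, ρ₂, ρ₁]
  have e6 : (Expr.var 21 - .var 7 * .var 0).eval w D ρ₆ = path n ℓ S v d p := by
    have v0 : (Expr.var 0).eval w D ρ₆ = n := by
      rw [eval_var, f6 0 (by omega)]; simpa [ρ₅, ρ₄, ρ₃, ρ₂, ρ₁] using h0
    have v7 : (Expr.var 7).eval w D ρ₆ = d := g7
    have v21 : (Expr.var 21).eval w D ρ₆ = q := h21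
    rw [eval_sub v21 (eval_mul v7 v0 (by omega)) (by omega) (by omega)]
    omega
  refine ⟨_, (Runs.asg_seq e1 <| Runs.asg_seq e2 <| Runs.asg_seq e3 <| Runs.asg_seq e4 <|
    Runs.asg_seq e5 Runs.skip).seq (r6.seq (Runs.asg e6)), fun x hx => ?_, ?_, by simp⟩
  · rw [Function.update_of_ne (by omega), f6 x (by omega)]
    simp only [ρ₅, ρ₄, ρ₃, ρ₂, ρ₁]
    rw [Function.update_of_ne (by omega), Function.update_of_ne (by omega),
      Function.update_of_ne (by omega), Function.update_of_ne (by omega),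
      Function.update_of_ne (by omega)]
  · rw [Function.update_of_ne (by omega), g7]

end

/-! ### Traversing all levels -/

/-- Rank and selection queries are served, on the wavelet matrix of `S[0, n)` among others. -/
structure Indexed (w : ℕ) (D : List Bool) (W : ℕ) {B : ℕ → Bool} {F M : ℕ} (I : BitIndex B F M)
    (pv : ℕ → ℕ) (low : Arr) (n ℓ : ℕ) (S : ℕ → ℕ) : Prop where
  served : Served w D W (arrays I W pv low) M
  param : IsParam F pv
  two_le : 2 ≤ F
  levels : Levels B n ℓ S M
  lt : ∀ p < n, S p < 2 ^ ℓ
  n_lt : 2 * n < 2 ^ w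
  ell_lt : 2 ^ ℓ < 2 ^ w

section
variable {B : ℕ → Bool} {F M W w : ℕ} {D : List Bool} {I : BitIndex B F M} {pv : ℕ → ℕ} {low : Arr}
  {ρ : ℕ → ℕ} {n ℓ : ℕ} {S : ℕ → ℕ} {l r v : ℕ}

theorem lessCnt_le (hr : r ≤ n) (k : ℕ) : lessCnt S l r v k ≤ n := by
  refine (Finset.card_filter_le _ _).trans ?_
  rw [Nat.card_Ico]; omega

/-- At level `d` the counter holds the number of elements that are smaller than `v` in the first `d`
bits: zero at the start, the full count at the end. It is not required that `v` occurs. -/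
theorem count_runs (hI : Indexed w D W I pv low n ℓ S) (h0 : ρ 0 = n) (h5 : ρ 5 = W)
    (h6 : ρ 6 = v) (h7 : ρ 7 = 0) (h8 : ρ 8 = l) (h9 : ρ 9 = r) (h10 : ρ 10 = 0) (h13 : ρ 13 = ℓ)
    (hlr : l ≤ r) (hr : r ≤ n) (hv : v < 2 ^ ℓ) :
    ∃ ρ', Runs w D (.loop (.lt (2 * 7) (2 * 13)) countBody) ρ ρ' (ℓ * (countBody.cost + 1) + 1) ∧
      (∀ x, x < 7 ∨ x = 13 ∨ 25 < x → ρ' x = ρ x) ∧ ρ' 10 = lessCnt S l r v 0 := by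
  have hℓ : ℓ < 2 ^ w := Nat.lt_two_pow_self.trans hI.ell_lt
  obtain ⟨ρ', m', h1, ⟨d, hd, hf, h7', h8', h9', h10'⟩, h3⟩ := Runs.loop (w := w) (D := D)
    (P := countBody) (a := 7) (b := 13) (T := countBody.cost) (fun m ρ' => ∃ d, d + m = ℓ ∧
      (∀ x, x < 7 ∨ x = 13 ∨ 25 < x → ρ' x = ρ x) ∧ ρ' 7 = d ∧ ρ' 8 = path n ℓ S v d l ∧
      ρ' 9 = path n ℓ S v d r ∧ ρ' 10 = lessCnt S l r v (ℓ - d))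
    (by
      rintro m ρ₁ ⟨d, hd, hf, g7, g8, g9, g10⟩ hlt
      have g13 : ρ₁ 13 = ℓ := by rw [hf 13 (by omega), h13]
      rw [g7, g13] at hlt
      have hc := lessCnt_le (S := S) (l := l) (v := v) hr (ℓ - d)
      have hn := hI.n_lt
      obtain ⟨ρ₂, r2, f2, k7, k8, k9, k10⟩ := countBody_runs hI.served hI.param hI.two_le hI.levels
        (by rw [hf 0 (by omega), h0]) (by rw [hf 5 (by omega), h5]) g7 g8 g9
        (by rw [hf 6 (by omega), h6]) g10 g13 hlt (path_mono hlr) (path_le hr) (by omega) hℓ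
      refine ⟨ρ₂, m - 1, by omega, r2, d + 1, by omega, fun x hx => by rw [f2 x hx, hf x hx], k7, k8,
        k9, ?_⟩
      rw [k10]
      have hz := zeros_path (S := S) hlr hr hI.lt hv hlt
      split_ifs with hb
      · rw [lessCnt_of_true hlt hb]; omega
      · rw [lessCnt_of_false hlt (by simpa using hb)])
    ℓ ⟨0, by omega, fun _ _ => rfl, h7, h8, h9, by
      rw [h10, Nat.sub_zero, lessCnt_zero hI.lt hv hr]⟩
  refine ⟨ρ', h1, hf, ?_⟩
  rw [h7', hf 13 (by omega), h13] at h3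
  rw [h10', show ℓ - d = 0 by omega]

/-- The invariant keeps the first `d` bits of `v` in variable `11`, and in `12` the number of
elements less than `v` among those that agree with it so far. Comparing the latter with the number
of zeros in the range yields the next bit, by `lessCnt_lt` or `lessCnt_of_true`. -/
theorem find_runs (hI : Indexed w D W I pv low n ℓ S) {p : ℕ} (h0 : ρ 0 = n) (h5 : ρ 5 = W)
    (h7 : ρ 7 = 0) (h8 : ρ 8 = l) (h9 : ρ 9 = r) (h11 : ρ 11 = 0)
    (h12 : ρ 12 = lessCnt S l r v 0) (h13 : ρ 13 = ℓ)
    (hp : p ∈ Finset.Ico l r) (hr : r ≤ n) (hv : v < 2 ^ ℓ) (hpv : S p = v) :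
    ∃ ρ', Runs w D (.loop (.lt (2 * 7) (2 * 13)) findBody) ρ ρ' (ℓ * (findBody.cost + 1) + 1) ∧
      (∀ x, x < 7 ∨ x = 10 ∨ x = 13 ∨ 25 < x → ρ' x = ρ x) ∧ ρ' 7 = ℓ ∧
      ρ' 8 = path n ℓ S v ℓ l ∧ ρ' 11 = v := by
  have hℓ : ℓ < 2 ^ w := Nat.lt_two_pow_self.trans hI.ell_lt
  have h2ℓ := hI.ell_lt
  have hlr : l ≤ r := by rw [Finset.mem_Ico] at hp; omega
  have hc0 := lessCnt_le (S := S) (l := l) (v := v) hr 0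
  have hn := hI.n_lt
  obtain ⟨ρ', m', h1, ⟨d, hd, hf, h7', h8', h9', h11', h12'⟩, h3⟩ := Runs.loop (w := w) (D := D)
    (P := findBody) (a := 7) (b := 13) (T := findBody.cost) (fun m ρ' => ∃ d, d + m = ℓ ∧
      (∀ x, x < 7 ∨ x = 10 ∨ x = 13 ∨ 25 < x → ρ' x = ρ x) ∧ ρ' 7 = d ∧
      ρ' 8 = path n ℓ S v d l ∧ ρ' 9 = path n ℓ S v d r ∧ ρ' 11 = v / 2 ^ (ℓ - d) ∧
      ρ' 12 + lessCnt S l r v (ℓ - d) = lessCnt S l r v 0)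
    (by
      rintro m ρ₁ ⟨d, hd, hf, g7, g8, g9, g11, g12⟩ hlt
      have g13 : ρ₁ 13 = ℓ := by rw [hf 13 (by omega), h13]
      rw [g7, g13] at hlt
      have hz := zeros_path (S := S) hlr hr hI.lt hv hlt
      have hdiv : v / 2 ^ (ℓ - (d + 1)) = 2 * (v / 2 ^ (ℓ - d)) +
          (v.testBit (ℓ - 1 - d)).toNat := by
        rw [show ℓ - (d + 1) = ℓ - 1 - d by omega, show ℓ - d = (ℓ - 1 - d) + 1 by omega, pow_succ,
          ← Nat.div_div_eq_div_mul, Nat.toNat_testBit]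
        omega
      have hdle := Nat.div_le_self v (2 ^ (ℓ - (d + 1)))
      have hb : v.testBit (ℓ - 1 - d) = decide (cnt (levelBit n ℓ S d) false (path n ℓ S v d r) -
          cnt (levelBit n ℓ S d) false (path n ℓ S v d l) ≤ ρ₁ 12) := by
        cases hb : v.testBit (ℓ - 1 - d)
        · have := lessCnt_lt hlt hb hp hpv
          rw [decide_eq_false (by omega)]
        · have h1 := lessCnt_of_true (l := l) (r := r) (S := S) hlt hb
          have h2 := lessCnt_anti (S := S) (l := l) (r := r) (v := v) (Nat.zero_le (ℓ - (d + 1)))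
          rw [decide_eq_true (by omega)]
      obtain ⟨ρ₂, r2, f2, k7, k8, k9, k11, k12⟩ := findBody_runs hI.served hI.param hI.two_le
        hI.levels (by rw [hf 0 (by omega), h0]) (by rw [hf 5 (by omega), h5]) g7 g8 g9 g11 rfl
        (v.testBit (ℓ - 1 - d)) hb hlt (path_mono hlr) (path_le hr) (by omega) (by omega) hℓ
      refine ⟨ρ₂, m - 1, by omega, r2, d + 1, by omega, fun x hx => by rw [f2 x hx, hf x hx], k7, k8,
        k9, by rw [k11, hdiv], ?_⟩
      rw [k12]
      split_ifs with hb'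
      · have h1 := lessCnt_of_true (l := l) (r := r) (S := S) hlt hb'
        rw [hb', eq_comm, decide_eq_true_eq] at hb
        omega
      · rw [lessCnt_of_false hlt (by simpa using hb'), g12])
    ℓ ⟨0, by omega, fun _ _ => rfl, h7, h8, h9, by
      rw [h11, Nat.sub_zero, Nat.div_eq_of_lt hv], by
      rw [h12, Nat.sub_zero, lessCnt_zero hI.lt hv hr, add_zero]⟩
  rw [h7', hf 13 (by omega), h13] at h3
  obtain rfl : d = ℓ := by omega
  exact ⟨ρ', h1, hf, h7', h8', by rw [h11', Nat.sub_self, pow_zero, Nat.div_one]⟩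

theorem ascent_runs (hI : Indexed w D W I pv low n ℓ S) {p : ℕ} (h0 : ρ 0 = n) (h5 : ρ 5 = W)
    (h7 : ρ 7 = ℓ) (h8 : ρ 8 = path n ℓ S v ℓ p) (h11 : ρ 11 = v) (h13 : ρ 13 = ℓ)
    (h19 : ρ 19 = 0) (hp : p < n) (hv : S p = v) :
    ∃ ρ', Runs w D (.loop (.lt (2 * 19) (2 * 7)) ascentBody) ρ ρ'
      (ℓ * (ascentBody.cost + 1) + 1) ∧
      (∀ x, x < 7 ∨ 8 < x ∧ x < 14 ∨ x = 19 ∨ 25 < x → ρ' x = ρ x) ∧ ρ' 8 = p := by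
  have hℓ : ℓ < 2 ^ w := Nat.lt_two_pow_self.trans hI.ell_lt
  obtain ⟨ρ', m', h1, ⟨hm, hf, h7', h8'⟩, h3⟩ := Runs.loop (w := w) (D := D)
    (P := ascentBody) (a := 19) (b := 7) (T := ascentBody.cost) (fun m ρ' => m ≤ ℓ ∧
      (∀ x, x < 7 ∨ 8 < x ∧ x < 14 ∨ x = 19 ∨ 25 < x → ρ' x = ρ x) ∧ ρ' 7 = m ∧
      ρ' 8 = path n ℓ S v m p)
    (by
      rintro m ρ₁ ⟨hm, hf, g7, g8⟩ hlt
      rw [g7, hf 19 (by omega), h19] at hlt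
      obtain ⟨d, rfl⟩ : ∃ d, m = d + 1 := ⟨m - 1, by omega⟩
      obtain ⟨ρ₂, r2, f2, k7, k8⟩ := ascentBody_runs hI.served hI.param hI.two_le hI.levels
        (by rw [hf 0 (by omega), h0]) (by rw [hf 5 (by omega), h5]) g7 g8
        (by rw [hf 11 (by omega), h11]) (by rw [hf 13 (by omega), h13]) (by omega) hp hv hℓ
      exact ⟨ρ₂, d, by omega, r2, by omega, fun x hx => by rw [f2 x hx, hf x hx], k7, k8⟩)
    ℓ ⟨le_rfl, fun _ _ => rfl, h7, h8⟩
  rw [h7', hf 19 (by omega), h19] at h3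
  obtain rfl : m' = 0 := by omega
  exact ⟨ρ', h1, hf, h8'⟩

/-! ### The dictionary of values and binary search in it -/

/-- The values with numbers below `u` are represented by their `lw` last bits in the array `28` and
their leading bits, which are coded in unary in `B` from position `base` on. -/
structure Values (w : ℕ) (D : List Bool) (W : ℕ) (B : ℕ → Bool) (M base u lw : ℕ) (val : ℕ → ℕ) :
    Prop where
  low : ∀ (ρ : ℕ → ℕ) (e : Expr) (k : ℕ), ρ 5 = W → ρ 30 = lw → e.eval w D ρ = k → k < u →
    (tabW 28 (.var 30) e).eval w D ρ = val k % 2 ^ lw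
  bit : ∀ k < u, B (base + k + val k / 2 ^ lw) = true
  cnt : ∀ k < u, cnt B true (base + k + val k / 2 ^ lw) = cnt B true base + k
  lt : ∀ k < u, base + k + val k / 2 ^ lw < M
  val_lt : ∀ k < u, val k < 2 ^ w

/-- The value with number `19` is computed in variable `21`. -/
def valueP : Prog :=
  .seq (.seq (asg 20 (.lit 1)) <| .seq (asg 21 (.var 31 + .var 19)) .skip) <|
  .seq selP (asg 21 (.bin .shl (.var 21 - (.var 32 + .var 19)) (.var 30) +
    tabW 28 (.var 30) (.var 19)))

/-- The one with number `k` after `base` stands at `base + k` plus the high part of `val k`, so one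
selection recovers the high part. -/
theorem value_runs (hI : Indexed w D W I pv low n ℓ S) {base u lw k : ℕ} {val : ℕ → ℕ}
    (hV : Values w D W B M base u lw val) (h5 : ρ 5 = W) (h19 : ρ 19 = k) (h30 : ρ 30 = lw)
    (h31 : ρ 31 = cnt B true base) (h32 : ρ 32 = base) (hk : k < u) :
    ∃ ρ', Runs w D valueP ρ ρ' valueP.cost ∧ (∀ x, x < 20 ∨ 25 < x → ρ' x = ρ x) ∧
      ρ' 21 = val k := by
  have hlit := hI.served.lit_lt
  have hM := hI.served.size_lt
  have hlt := hV.lt k hk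
  have hvl := hV.val_lt k hk
  have hb := hV.bit k hk
  have hc := hV.cnt k hk
  have hcb := cnt_le B true (base + k + val k / 2 ^ lw)
  have hdiv := Nat.zero_le (val k / 2 ^ lw)
  rw [hc] at hcb
  let q := base + k + val k / 2 ^ lw
  let ρ₁ := Function.update ρ 20 1
  let ρ₂ := Function.update ρ₁ 21 (cnt B true base + k)
  have e1 : (Expr.lit 1).eval w D ρ = 1 := eval_lit (by omega)
  have e2 : (Expr.var 31 + .var 19).eval w D ρ₁ = cnt B true base + k :=
    eval_add (by simpa [ρ₁, Expr.eval] using h31) (by simpa [ρ₁, Expr.eval] using h19) (by omega)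
  obtain ⟨ρ₃, r3, f3, h21⟩ := sel_runs (ρ := ρ₂) (q := q) hI.served hI.param hI.two_le
    (by simpa [ρ₂, ρ₁] using h5) hlt (by simp [ρ₂, ρ₁, q, hb]) (by simp [ρ₂, q, hb, hc])
  have fr : ∀ x, x < 20 ∨ 25 < x → ρ₃ x = ρ x := fun x hx => by
    rw [f3 x hx]
    simp [ρ₂, ρ₁, show x ≠ 21 by omega, show x ≠ 20 by omega]
  have v21 : (Expr.var 21).eval w D ρ₃ = q := h21
  have v32 : (Expr.var 32).eval w D ρ₃ = base := by rw [eval_var, fr 32 (by omega), h32]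
  have v19 : (Expr.var 19).eval w D ρ₃ = k := by rw [eval_var, fr 19 (by omega), h19]
  have v30 : (Expr.var 30).eval w D ρ₃ = lw := by rw [eval_var, fr 30 (by omega), h30]
  have hdm : val k / 2 ^ lw * 2 ^ lw + val k % 2 ^ lw = val k := by
    rw [mul_comm]; exact Nat.div_add_mod _ _
  have hqd : q = base + k + val k / 2 ^ lw := rfl
  have hq : q - (base + k) = val k / 2 ^ lw := by omega
  have e3 : (Expr.bin .shl (.var 21 - (.var 32 + .var 19)) (.var 30) +
      tabW 28 (.var 30) (.var 19)).eval w D ρ₃ = val k := by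
    rw [← hdm]
    have hm := Nat.zero_le (val k % 2 ^ lw)
    refine eval_add (eval_shl ?_ v30 (by omega)) (hV.low ρ₃ _ k (by rw [fr 5 (by omega), h5]) v30 v19
      hk) (by omega)
    rw [← hq]
    exact eval_sub v21 (eval_add v32 v19 (by omega)) (by omega) (by omega)
  refine ⟨_, (Runs.asg_seq e1 <| Runs.asg_seq e2 Runs.skip).seq (r3.seq (Runs.asg e3)),
    fun x hx => ?_, by simp⟩
  rw [Function.update_of_ne (by omega), fr x hx]

/-- One step of the search for the number of values less than `4`, between `6` and `7`. -/
def searchBody : Prog :=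
  .seq (asg 19 ((.var 6 + .var 7) / .lit 2)) <|
  .seq valueP <|
  .seq (asg 6 (.cond (.var 21) (.var 4) (.var 19 + .lit 1) (.var 6))) <|
  .seq (asg 7 (.cond (.var 21) (.var 4) (.var 7) (.var 19))) .skip

theorem searchBody_runs (hI : Indexed w D W I pv low n ℓ S) {base u lw : ℕ} {val : ℕ → ℕ}
    (hV : Values w D W B M base u lw val) {a b x : ℕ} (h5 : ρ 5 = W) (h4 : ρ 4 = x) (h6 : ρ 6 = a)
    (h7 : ρ 7 = b) (h30 : ρ 30 = lw) (h31 : ρ 31 = cnt B true base) (h32 : ρ 32 = base)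
    (hab : a < b) (hb : b ≤ u) (hu : 2 * u < 2 ^ w) :
    ∃ ρ', Runs w D searchBody ρ ρ' searchBody.cost ∧
      (∀ x, x < 6 ∨ 7 < x ∧ x < 19 ∨ 25 < x → ρ' x = ρ x) ∧
      ρ' 6 = (if val ((a + b) / 2) < x then (a + b) / 2 + 1 else a) ∧
      ρ' 7 = if val ((a + b) / 2) < x then b else (a + b) / 2 := by
  have hlit := hI.served.lit_lt
  let m := (a + b) / 2
  have hm : m < u := by simp only [m]; omega
  have v6 : (Expr.var 6).eval w D ρ = a := h6
  have v7 : (Expr.var 7).eval w D ρ = b := h7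
  have e1 : ((Expr.var 6 + .var 7) / .lit 2).eval w D ρ = m :=
    eval_div (eval_add v6 v7 (by omega)) (eval_lit (by omega))
  let ρ₁ := Function.update ρ 19 m
  obtain ⟨ρ₂, r2, f2, h21⟩ := value_runs (ρ := ρ₁) hI hV (by simpa [ρ₁] using h5)
    (k := m) (by simp [ρ₁]) (by simpa [ρ₁] using h30) (by simpa [ρ₁] using h31)
    (by simpa [ρ₁] using h32) hm
  let c := if val m < x then m + 1 else a
  let ρ₃ := Function.update ρ₂ 6 c
  have g3 : ∀ x, x ≠ 6 → ρ₃ x = ρ₂ x := fun x hx => Function.update_of_ne hx _ _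
  have fr : ∀ x, x < 19 ∨ 25 < x → ρ₂ x = ρ x := fun x hx => by
    rw [f2 x (by omega)]; simp [ρ₁, show x ≠ 19 by omega]
  have g19 : ρ₂ 19 = m := by rw [f2 19 (by omega)]; simp [ρ₁]
  have e2 : (Expr.cond (.var 21) (.var 4) (.var 19 + .lit 1) (.var 6)).eval w D ρ₂ = c := by
    have v19 : (Expr.var 19).eval w D ρ₂ = m := g19
    have v21 : (Expr.var 21).eval w D ρ₂ = val m := h21
    exact eval_cond v21 (by rw [eval_var, fr 4 (by omega), h4])
      (fun _ => eval_add v19 (eval_lit (by omega)) (by omega))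
      (fun _ => by rw [eval_var, fr 6 (by omega), h6])
  have e3 : (Expr.cond (.var 21) (.var 4) (.var 7) (.var 19)).eval w D ρ₃ =
      if val m < x then b else m := by
    refine eval_cond (by simpa [ρ₃, Expr.eval] using h21) ?_ (fun _ => ?_) (fun _ => ?_)
    · rw [eval_var, g3 _ (by omega), fr 4 (by omega), h4]
    · rw [eval_var, g3 _ (by omega), fr 7 (by omega), h7]
    · rw [eval_var, g3 _ (by omega), g19]
  refine ⟨_, (Runs.asg e1).seq (r2.seq (Runs.asg_seq e2 <| Runs.asg_seq e3 Runs.skip)),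
    fun x hx => ?_, by simp [c, m], by simp [m]⟩
  rw [Function.update_of_ne (by omega), Function.update_of_ne (by omega), fr x (by omega)]

theorem search_runs (hI : Indexed w D W I pv low n ℓ S) {base u lw : ℕ} {val : ℕ → ℕ}
    (hV : Values w D W B M base u lw val) {x : ℕ} (h5 : ρ 5 = W) (h4 : ρ 4 = x) (h6 : ρ 6 = 0)
    (h7 : ρ 7 = u) (h30 : ρ 30 = lw) (h31 : ρ 31 = cnt B true base) (h32 : ρ 32 = base)
    (hu : 2 * u < 2 ^ w) (huℓ : u ≤ 2 ^ ℓ) (hval : ∀ a b, a < b → b < u → val a < val b) :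
    ∃ ρ', Runs w D (.loop (.lt (2 * 6) (2 * 7)) searchBody) ρ ρ'
      ((ℓ + 1) * (searchBody.cost + 1) + 1) ∧
      (∀ x, x < 6 ∨ 7 < x ∧ x < 19 ∨ 25 < x → ρ' x = ρ x) ∧ ρ' 6 ≤ u ∧
      ∀ k < u, k < ρ' 6 ↔ val k < x := by
  obtain ⟨ρ', m', h1, ⟨hf, h7', hle, hlow, hhigh, -⟩, h3⟩ := Runs.loop (w := w) (D := D)
    (P := searchBody) (a := 6) (b := 7) (T := searchBody.cost) (fun m ρ' =>
      (∀ x, x < 6 ∨ 7 < x ∧ x < 19 ∨ 25 < x → ρ' x = ρ x) ∧ ρ' 7 ≤ u ∧ ρ' 6 ≤ ρ' 7 ∧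
      (∀ k < ρ' 6, val k < x) ∧ (∀ k < u, ρ' 7 ≤ k → x ≤ val k) ∧ ρ' 7 < ρ' 6 + 2 ^ m)
    (by
      rintro m ρ₁ ⟨hf, hb, hab, hlow, hhigh, hm⟩ hlt
      obtain ⟨ρ₂, r2, f2, k6, k7⟩ := searchBody_runs (ρ := ρ₁) (x := x) hI hV
        (by rw [hf 5 (by omega), h5]) (by rw [hf 4 (by omega), h4]) rfl rfl
        (by rw [hf 30 (by omega), h30]) (by rw [hf 31 (by omega), h31])
        (by rw [hf 32 (by omega), h32]) hlt hb hu
      -- The measure is positive, since a gap below `2 ^ 0` contradicts the loop test.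
      obtain ⟨m, rfl⟩ : ∃ m₁, m = m₁ + 1 := ⟨m - 1, by
        rcases m with _ | m
        · simp at hm; omega
        · rfl⟩
      rw [pow_succ] at hm
      have hmid : (ρ₁ 6 + ρ₁ 7) / 2 < u := by omega
      refine ⟨ρ₂, m, by omega, r2, fun x hx => by rw [f2 x hx, hf x hx], ?_⟩
      split_ifs at k6 k7 with hc
      · rw [k6, k7]
        refine ⟨hb, by omega, fun k hk => ?_, hhigh, by omega⟩
        rcases Nat.lt_succ_iff_lt_or_eq.1 hk with h | h
        · exact (hval _ _ h hmid).trans hc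
        · rwa [h]
      · rw [k6, k7]
        refine ⟨by omega, by omega, hlow, fun k hk h => ?_, by omega⟩
        rcases h.lt_or_eq with h | h
        · exact (not_lt.1 hc).trans (hval _ _ h hk).le
        · rw [← h]; exact not_lt.1 hc)
    -- The initial gap `u` may equal `2 ^ ℓ`, so the strict bound needs one more halving.
    (ℓ + 1) ⟨fun _ _ => rfl, h7.le, by omega, by rw [h6]; intro k hk; omega,
      by rw [h7]; intro k hk h; omega, by rw [h6, h7, pow_succ]; have := Nat.two_pow_pos ℓ; omega⟩
  refine ⟨ρ', h1, hf, hle.trans h7', fun k hk => ⟨hlow k, fun h => ?_⟩⟩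
  by_contra hcon
  exact absurd h (not_lt.2 (hhigh k hk (by omega)))

end

/-! ### The complete query on dense ranks -/

/-- The constants of the query algorithm are computed from `n`, `σ` and the stored parameters. -/
def setupP (K : ℕ) : Prog :=
  .seq (asg 5 (.lit K * (.log (.var 0) + .lit 1))) <|
  .seq (asg 13 (par 7)) <|
  .seq (asg 33 (par 8)) <|
  .seq (asg 30 (.log (.var 1 / .var 33))) <|
  .seq (asg 32 (.var 0 * .var 13)) <|
  .seq (asg 31 (rankE (.var 32))) <|
  .seq (asg 6 (.lit 0)) <|
  .seq (asg 7 (.var 33)) .skip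

/-- The answer is computed when `10` elements of the range are too small, but not all. -/
def foundP : Prog :=
  .seq (.seq (asg 11 (.lit 0)) <|
    .seq (asg 12 (.var 10)) <|
    .seq (asg 7 (.lit 0)) <|
    .seq (asg 8 (.var 2 - .lit 1)) <|
    .seq (asg 9 (.var 3)) .skip) <|
  .seq (.loop (.lt (2 * 7) (2 * 13)) findBody) <|
  .seq (asg 19 (.lit 0)) <|
  .seq (.loop (.lt (2 * 19) (2 * 7)) ascentBody) <|
  .seq (asg 19 (.var 11)) <|
  .seq valueP <|
  .seq (asg 0 (.lit 1)) <|
  .seq (asg 1 (.var 21)) <|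
  .seq (asg 2 (.var 8 + .lit 1)) <|
  .seq (asg 3 (.var 10 + .lit 1)) .skip

/-- The answer is computed from the number `6` of values that are too small. -/
def rangeP : Prog :=
  .seq (.seq (asg 7 (.lit 0)) <|
    .seq (asg 8 (.var 2 - .lit 1)) <|
    .seq (asg 9 (.var 3)) <|
    .seq (asg 10 (.lit 0)) .skip) <|
  .seq (.loop (.lt (2 * 7) (2 * 13)) countBody) <|
  .seq (asg 18 (.var 3 - (.var 2 - .lit 1))) <|
  .ite (.lt (2 * 10) (2 * 18)) foundP (asg 0 (.lit 0))

/-- The range next value query for `n`, `σ`, `i`, `j`, `x` in the variables `0` to `4`. -/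
def queryP (K : ℕ) : Prog :=
  .seq (setupP K) <|
  .seq (.loop (.lt (2 * 6) (2 * 7)) searchBody) <|
  .ite (.lt (2 * 6) (2 * 33)) rangeP (asg 0 (.lit 0))

/-- The answer to a query in terms of dense ranks: `v` is the smallest element of the range with a
value that is at least `x`, and `p` is its first occurrence. -/
def Result (S val : ℕ → ℕ) (l r x : ℕ) (ρ : ℕ → ℕ) : Prop :=
  (ρ 0 = 1 ∧ ∃ p ∈ Finset.Ico l r, (∀ q, l ≤ q → q < p → S q ≠ S p) ∧ x ≤ val (S p) ∧
    (∀ q ∈ Finset.Ico l r, x ≤ val (S q) → S p ≤ S q) ∧ ρ 1 = val (S p) ∧ ρ 2 = p + 1 ∧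
    ρ 3 = lessCnt S l r (S p) 0 + 1) ∨
  (ρ 0 = 0 ∧ ∀ q ∈ Finset.Ico l r, val (S q) < x)

section
variable {B : ℕ → Bool} {F M W w : ℕ} {D : List Bool} {I : BitIndex B F M} {pv : ℕ → ℕ} {low : Arr}
  {ρ : ℕ → ℕ} {n ℓ : ℕ} {S : ℕ → ℕ} {l r v : ℕ} {u lw : ℕ} {val : ℕ → ℕ}

theorem setup_runs (hI : Indexed w D W I pv low n ℓ S) {K σ : ℕ} (h0 : ρ 0 = n) (h1 : ρ 1 = σ)
    (hW : W = K * (Nat.log2 n + 1)) (hWw : W < 2 ^ w) (hK : K < 2 ^ w) (h7 : pv 7 = ℓ)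
    (h8 : pv 8 = u) (hlw : lw = Nat.log2 (σ / u)) (hM : n * ℓ ≤ M) :
    ∃ ρ', Runs w D (setupP K) ρ ρ' (setupP K).cost ∧ (∀ x, x < 5 → ρ' x = ρ x) ∧ ρ' 5 = W ∧
      ρ' 6 = 0 ∧ ρ' 7 = u ∧ ρ' 13 = ℓ ∧ ρ' 30 = lw ∧ ρ' 31 = cnt B true (n * ℓ) ∧
      ρ' 32 = n * ℓ ∧ ρ' 33 = u := by
  have hlit := hI.served.lit_lt
  have hn := hI.n_lt
  have hMw := hI.served.size_lt
  have hlog : Nat.log2 n + 1 < 2 ^ w := by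
    rcases Nat.eq_zero_or_pos n with rfl | h
    · rw [Nat.log2_zero]; omega
    · have := Nat.log_lt_self 2 h.ne'
      rw [← Nat.log2_eq_log_two] at this
      omega
  let ρ₁ := Function.update ρ 5 W
  let ρ₂ := Function.update ρ₁ 13 ℓ
  let ρ₃ := Function.update ρ₂ 33 u
  let ρ₄ := Function.update ρ₃ 30 lw
  let ρ₅ := Function.update ρ₄ 32 (n * ℓ)
  let ρ₆ := Function.update ρ₅ 31 (cnt B true (n * ℓ))
  let ρ₇ := Function.update ρ₆ 6 0
  have e1 : (Expr.lit K * (.log (.var 0) + .lit 1)).eval w D ρ = W := by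
    have v0 : (Expr.var 0).eval w D ρ = n := h0
    rw [hW]
    exact eval_mul (eval_lit hK) (eval_add (eval_log v0) (eval_lit (by omega)) hlog) (hW ▸ hWw)
  have e2 : (par 7).eval w D ρ₁ = ℓ := by
    rw [par_eval hI.served (by simp [ρ₁]) (by omega), h7]
  have e3 : (par 8).eval w D ρ₂ = u := by
    rw [par_eval hI.served (by simp [ρ₁, ρ₂]) (by omega), h8]
  have e4 : (Expr.log (.var 1 / .var 33)).eval w D ρ₃ = lw := by
    rw [hlw]
    exact eval_log (eval_div (by simp [ρ₁, ρ₂, ρ₃, h1, Expr.eval])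
      (by simp [ρ₁, ρ₂, ρ₃, Expr.eval]))
  have e5 : (Expr.var 0 * .var 13).eval w D ρ₄ = n * ℓ :=
    eval_mul (by simp [ρ₁, ρ₂, ρ₃, ρ₄, h0, Expr.eval]) (by simp [ρ₁, ρ₂, ρ₃, ρ₄, Expr.eval])
      (by omega)
  have e6 : (rankE (.var 32)).eval w D ρ₅ = cnt B true (n * ℓ) :=
    rank_eval hI.served hI.param hI.two_le (by simp [ρ₁, ρ₂, ρ₃, ρ₄, ρ₅])
      (by simp [ρ₅, Expr.eval]) hM
  have e7 : (Expr.lit 0).eval w D ρ₆ = 0 := eval_lit (by omega)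
  have e8 : (Expr.var 33).eval w D ρ₇ = u := by
    simp [ρ₁, ρ₂, ρ₃, ρ₄, ρ₅, ρ₆, ρ₇, Expr.eval]
  refine ⟨_, Runs.asg_seq e1 <| Runs.asg_seq e2 <| Runs.asg_seq e3 <| Runs.asg_seq e4 <|
    Runs.asg_seq e5 <| Runs.asg_seq e6 <| Runs.asg_seq e7 <| Runs.asg_seq e8 Runs.skip,
    fun x hx => ?_, ?_⟩
  · simp [show x ≠ 5 by omega, show x ≠ 6 by omega, show x ≠ 7 by omega,
      show x ≠ 13 by omega, show x ≠ 30 by omega, show x ≠ 31 by omega, show x ≠ 32 by omega,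
      show x ≠ 33 by omega]
  · simp

theorem lessCnt_eq_card {x : ℕ} :
    lessCnt S l r x 0 = ((Finset.Ico l r).filter fun p => S p < x).card := by
  simp [lessCnt]

/-- If not all elements of a range are below `a`, then there is a smallest element that is not, and
it has a first occurrence. -/
theorem exists_next {a : ℕ} (h : lessCnt S l r a 0 < r - l) :
    ∃ p ∈ Finset.Ico l r, (∀ q, l ≤ q → q < p → S q ≠ S p) ∧ a ≤ S p ∧
      (∀ q ∈ Finset.Ico l r, a ≤ S q → S p ≤ S q) ∧
      lessCnt S l r a 0 = lessCnt S l r (S p) 0 := by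
  have hne : ∃ v p, p ∈ Finset.Ico l r ∧ a ≤ S p ∧ S p = v := by
    by_contra hcon
    push Not at hcon
    rw [lessCnt_eq_card, Finset.filter_true_of_mem, Nat.card_Ico] at h
    · omega
    · intro p hp
      by_contra h'
      exact hcon _ p hp (not_lt.1 h') rfl
  classical
  obtain ⟨hp₀⟩ : ∃ p, p ∈ Finset.Ico l r ∧ a ≤ S p ∧ S p = Nat.find hne := Nat.find_spec hne
  rename_i hp₀'
  have hmin : ∀ q ∈ Finset.Ico l r, a ≤ S q → Nat.find hne ≤ S q :=
    fun q hq hqa => Nat.find_min' hne ⟨q, hq, hqa, rfl⟩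
  have hpos : ∃ p, p ∈ Finset.Ico l r ∧ a ≤ S p ∧ S p = Nat.find hne := ⟨_, hp₀'⟩
  obtain ⟨h1, h2, h3⟩ := Nat.find_spec hpos
  refine ⟨Nat.find hpos, h1, fun q hlq hq he => ?_, h2, fun q hq hqa => ?_, ?_⟩
  · refine Nat.find_min hpos hq ⟨?_, he ▸ h2, he.trans h3⟩
    rw [Finset.mem_Ico] at h1 ⊢
    omega
  · rw [h3]; exact hmin q hq hqa
  · rw [lessCnt_eq_card, lessCnt_eq_card]
    congr 1
    refine Finset.filter_congr fun q hq => ⟨fun h => h.trans_le h2, fun h => ?_⟩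
    by_contra hcon
    have := hmin q hq (not_lt.1 hcon)
    omega

theorem found_runs (hI : Indexed w D W I pv low n ℓ S)
    (hV : Values w D W B M (n * ℓ) u lw val) {i p : ℕ} (h0 : ρ 0 = n) (h2 : ρ 2 = i) (h3 : ρ 3 = r)
    (h5 : ρ 5 = W) (h10 : ρ 10 = lessCnt S (i - 1) r (S p) 0) (h13 : ρ 13 = ℓ) (h30 : ρ 30 = lw)
    (h31 : ρ 31 = cnt B true (n * ℓ)) (h32 : ρ 32 = n * ℓ) (hi : 1 ≤ i) (hr : r ≤ n)
    (hp : p ∈ Finset.Ico (i - 1) r) (hfirst : ∀ q, i - 1 ≤ q → q < p → S q ≠ S p)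
    (hu : S p < u) :
    ∃ ρ', Runs w D foundP ρ ρ' (foundP.cost + (ℓ * (findBody.cost + ascentBody.cost + 2) + 2)) ∧
      ρ' 0 = 1 ∧ ρ' 1 = val (S p) ∧ ρ' 2 = p + 1 ∧ ρ' 3 = lessCnt S (i - 1) r (S p) 0 + 1 := by
  have hlit := hI.served.lit_lt
  have hn := hI.n_lt
  have hpI := Finset.mem_Ico.1 hp
  have hpn : p < n := by omega
  have hcl := lessCnt_le (S := S) (l := i - 1) (v := S p) hr 0
  let ρ₁ := Function.update ρ 11 0
  let ρ₂ := Function.update ρ₁ 12 (lessCnt S (i - 1) r (S p) 0)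
  let ρ₃ := Function.update ρ₂ 7 0
  let ρ₄ := Function.update ρ₃ 8 (i - 1)
  let ρ₅ := Function.update ρ₄ 9 r
  have e1 : (Expr.lit 0).eval w D ρ = 0 := eval_lit (by omega)
  have e2 : (Expr.var 10).eval w D ρ₁ = lessCnt S (i - 1) r (S p) 0 := by
    simp [ρ₁, Expr.eval, h10]
  have e3 : (Expr.lit 0).eval w D ρ₂ = 0 := eval_lit (by omega)
  have e4 : (Expr.var 2 - .lit 1).eval w D ρ₃ = i - 1 :=
    eval_sub (by simp [ρ₁, ρ₂, ρ₃, Expr.eval, h2]) (eval_lit (by omega)) (by omega) hi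
  have e5 : (Expr.var 3).eval w D ρ₄ = r := by simp [ρ₁, ρ₂, ρ₃, ρ₄, Expr.eval, h3]
  have g : ∀ x, x < 7 ∨ x = 10 ∨ x = 13 ∨ 25 < x → ρ₅ x = ρ x := fun x hx => by
    simp [ρ₁, ρ₂, ρ₃, ρ₄, ρ₅, show x ≠ 11 by omega, show x ≠ 12 by omega, show x ≠ 7 by omega,
      show x ≠ 8 by omega, show x ≠ 9 by omega]
  obtain ⟨ρ₆, r6, f6, k7, k8, k11⟩ := find_runs (ρ := ρ₅) (p := p) hI
    (by rw [g 0 (by omega), h0]) (by rw [g 5 (by omega), h5]) (by simp [ρ₃, ρ₄, ρ₅])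
    (by simp [ρ₄, ρ₅]) (by simp [ρ₅]) (by simp [ρ₁, ρ₂, ρ₃, ρ₄, ρ₅]) (by simp [ρ₂, ρ₃, ρ₄, ρ₅])
    (by rw [g 13 (by omega), h13]) hp hr (hI.lt p hpn) rfl
  have g6 : ∀ x, x < 7 ∨ x = 10 ∨ x = 13 ∨ 25 < x → ρ₆ x = ρ x := fun x hx => by
    rw [f6 x hx, g x hx]
  have e6 : (Expr.lit 0).eval w D ρ₆ = 0 := eval_lit (by omega)
  let ρ₇ := Function.update ρ₆ 19 0
  have g7 : ∀ x, x ≠ 19 → ρ₇ x = ρ₆ x := fun x hx => by simp [ρ₇, hx]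
  obtain ⟨ρ₈, r8, f8, m8⟩ := ascent_runs (ρ := ρ₇) (p := p) (v := S p) hI
    (by rw [g7 0 (by omega), g6 0 (by omega), h0]) (by rw [g7 5 (by omega), g6 5 (by omega), h5])
    (by rw [g7 7 (by omega), k7])
    (by rw [g7 8 (by omega), k8, path_eq_of_first hpI.1 hpn hI.lt (hI.lt p hpn) hfirst])
    (by rw [g7 11 (by omega), k11]) (by rw [g7 13 (by omega), g6 13 (by omega), h13])
    (by simp [ρ₇]) hpn rfl
  have g8 : ∀ x, x < 7 ∨ x = 10 ∨ x = 13 ∨ 25 < x → ρ₈ x = ρ x := fun x hx => by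
    rw [f8 x (by omega), g7 x (by omega), g6 x hx]
  have e8 : (Expr.var 11).eval w D ρ₈ = S p := by
    rw [eval_var, f8 11 (by omega), g7 11 (by omega), k11]
  let ρ₉ := Function.update ρ₈ 19 (S p)
  have g9 : ∀ x, x ≠ 19 → ρ₉ x = ρ₈ x := fun x hx => by simp [ρ₉, hx]
  obtain ⟨ρ₀, r0, f0, m21⟩ := value_runs (ρ := ρ₉) hI hV
    (by rw [g9 5 (by omega), g8 5 (by omega), h5]) (k := S p) (by simp [ρ₉])
    (by rw [g9 30 (by omega), g8 30 (by omega), h30])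
    (by rw [g9 31 (by omega), g8 31 (by omega), h31])
    (by rw [g9 32 (by omega), g8 32 (by omega), h32]) hu
  have a8 : ρ₀ 8 = p := by rw [f0 8 (by omega), g9 8 (by omega), m8]
  have a10 : ρ₀ 10 = lessCnt S (i - 1) r (S p) 0 := by
    rw [f0 10 (by omega), g9 10 (by omega), g8 10 (by omega), h10]
  let σ₁ := Function.update ρ₀ 0 1
  let σ₂ := Function.update σ₁ 1 (val (S p))
  let σ₃ := Function.update σ₂ 2 (p + 1)
  have q1 : (Expr.lit 1).eval w D ρ₀ = 1 := eval_lit (by omega)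
  have q2 : (Expr.var 21).eval w D σ₁ = val (S p) := by simp [σ₁, Expr.eval, m21]
  have q3 : (Expr.var 8 + .lit 1).eval w D σ₂ = p + 1 :=
    eval_add (by simp [σ₁, σ₂, Expr.eval, a8]) (eval_lit (by omega)) (by omega)
  have q4 : (Expr.var 10 + .lit 1).eval w D σ₃ = lessCnt S (i - 1) r (S p) 0 + 1 :=
    eval_add (by simp [σ₁, σ₂, σ₃, Expr.eval, a10]) (eval_lit (by omega)) (by omega)
  refine ⟨_, ((Runs.asg_seq e1 <| Runs.asg_seq e2 <| Runs.asg_seq e3 <| Runs.asg_seq e4 <|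
    Runs.asg_seq e5 Runs.skip).seq <| r6.seq <| (Runs.asg e6).seq <| r8.seq <| (Runs.asg e8).seq <|
    r0.seq <| Runs.asg_seq q1 <| Runs.asg_seq q2 <| Runs.asg_seq q3 <|
    Runs.asg_seq q4 Runs.skip).mono ?_, by simp, by simp, by simp, by simp⟩
  simp only [foundP, Prog.cost]
  ring_nf
  omega

theorem range_runs (hI : Indexed w D W I pv low n ℓ S)
    (hV : Values w D W B M (n * ℓ) u lw val) {i a x : ℕ} (h0 : ρ 0 = n) (h2 : ρ 2 = i)
    (h3 : ρ 3 = r) (h5 : ρ 5 = W) (h6 : ρ 6 = a) (h13 : ρ 13 = ℓ) (h30 : ρ 30 = lw)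
    (h31 : ρ 31 = cnt B true (n * ℓ)) (h32 : ρ 32 = n * ℓ) (hi : 1 ≤ i) (hir : i ≤ r)
    (hr : r ≤ n) (hu : ∀ p < n, S p < u) (haℓ : a < 2 ^ ℓ)
    (hax : ∀ k < u, k < a ↔ val k < x) :
    ∃ ρ', Runs w D rangeP ρ ρ' (rangeP.cost +
      (ℓ * (countBody.cost + findBody.cost + ascentBody.cost + 3) + 3)) ∧
      Result S val (i - 1) r x ρ' := by
  have hlit := hI.served.lit_lt
  have hn := hI.n_lt
  have hax' : ∀ q ∈ Finset.Ico (i - 1) r, (a ≤ S q ↔ x ≤ val (S q)) := fun q hq => by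
    rw [Finset.mem_Ico] at hq
    rw [← not_lt, hax _ (hu q (by omega)), not_lt]
  let ρ₁ := Function.update ρ 7 0
  let ρ₂ := Function.update ρ₁ 8 (i - 1)
  let ρ₃ := Function.update ρ₂ 9 r
  let ρ₄ := Function.update ρ₃ 10 0
  have e1 : (Expr.lit 0).eval w D ρ = 0 := eval_lit (by omega)
  have e2 : (Expr.var 2 - .lit 1).eval w D ρ₁ = i - 1 :=
    eval_sub (by simp [ρ₁, Expr.eval, h2]) (eval_lit (by omega)) (by omega) hi
  have e3 : (Expr.var 3).eval w D ρ₂ = r := by simp [ρ₁, ρ₂, Expr.eval, h3]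
  have e4 : (Expr.lit 0).eval w D ρ₃ = 0 := eval_lit (by omega)
  have g : ∀ x, x < 7 ∨ x = 13 ∨ 25 < x → ρ₄ x = ρ x := fun x hx => by
    simp [ρ₁, ρ₂, ρ₃, ρ₄, show x ≠ 10 by omega, show x ≠ 7 by omega,
      show x ≠ 8 by omega, show x ≠ 9 by omega]
  obtain ⟨ρ₅, r5, f5, k10⟩ := count_runs (ρ := ρ₄) (l := i - 1) (r := r) (v := a) hI
    (by rw [g 0 (by omega), h0]) (by rw [g 5 (by omega), h5]) (by rw [g 6 (by omega), h6])
    (by simp [ρ₁, ρ₂, ρ₃, ρ₄]) (by simp [ρ₂, ρ₃, ρ₄]) (by simp [ρ₃, ρ₄]) (by simp [ρ₄])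
    (by rw [g 13 (by omega), h13]) (by omega) hr haℓ
  have g5 : ∀ x, x < 7 ∨ x = 13 ∨ 25 < x → ρ₅ x = ρ x := fun x hx => by rw [f5 x hx, g x hx]
  have v2 : (Expr.var 2).eval w D ρ₅ = i := by rw [eval_var, g5 2 (by omega), h2]
  have v3 : (Expr.var 3).eval w D ρ₅ = r := by rw [eval_var, g5 3 (by omega), h3]
  have e5 : (Expr.var 3 - (.var 2 - .lit 1)).eval w D ρ₅ = r - (i - 1) :=
    eval_sub v3 (eval_sub v2 (eval_lit (by omega)) (by omega) hi) (by omega) (by omega)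
  let ρ₆ := Function.update ρ₅ 18 (r - (i - 1))
  have g6 : ∀ x, x ≠ 18 → ρ₆ x = ρ₅ x := fun x hx => by simp [ρ₆, hx]
  have s10 : ρ₆ 10 = lessCnt S (i - 1) r a 0 := by rw [g6 10 (by omega), k10]
  have s18 : ρ₆ 18 = r - (i - 1) := by simp [ρ₆]
  have hpre := Runs.asg_seq e1 <| Runs.asg_seq e2 <|
    Runs.asg_seq e3 <| Runs.asg_seq (x := 10) e4 Runs.skip
  -- The threshold `a` need not occur in the range; `exists_next` replaces it by the smallest
  -- element not below it, without changing the count.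
  by_cases hc : lessCnt S (i - 1) r a 0 < r - (i - 1)
  · obtain ⟨p, hp, hfirst, hap, hmin, hcnt⟩ := exists_next hc
    have hpn : p < n := by rw [Finset.mem_Ico] at hp; omega
    obtain ⟨ρ₇, r7, o0, o1, o2, o3⟩ := found_runs (ρ := ρ₆) hI hV
      (by rw [g6 0 (by omega), g5 0 (by omega), h0]) (by rw [g6 2 (by omega), g5 2 (by omega), h2])
      (by rw [g6 3 (by omega), g5 3 (by omega), h3]) (by rw [g6 5 (by omega), g5 5 (by omega), h5])
      (by rw [s10, hcnt]) (by rw [g6 13 (by omega), g5 13 (by omega), h13])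
      (by rw [g6 30 (by omega), g5 30 (by omega), h30])
      (by rw [g6 31 (by omega), g5 31 (by omega), h31])
      (by rw [g6 32 (by omega), g5 32 (by omega), h32]) hi hr hp hfirst (hu p hpn)
    refine ⟨ρ₇, (hpre.seq <| r5.seq <| (Runs.asg e5).seq <|
      Runs.ite_true (a := 10) (b := 18) (show ρ₆ 10 < ρ₆ 18 by rw [s10, s18]; exact hc) r7).mono ?_,
      .inl ⟨o0, p, hp, hfirst, (hax' p hp).1 hap,
        fun q hq hx => hmin q hq ((hax' q hq).2 hx), o1, o2, o3⟩⟩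
    simp only [rangeP, Prog.cost]
    ring_nf
    omega
  · have e6 : (Expr.lit 0).eval w D ρ₆ = 0 := eval_lit (by omega)
    refine ⟨_, (hpre.seq <| r5.seq <| (Runs.asg e5).seq <|
      Runs.ite_false (a := 10) (b := 18) (show ¬ ρ₆ 10 < ρ₆ 18 by rw [s10, s18]; exact hc) (Runs.asg e6)).mono ?_,
      .inr ⟨by simp, fun q hq => ?_⟩⟩
    · simp only [rangeP, Prog.cost]
      ring_nf
      omega
    · have hq' := Finset.mem_Ico.1 hq
      rw [← hax _ (hu q (by omega))]
      rw [lessCnt_eq_card, ← Nat.card_Ico (i - 1) r] at hc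
      by_contra hcon
      exact hc (Finset.card_lt_card (Finset.filter_ssubset.2 ⟨q, hq, hcon⟩))

theorem query_runs (hI : Indexed w D W I pv low n ℓ S)
    (hV : Values w D W B M (n * ℓ) u lw val) {K σ i x : ℕ} (h0 : ρ 0 = n) (h1 : ρ 1 = σ)
    (h2 : ρ 2 = i) (h3 : ρ 3 = r) (h4 : ρ 4 = x)
    (hW : W = K * (Nat.log2 n + 1)) (hWw : W < 2 ^ w) (hK : K < 2 ^ w) (h7 : pv 7 = ℓ)
    (h8 : pv 8 = u) (hlw : lw = Nat.log2 (σ / u)) (hM : n * ℓ ≤ M) (hi : 1 ≤ i) (hir : i ≤ r)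
    (hr : r ≤ n) (hu : ∀ p < n, S p < u) (hun : u ≤ n) (huℓ : u ≤ 2 ^ ℓ)
    (hval : ∀ a b, a < b → b < u → val a < val b) :
    ∃ ρ', Runs w D (queryP K) ρ ρ' ((ℓ + 1) * ((setupP K).cost + searchBody.cost + rangeP.cost +
      countBody.cost + findBody.cost + ascentBody.cost + 10)) ∧
      Result S val (i - 1) r x ρ' := by
  have hlit := hI.served.lit_lt
  have hn := hI.n_lt
  obtain ⟨ρ₁, r1, f1, a5, a6, a7, a13, a30, a31, a32, a33⟩ :=
    setup_runs (ρ := ρ) hI h0 h1 hW hWw hK h7 h8 hlw hM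
  obtain ⟨ρ₂, r2, f2, hle, hax⟩ := search_runs (ρ := ρ₁) hI hV a5
    (by rw [f1 4 (by omega), h4]) a6 a7 a30 a31 a32 (by omega) huℓ hval
  have a33' : ρ₂ 33 = u := by rw [f2 33 (by omega), a33]
  -- If all `u` values are below `x`, there is no answer. This case is split off because `u` may
  -- equal `2 ^ ℓ`, and then has no representation with the `ℓ` bits used in the descent.
  by_cases hc : ρ₂ 6 < u
  · obtain ⟨ρ₃, r3, hres⟩ := range_runs (ρ := ρ₂) hI hV
      (by rw [f2 0 (by omega), f1 0 (by omega), h0]) (by rw [f2 2 (by omega), f1 2 (by omega), h2])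
      (by rw [f2 3 (by omega), f1 3 (by omega), h3]) (by rw [f2 5 (by omega), a5]) rfl
      (by rw [f2 13 (by omega), a13]) (by rw [f2 30 (by omega), a30])
      (by rw [f2 31 (by omega), a31]) (by rw [f2 32 (by omega), a32]) hi hir hr hu
      (by omega) hax
    refine ⟨ρ₃, (r1.seq <| r2.seq <| Runs.ite_true (a := 6) (b := 33) (by rw [a33']; exact hc)
      r3).mono ?_, hres⟩
    ring_nf
    omega
  · have e : (Expr.lit 0).eval w D ρ₂ = 0 := eval_lit (by omega)
    refine ⟨_, (r1.seq <| r2.seq <| Runs.ite_false (a := 6) (b := 33) (by rw [a33']; exact hc)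
      (Runs.asg e)).mono ?_, .inr ⟨by simp, fun q hq => ?_⟩⟩
    · simp only [show (asg 0 (.lit 0)).cost = 2 from rfl]
      ring_nf
      omega
    · rw [Finset.mem_Ico] at hq
      have := hu q (by omega)
      exact (hax _ this).1 (by omega)

end

end RangeNextValue

namespace WordRAM

/-! ### Passing arguments and results -/

/-- Copies register `a` to register `dst`. -/
def move (dst a : ℕ) : Prog := .instr (.op .or dst a a)

theorem exec_move (w : ℕ) (D : List Bool) (dst a : ℕ) (s : State) :
    Exec w D (move dst a) s (s.setReg dst (s.reg a)) 1 := by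
  have h := Exec.instr (w := w) (D := D) (.op .or dst a a) s
  rwa [Instr.step, BinOp.eval, Nat.or_self] at h

/-- Runs a program on variables with five arguments and four results in the initial registers. -/
def onVars (P : Prog) : Prog :=
  .seq (move 8 4) <| .seq (move 6 3) <| .seq (move 4 2) <| .seq (move 2 1) <| .seq P <|
  .seq (move 1 2) <| .seq (move 2 4) <| move 3 6

/-- Arguments spread out to the even registers from the last to the first, and results are gathered
from the first to the last, so no register is overwritten before it is read. -/
theorem exec_onVars {w : ℕ} {D : List Bool} {P : Prog} {T a b c d e : ℕ} {R : (ℕ → ℕ) → Prop}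
    (ha : a < 2 ^ w) (hb : b < 2 ^ w) (hc : c < 2 ^ w) (hd : d < 2 ^ w) (he : e < 2 ^ w)
    (h : ∀ ρ : ℕ → ℕ, ρ 0 = a → ρ 1 = b → ρ 2 = c → ρ 3 = d → ρ 4 = e →
      ∃ ρ', Runs w D P ρ ρ' T ∧ R ρ') :
    ∃ s t ρ', Exec w D (onVars P) (initState w [a, b, c, d, e]) s t ∧ t ≤ T + 7 ∧ R ρ' ∧
      s.reg 0 = ρ' 0 ∧ s.reg 1 = ρ' 1 ∧ s.reg 2 = ρ' 2 ∧ s.reg 3 = ρ' 3 := by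
  let s₀ := initState w [a, b, c, d, e]
  let s₁ := s₀.setReg 8 (s₀.reg 4)
  let s₂ := s₁.setReg 6 (s₁.reg 3)
  let s₃ := s₂.setReg 4 (s₂.reg 2)
  let s₄ := s₃.setReg 2 (s₃.reg 1)
  obtain ⟨ρ', hr, hR⟩ := h s₄.env
    (by simp [s₀, s₁, s₂, s₃, s₄, State.env, State.setReg, initState, Nat.mod_eq_of_lt ha])
    (by simp [s₀, s₁, s₂, s₃, s₄, State.env, State.setReg, initState, Nat.mod_eq_of_lt hb])
    (by simp [s₀, s₁, s₂, s₃, s₄, State.env, State.setReg, initState, Nat.mod_eq_of_lt hc])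
    (by simp [s₀, s₁, s₂, s₃, s₄, State.env, State.setReg, initState, Nat.mod_eq_of_lt hd])
    (by simp [s₀, s₁, s₂, s₃, s₄, State.env, State.setReg, initState, Nat.mod_eq_of_lt he])
  obtain ⟨s₅, t, hx, ht, hs⟩ := hr s₄ rfl
  refine ⟨_, _, ρ', .seq (exec_move ..) <| .seq (exec_move ..) <| .seq (exec_move ..) <|
    .seq (exec_move ..) <| .seq hx <| .seq (exec_move ..) <| .seq (exec_move ..) (exec_move ..),
    by omega, hR, ?_, ?_, ?_, ?_⟩
  · rw [← hs]; simp [State.env, State.setReg]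
  · rw [← hs]; simp [State.env, State.setReg]
  · rw [← hs]; simp [State.env, State.setReg]
  · rw [← hs]; simp [State.env, State.setReg]

end WordRAM

namespace RangeNextValue

open WordRAM

/-! ### Dense ranks of the sequence, and the stored bit string -/

section
variable {S S' val : ℕ → ℕ} {n u i j x : ℕ} {ρ : ℕ → ℕ}

/-- An answer in terms of dense ranks answers the query. -/
theorem Result.answers (h : Result S' val (i - 1) j x ρ) (hi : 1 ≤ i) (hj : j ≤ n)
    (hval : ∀ a b, a < b → b < u → val a < val b) (hu : ∀ p < n, S' p < u)
    (hS : ∀ p < n, S (p + 1) = val (S' p)) {reg : ℕ → ℕ} (h0 : reg 0 = ρ 0) (h1 : reg 1 = ρ 1)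
    (h2 : reg 2 = ρ 2) (h3 : reg 3 = ρ 3) : Answers S i j x reg := by
  have hmono : ∀ p q, p < n → q < n → (S' p < S' q ↔ val (S' p) < val (S' q)) := fun p q hp hq =>
    ⟨fun h => hval _ _ h (hu q hq), fun h => by
      by_contra hcon
      rcases (not_lt.1 hcon).lt_or_eq with h' | h'
      · exact absurd h (hval _ _ h' (hu p hp)).asymm
      · rw [h'] at h; exact lt_irrefl _ h⟩
  have hpred : ∀ r, i ≤ r → r ≤ j → r - 1 ∈ Finset.Ico (i - 1) j ∧ S r = val (S' (r - 1)) :=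
    fun r hr hrj => by
      refine ⟨by rw [Finset.mem_Ico]; omega, ?_⟩
      rw [← hS (r - 1) (by omega), Nat.sub_add_cancel (by omega)]
  rcases h with ⟨r0, p, hp, hfirst, hx, hmin, r1, r2, r3⟩ | ⟨r0, hall⟩
  · left
    have hpI := Finset.mem_Ico.1 hp
    have hpn : p < n := by omega
    rw [h0, h1, h2, h3, r0, r1, r2, r3]
    refine ⟨rfl, ⟨⟨hx, p + 1, by omega, by omega, hS p hpn⟩, ?_⟩,
      ⟨⟨by omega, by omega, hS p hpn⟩, ?_⟩, ?_⟩
    · rintro y ⟨hxy, r, hir, hrj, rfl⟩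
      obtain ⟨hr, he⟩ := hpred r hir hrj
      rw [he] at hxy ⊢
      have := hmin _ hr hxy
      rw [← not_lt, ← hmono _ _ (by omega) hpn]
      omega
    · rintro r ⟨hir, hrj, hr⟩
      obtain ⟨-, he⟩ := hpred r hir hrj
      rw [he] at hr
      by_contra hcon
      have h4 := hmono (r - 1) p (by omega) hpn
      have h5 := hmono p (r - 1) hpn (by omega)
      rw [hr] at h4 h5
      simp only [lt_irrefl, iff_false] at h4 h5
      exact hfirst (r - 1) (by omega) (by omega) (by omega)
    · rw [smallestRank, lessCnt_eq_card]
      congr 1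
      refine Finset.card_bij (fun q _ => q + 1) (fun q hq => ?_) (fun a _ b _ h => by omega)
        (fun r hr => ?_)
      · rw [Finset.mem_filter, Finset.mem_Ico] at hq
        rw [Finset.mem_filter, Finset.mem_Icc, hS q (by omega)]
        exact ⟨by omega, (hmono _ _ (by omega) hpn).1 hq.2⟩
      · rw [Finset.mem_filter, Finset.mem_Icc] at hr
        obtain ⟨hm, he⟩ := hpred r hr.1.1 hr.1.2
        refine ⟨r - 1, ?_, by omega⟩
        rw [Finset.mem_filter]
        exact ⟨hm, (hmono _ _ (by omega) hpn).2 (by rw [← he]; exact hr.2)⟩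
  · right
    rw [h0]
    refine ⟨r0, fun r hir hrj => ?_⟩
    obtain ⟨hm, he⟩ := hpred r hir hrj
    rw [he]; exact hall _ hm

end

/-- The values of a sequence and their dense ranks. -/
theorem exists_ranks (S : ℕ → ℕ) (n : ℕ) : ∃ S' val : ℕ → ℕ,
    (∀ a b, a < b → b < numDistinct S n → val a < val b) ∧
    (∀ p < n, S' p < numDistinct S n) ∧ (∀ p < n, S (p + 1) = val (S' p)) ∧
    ∀ k < numDistinct S n, ∃ p, 1 ≤ p ∧ p ≤ n ∧ S p = val k := by
  classical
  let V := (Finset.Icc 1 n).image S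
  have hfin : {v | v ∈ V}.Finite := V.finite_toSet
  have hcard : hfin.toFinset.card = numDistinct S n := by
    rw [numDistinct]; congr 1; ext v; rw [Set.Finite.mem_toFinset]; rfl
  have hmem : ∀ p < n, S (p + 1) ∈ V := fun p hp =>
    Finset.mem_image_of_mem _ (Finset.mem_Icc.2 (by omega))
  refine ⟨fun p => Nat.count (· ∈ V) (S (p + 1)), Nat.nth (· ∈ V), fun a b hab hb => ?_,
    fun p hp => ?_, fun p hp => (Nat.nth_count (hmem p hp)).symm, fun k hk => ?_⟩
  · exact Nat.nth_lt_nth_of_lt_card hfin hab (hb.trans_eq hcard.symm)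
  · exact (Nat.count_lt_card hfin (hmem p hp)).trans_eq hcard
  · have h := Nat.nth_mem_of_lt_card hfin (hk.trans_eq hcard.symm)
    obtain ⟨p, hp, he⟩ := Finset.mem_image.1 h
    rw [Finset.mem_Icc] at hp
    exact ⟨p, hp.1, hp.2, he⟩

/-- The levels of the wavelet matrix of `S[0, n)` and the unary code of `g 0, …, g (u - 1)`. -/
noncomputable def codeBits (n ℓ : ℕ) (S : ℕ → ℕ) (u : ℕ) (g : ℕ → ℕ) (q : ℕ) : Bool :=
  open Classical in
  if q < n * ℓ then levelBit n ℓ S (q / n) (q % n) else decide (∃ k < u, q = n * ℓ + g k)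

theorem levels_codeBits {n ℓ u M : ℕ} {S g : ℕ → ℕ} (hM : n * ℓ ≤ M) :
    Levels (codeBits n ℓ S u g) n ℓ S M where
  bit d hd q hq := by
    have h : d * n + q < n * ℓ := by
      rw [mul_comm n]
      exact mul_add_lt hd hq
    rw [codeBits, if_pos h, mul_comm d, Nat.mul_add_div (by omega), Nat.div_eq_of_lt hq,
      Nat.mul_add_mod, Nat.mod_eq_of_lt hq, add_zero]
  size := by rwa [mul_comm]

theorem codeBits_unary {n ℓ u k : ℕ} {S g : ℕ → ℕ} (hk : k < u) :
    codeBits n ℓ S u g (n * ℓ + g k) = true := by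
  rw [codeBits, if_neg (by omega), decide_eq_true_eq]
  exact ⟨k, hk, rfl⟩

/-- Beyond the levels the ones are exactly the images of `g`, and since `g` increases, those before
`g k` are `g 0, …, g (k - 1)`. -/
theorem cnt_codeBits {n ℓ u : ℕ} {S g : ℕ → ℕ} (hg : ∀ a b, a < b → b < u → g a < g b) {k : ℕ}
    (hk : k < u) : cnt (codeBits n ℓ S u g) true (n * ℓ + g k) =
      cnt (codeBits n ℓ S u g) true (n * ℓ) + k := by
  classical
  rw [cnt_add]
  congr 1
  rw [cnt, Nat.count_eq_card_filter_range]
  conv_rhs => rw [← Finset.card_range k]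
  symm
  refine Finset.card_bij (fun a _ => g a) (fun a ha => ?_) (fun a ha b hb h => ?_) (fun q hq => ?_)
  · rw [Finset.mem_range] at ha
    rw [Finset.mem_filter, Finset.mem_range]
    exact ⟨hg _ _ ha hk, codeBits_unary (by omega)⟩
  · rw [Finset.mem_range] at ha hb
    rcases lt_trichotomy a b with h' | h' | h'
    · exact absurd h (hg _ _ h' (by omega)).ne
    · exact h'
    · exact absurd h (hg _ _ h' (by omega)).ne'
  · rw [Finset.mem_filter, Finset.mem_range, codeBits, if_neg (by omega), decide_eq_true_eq] at hq
    obtain ⟨hqk, a, ha, he⟩ := hq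
    have he' : q = g a := by omega
    refine ⟨a, ?_, he'.symm⟩
    rw [Finset.mem_range]
    by_contra hcon
    rcases (not_lt.1 hcon).lt_or_eq with h' | h'
    · have := hg _ _ h' ha
      omega
    · subst h'; omega

/-! ### Space -/

/-- An upper bound for the size of the tables that depend only on `F`. -/
def tableBound (F : ℕ) : ℕ := 2 ^ (8 * F ^ 2 + 12 * F + 8)

section
variable {B : ℕ → Bool} {F M W K n : ℕ} {I : BitIndex B F M} {pv : ℕ → ℕ} {low : Arr}

theorem relWidth_le (hF : 2 ≤ F) : relWidth F ≤ 8 * F :=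
  Nat.mul_le_mul_left 8 (bitLen_le (by omega))

theorem mul_labWidth_le (hF : 2 ≤ F) (e : ℕ) : F * labWidth F e ≤ 8 * F ^ 2 := by
  have h1 := bitLen_le (show 0 < F by omega)
  have h2 := relWidth_le hF
  rw [pow_two, ← mul_assoc, mul_comm 8 F, mul_assoc]
  refine Nat.mul_le_mul_left F ?_
  rw [labWidth]
  split_ifs <;> omega

theorem eight_mul_le_two_pow (F : ℕ) : 8 * F ≤ 2 ^ (F + 3) := by
  rw [pow_add, mul_comm]
  exact Nat.mul_le_mul_right 8 Nat.lt_two_pow_self.le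

theorem pow_le_tableBound {k : ℕ} (hk : k ≤ 8) : F ^ k ≤ tableBound F := by
  rcases Nat.eq_zero_or_pos F with rfl | hF
  · rcases Nat.eq_zero_or_pos k with rfl | hk'
    · exact Nat.one_le_two_pow
    · rw [zero_pow hk'.ne']; exact Nat.zero_le _
  calc F ^ k ≤ F ^ 8 := Nat.pow_le_pow_right hF hk
    _ ≤ (2 ^ F) ^ 8 := Nat.pow_le_pow_left Nat.lt_two_pow_self.le 8
    _ ≤ tableBound F := by
      rw [← pow_mul, tableBound]
      exact Nat.pow_le_pow_right (by omega) (by omega)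

theorem two_pow_mul_le_tableBound {a b : ℕ} (ha : a + F + 3 ≤ 8 * F ^ 2 + 12 * F + 8)
    (hb : b ≤ 8 * F) : 2 ^ a * b ≤ tableBound F :=
  calc 2 ^ a * b ≤ 2 ^ a * 2 ^ (F + 3) := Nat.mul_le_mul_left _ (hb.trans (eight_mul_le_two_pow F))
    _ = 2 ^ (a + F + 3) := by rw [← pow_add, add_assoc]
    _ ≤ tableBound F := Nat.pow_le_pow_right (by omega) ha

/-- The two parts of the cells account for `M`. Each other array either is a table depending on `F`
alone, or spends a bounded number of bits (or `O(K)` many) per `F ^ 2` bits of `B`, which is `O(n)`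
or `O(K n)` by `hM`. -/
theorem length_arrays_le (hF : 2 ≤ F) (hM : M ≤ 17 * F ^ 2 * n) (hW : W ≤ 16 * K * F ^ 2) :
    (arrsBits (arrays I W pv low) 28).length ≤ M + 2200 * (K + 1) * (n + tableBound F) := by
  have hbl := bitLen_le (show 0 < F by omega)
  have hrw := relWidth_le hF
  have hFF : 2 * F ≤ F ^ 2 := by rw [pow_two]; exact Nat.mul_le_mul_right F hF
  have hF2 : 0 < F ^ 2 := by positivity
  set T := tableBound F with hT
  set N := M / F ^ 8 + 1 with hN
  -- The number of cells; the last region is stored in full, which costs at most another `T`.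
  let Z := N * F ^ 6
  have hZ : Z ≤ 17 * n + T := by
    have h1 : M / F ^ 8 * F ^ 6 ≤ 17 * n := by
      refine Nat.le_of_mul_le_mul_right (c := F ^ 2) ?_ hF2
      calc M / F ^ 8 * F ^ 6 * F ^ 2 = M / F ^ 8 * F ^ 8 := by ring
        _ ≤ M := Nat.div_mul_le_self _ _
        _ ≤ 17 * n * F ^ 2 := by linarith
    have h2 : F ^ 6 ≤ T := pow_le_tableBound (by omega)
    simp only [Z, hN, add_mul, one_mul]
    omega
  have hZF : Z * F ^ 2 ≤ M + T := by
    have h1 : M / F ^ 8 * F ^ 8 ≤ M := Nat.div_mul_le_self _ _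
    have h2 : F ^ 8 ≤ T := pow_le_tableBound (by omega)
    have h3 : Z * F ^ 2 = M / F ^ 8 * F ^ 8 + F ^ 8 := by simp only [Z, hN]; ring
    omega
  have hR : (M / F ^ 4 + 1) * F ^ 2 ≤ 17 * n + T := by
    have h1 : M / F ^ 4 * F ^ 2 ≤ 17 * n := by
      refine Nat.le_of_mul_le_mul_right (c := F ^ 2) ?_ hF2
      calc M / F ^ 4 * F ^ 2 * F ^ 2 = M / F ^ 4 * F ^ 4 := by ring
        _ ≤ M := Nat.div_mul_le_self _ _
        _ ≤ 17 * n * F ^ 2 := by linarith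
    have h2 : F ^ 2 ≤ T := pow_le_tableBound (by omega)
    rw [add_mul, one_mul]
    omega
  have hNZ : ∀ k ≤ 6, N * F ^ k ≤ Z := fun k hk =>
    Nat.mul_le_mul_left N (Nat.pow_le_pow_right (by omega) hk)
  let f : ℕ → ℕ := fun t => (arrays I W pv low t).len * (arrays I W pv low t).width
  have f0 : f 0 ≤ 144 * (K * T) := by
    have h2 : K * F ^ 2 ≤ K * T := Nat.mul_le_mul_left _ (pow_le_tableBound (by omega))
    change 9 * W ≤ _
    linarith
  have f1 : f 1 ≤ 64 * (K * Z) := by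
    change 2 * (M / F ^ 8 + 2) * W ≤ _
    calc 2 * (M / F ^ 8 + 2) * W ≤ 4 * N * (16 * K * F ^ 2) := Nat.mul_le_mul (by have := Nat.zero_le (M / F ^ 8); omega) hW
      _ = 64 * (K * (N * F ^ 2)) := by ring
      _ ≤ _ := Nat.mul_le_mul_left _ (Nat.mul_le_mul_left _ (hNZ 2 (by omega)))
  have f2 : f 2 ≤ 8 * Z := by
    change N * F ^ 5 * relWidth F ≤ _
    calc N * F ^ 5 * relWidth F ≤ N * F ^ 5 * (8 * F) := Nat.mul_le_mul_left _ hrw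
      _ = 8 * Z := by simp only [Z]; ring
  have f3 : f 3 ≤ T := by
    change 2 ^ (F * labWidth F 0) * F * relWidth F ≤ _
    calc 2 ^ (F * labWidth F 0) * F * relWidth F
        ≤ 2 ^ (8 * F ^ 2) * 2 ^ F * relWidth F := Nat.mul_le_mul_right _
          (Nat.mul_le_mul (Nat.pow_le_pow_right (by omega) (mul_labWidth_le hF 0))
            Nat.lt_two_pow_self.le)
      _ = 2 ^ (8 * F ^ 2 + F) * relWidth F := by rw [← pow_add]
      _ ≤ T := two_pow_mul_le_tableBound (by omega) hrw
  have f4 : f 4 ≤ T := by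
    change 2 ^ (F * labWidth F 0) * F * (2 * bitLen F + 1) ≤ _
    calc 2 ^ (F * labWidth F 0) * F * (2 * bitLen F + 1)
        ≤ 2 ^ (8 * F ^ 2) * 2 ^ F * (2 * bitLen F + 1) := Nat.mul_le_mul_right _
          (Nat.mul_le_mul (Nat.pow_le_pow_right (by omega) (mul_labWidth_le hF 0))
            Nat.lt_two_pow_self.le)
      _ = 2 ^ (8 * F ^ 2 + F) * (2 * bitLen F + 1) := by rw [← pow_add]
      _ ≤ T := two_pow_mul_le_tableBound (by omega) (by omega)
  have f5 : f 5 = Z * (F ^ 2 - 2 * bitLen F) := rfl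
  have f6 : f 6 ≤ T := by
    change 2 ^ (2 * bitLen F + 1) * 2 ^ (F ^ 2 - 2 * bitLen F) * F ^ 2 * relWidth F ≤ _
    calc 2 ^ (2 * bitLen F + 1) * 2 ^ (F ^ 2 - 2 * bitLen F) * F ^ 2 * relWidth F
        ≤ 2 ^ (2 * bitLen F + 1) * 2 ^ (F ^ 2 - 2 * bitLen F) * (2 ^ F) ^ 2 * relWidth F := by
          gcongr; exact Nat.lt_two_pow_self.le
      _ = 2 ^ (2 * bitLen F + 1 + (F ^ 2 - 2 * bitLen F) + F * 2) * relWidth F := by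
          rw [← pow_add, ← pow_mul, ← pow_add]
      _ ≤ T := two_pow_mul_le_tableBound (by omega) hrw
  have f7 : f 7 ≤ 32 * (K * (17 * n + T)) := by
    change 2 * (M / F ^ 4 + 1) * W ≤ _
    calc 2 * (M / F ^ 4 + 1) * W ≤ 2 * (M / F ^ 4 + 1) * (16 * K * F ^ 2) :=
          Nat.mul_le_mul_left _ hW
      _ = 32 * (K * ((M / F ^ 4 + 1) * F ^ 2)) := by ring
      _ ≤ _ := Nat.mul_le_mul_left _ (Nat.mul_le_mul_left _ hR)
  have f8 : f 8 ≤ 32 * (K * Z) := by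
    change 2 * (N * F ^ 4) * W ≤ _
    calc 2 * (N * F ^ 4) * W ≤ 2 * (N * F ^ 4) * (16 * K * F ^ 2) := Nat.mul_le_mul_left _ hW
      _ = 32 * (K * Z) := by simp only [Z]; ring
  have f9 : f 9 ≤ T := by
    change 2 * (2 ^ (2 * bitLen F + 1) * 2 ^ (F ^ 2 - 2 * bitLen F) * 2 ^ relWidth F) *
      relWidth F ≤ _
    calc 2 * (2 ^ (2 * bitLen F + 1) * 2 ^ (F ^ 2 - 2 * bitLen F) * 2 ^ relWidth F) * relWidth F
        = 2 ^ (1 + (2 * bitLen F + 1 + (F ^ 2 - 2 * bitLen F) + relWidth F)) * relWidth F := by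
          rw [pow_add 2 1, pow_one, pow_add _ _ (relWidth F), pow_add _ (2 * bitLen F + 1)]
      _ ≤ T := two_pow_mul_le_tableBound (by omega) hrw
  have f10 : f 10 = Z * (2 * bitLen F + 1) := by
    change N * F ^ 5 * (F * (2 * bitLen F + 1)) = _
    simp only [Z]; ring
  have fn : ∀ e, 1 ≤ e → e < 6 → f (10 + e) ≤ 8 * Z := fun e he he6 => by
    simp only [f]
    rw [arrays_node e he6]
    have : labWidth F e = relWidth F := by rw [labWidth, if_neg (by omega)]
    rw [this]
    calc N * F ^ (5 - e) * (F * relWidth F) ≤ N * F ^ (5 - e) * (F * (8 * F)) := by gcongr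
      _ = 8 * (N * F ^ (5 - e + 2)) := by ring
      _ ≤ _ := Nat.mul_le_mul_left _ (hNZ _ (by omega))
  have ft : ∀ e, 2 * (2 ^ (F * labWidth F e) * 2 ^ relWidth F) * relWidth F ≤ T := fun e => by
    have h := mul_labWidth_le hF e
    calc 2 * (2 ^ (F * labWidth F e) * 2 ^ relWidth F) * relWidth F
        = 2 ^ (1 + (F * labWidth F e + relWidth F)) * relWidth F := by
          rw [pow_add 2 1, pow_one, pow_add]
      _ ≤ T := two_pow_mul_le_tableBound (by omega) hrw
  have fc : ∀ e < 6, f (16 + e) ≤ T := fun e he => by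
    simp only [f]; rw [arrays_child e he]; exact ft e
  have fp : ∀ e < 6, f (22 + e) ≤ T := fun e he => by
    simp only [f]; rw [arrays_childPre e he]; exact ft e
  -- Taken together, the second parts of the cells and the lowest nodes, which hold the first parts,
  -- exceed the raw bits by one bit per cell; separate bounds would lose the leading constant `1`.
  have h510 : f 5 + f 10 = Z * F ^ 2 + Z := by
    rw [f5, f10, ← mul_add, show F ^ 2 - 2 * bitLen F + (2 * bitLen F + 1) = F ^ 2 + 1 by omega,
      mul_add, mul_one]
  have hKZ : K * Z ≤ 17 * (K * n) + K * T := by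
    calc K * Z ≤ K * (17 * n + T) := Nat.mul_le_mul_left _ hZ
      _ = _ := by ring
  rw [length_arrsBits]
  change ∑ t ∈ Finset.range 28, f t ≤ _
  simp only [Finset.sum_range_succ, Finset.sum_range_zero]
  have n1 := fn 1 (by omega) (by omega)
  have n2 := fn 2 (by omega) (by omega)
  have n3 := fn 3 (by omega) (by omega)
  have n4 := fn 4 (by omega) (by omega)
  have n5 := fn 5 (by omega) (by omega)
  have c0 := fc 0 (by omega)
  have c1 := fc 1 (by omega)
  have c2 := fc 2 (by omega)
  have c3 := fc 3 (by omega)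
  have c4 := fc 4 (by omega)
  have c5 := fc 5 (by omega)
  have p0 := fp 0 (by omega)
  have p1 := fp 1 (by omega)
  have p2 := fp 2 (by omega)
  have p3 := fp 3 (by omega)
  have p4 := fp 4 (by omega)
  have p5 := fp 5 (by omega)
  simp only [Nat.reduceAdd] at n1 n2 n3 n4 n5 c0 c1 c2 c3 c4 c5 p0 p1 p2 p3 p4 p5
  have e1 : 32 * (K * (17 * n + T)) = 544 * (K * n) + 32 * (K * T) := by ring
  have e2 : 2200 * (K + 1) * (n + T) = 2200 * (K * n) + 2200 * (K * T) + 2200 * n + 2200 * T := by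
    ring
  rw [e1] at f7
  rw [e2]
  clear_value f Z T N
  omega

/-- The exponent `8 * F ^ 2` grows half as fast as `16 * (F - 2) ^ 2`, which leaves room for the
linear terms; `125` covers small `F`. -/
theorem tableBound_le {L : ℕ} (hF : 2 ≤ F) (hL : 16 * (F - 2) ^ 2 ≤ L) :
    tableBound F ≤ 2 ^ 125 * 2 ^ L := by
  rw [tableBound, ← pow_add]
  refine Nat.pow_le_pow_right (by omega) ?_
  obtain ⟨f, rfl⟩ : ∃ f, F = f + 2 := ⟨F - 2, by omega⟩
  rw [Nat.add_sub_cancel] at hL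
  -- With `F = f + 2` the exponent is `8 f² + 44 f + 64`, to be compared with `16 f² + 125`.
  have : (44 * f : ℤ) ≤ 8 * f ^ 2 + 61 := by nlinarith [sq_nonneg (4 * (f : ℤ) - 11)]
  nlinarith

end

/-- The parameter of the index for sequences of length `n`. -/
def cellParam (n : ℕ) : ℕ := Nat.sqrt ((Nat.log2 n + 1) / 16) + 2

theorem two_le_cellParam (n : ℕ) : 2 ≤ cellParam n := Nat.le_add_left _ _

theorem cellParam_sub_sq_le (n : ℕ) : 16 * (cellParam n - 2) ^ 2 ≤ Nat.log2 n + 1 := by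
  have h := Nat.sqrt_le ((Nat.log2 n + 1) / 16)
  rw [cellParam, Nat.add_sub_cancel, pow_two]
  omega

theorem log2_le_cellParam_sq (n : ℕ) : Nat.log2 n + 1 ≤ 16 * cellParam n ^ 2 := by
  have h := Nat.lt_succ_sqrt ((Nat.log2 n + 1) / 16)
  have h2 : (Nat.sqrt ((Nat.log2 n + 1) / 16) + 1) * (Nat.sqrt ((Nat.log2 n + 1) / 16) + 1) ≤
      cellParam n ^ 2 := by
    rw [cellParam, pow_two]
    exact Nat.mul_le_mul (by omega) (by omega)
  simp only [Nat.succ_eq_add_one] at h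
  omega

theorem cellParam_sq_le (n : ℕ) : 8 * cellParam n ^ 2 ≤ 72 * (Nat.log2 n + 1) := by
  have h := cellParam_sub_sq_le n
  have h2 := two_le_cellParam n
  obtain ⟨f, hf⟩ : ∃ f, cellParam n = f + 2 := ⟨cellParam n - 2, by omega⟩
  rw [hf, Nat.add_sub_cancel] at h
  rw [hf]
  nlinarith [sq_nonneg ((f : ℤ) - 1)]

theorem log2_pow_le {n : ℕ} (hn : 1 ≤ n) : 2 ^ (Nat.log2 n + 1) ≤ 2 * n := by
  rw [pow_succ, mul_comm]
  exact Nat.mul_le_mul_left 2 (Nat.log2_self_le (by omega))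

theorem tableBound_cellParam_le {n : ℕ} (hn : 1 ≤ n) :
    tableBound (cellParam n) ≤ 2 ^ 126 * n :=
  calc _ ≤ _ := tableBound_le (two_le_cellParam n) (cellParam_sub_sq_le n)
    _ ≤ 2 ^ 125 * (2 * n) := Nat.mul_le_mul_left _ (log2_pow_le hn)
    _ = 2 ^ 126 * n := by ring

/-- The words of the header have `headerFactor * (log2 n + 1)` bits. -/
def headerFactor : ℕ := 300

/-- The header has `58` words, two for each of `29` arrays. The array of low bits, which comes last,
is not included. -/
theorem length_index_le {B : ℕ → Bool} {M n ℓ : ℕ} (I : BitIndex B (cellParam n) M) (pv : ℕ → ℕ)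
    (low : Arr) (hn : 1 ≤ n) (hℓ : ℓ ≤ Nat.log2 n + 1) (hM : M ≤ n * ℓ + 3 * n) :
    58 * (headerFactor * (Nat.log2 n + 1)) +
      (arrsBits (arrays I (headerFactor * (Nat.log2 n + 1)) pv low) 28).length ≤
      n * ℓ + 2 ^ 150 * n := by
  have hF := two_le_cellParam n
  have hL := log2_le_cellParam_sq n
  have hT := tableBound_cellParam_le hn
  have hsq : cellParam n ^ 2 ≤ tableBound (cellParam n) := pow_le_tableBound (by omega)
  have hW : headerFactor * (Nat.log2 n + 1) ≤ 16 * headerFactor * cellParam n ^ 2 := by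
    rw [headerFactor]; omega
  have h4 : 4 ≤ cellParam n ^ 2 := by nlinarith
  have hM' : M ≤ 17 * cellParam n ^ 2 * n := by
    have : n * ℓ ≤ n * (16 * cellParam n ^ 2) := Nat.mul_le_mul_left _ (hℓ.trans hL)
    nlinarith
  have h := length_arrays_le (I := I) (pv := pv) (low := low) hF hM' hW
  set A := (arrsBits (arrays I (headerFactor * (Nat.log2 n + 1)) pv low) 28).length
  clear_value A
  rw [headerFactor] at h ⊢
  omega

/-- Guarantees that header words can hold all addresses up to the start of the array of low bits;
this determines how large `headerFactor` has to be. -/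
theorem index_lt_two_pow {n ℓ : ℕ} (hℓ : ℓ ≤ Nat.log2 n + 1) :
    n * ℓ + 2 ^ 150 * n < 2 ^ (headerFactor * (Nat.log2 n + 1)) := by
  set L := Nat.log2 n + 1 with hL
  have h1 : n < 2 ^ L := Nat.lt_log2_self
  have h2 : ℓ < 2 ^ L := hℓ.trans_lt Nat.lt_two_pow_self
  have h3 : 1 ≤ L := by omega
  calc n * ℓ + 2 ^ 150 * n = n * (ℓ + 2 ^ 150) := by ring
    _ < 2 ^ L * (2 ^ L + 2 ^ 150) := Nat.mul_lt_mul'' h1 (by omega)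
    _ ≤ 2 ^ L * (2 ^ L * 2 ^ 200) := by
      refine Nat.mul_le_mul_left _ ?_
      have : 1 ≤ 2 ^ L := Nat.one_le_two_pow
      omega
    _ ≤ 2 ^ L * (2 ^ L * 2 ^ (298 * L)) := by
      refine Nat.mul_le_mul_left _ (Nat.mul_le_mul_left _ ?_)
      exact Nat.pow_le_pow_right (by norm_num) (by omega)
    _ = 2 ^ (headerFactor * L) := by
      rw [headerFactor, ← pow_add, ← pow_add, show L + (L + 298 * L) = 300 * L by omega]

section
variable {B : ℕ → Bool} {F M W w : ℕ} {I : BitIndex B F M} {pv : ℕ → ℕ} {low : Arr}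

theorem array_cases {p : ℕ → Prop} (h0 : p 0) (h1 : p 1) (h2 : p 2) (h3 : p 3) (h4 : p 4)
    (h5 : p 5) (h6 : p 6) (h7 : p 7) (h8 : p 8) (h9 : p 9) (hn : ∀ e < 6, p (10 + e))
    (hc : ∀ e < 6, p (16 + e)) (hp : ∀ e < 6, p (22 + e)) : ∀ t < 28, p t := fun t ht => by
  rcases Nat.lt_or_ge t 10 with h | h
  · interval_cases t <;> assumption
  rcases Nat.lt_or_ge t 16 with h' | h'
  · obtain ⟨e, rfl⟩ := Nat.exists_eq_add_of_le h
    exact hn e (by omega)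
  rcases Nat.lt_or_ge t 22 with h'' | h''
  · obtain ⟨e, rfl⟩ := Nat.exists_eq_add_of_le h'
    exact hc e (by omega)
  · obtain ⟨e, rfl⟩ := Nat.exists_eq_add_of_le h''
    exact hp e (by omega)

theorem arrays_width_le (hF : 2 ≤ F) (hW : 8 * F ^ 2 ≤ W) :
    ∀ t < 28, (arrays I W pv low t).width ≤ W := by
  have h1 := bitLen_le (show 0 < F by omega)
  have h2 := relWidth_le hF
  have h3 : 2 * F ≤ F ^ 2 := by rw [pow_two]; exact Nat.mul_le_mul_right F hF
  have h4 : relWidth F ≤ W := by omega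
  refine array_cases le_rfl le_rfl h4 h4 ?_ ?_ h4 le_rfl le_rfl h4 ?_ ?_ ?_
  · change 2 * bitLen F + 1 ≤ W; omega
  · change F ^ 2 - 2 * bitLen F ≤ W; omega
  · intro e he
    rw [arrays_node e he]
    exact (mul_labWidth_le hF e).trans hW
  · intro e he
    rw [arrays_child e he]; exact h4
  · intro e he
    rw [arrays_childPre e he]; exact h4

theorem arrays_val_lt (hF : 2 ≤ F) (hpv : ∀ k < 9, pv k < 2 ^ W) (hM : M + F ^ 8 < 2 ^ W) :
    ∀ t < 28, ∀ k < (arrays I W pv low t).len,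
      (arrays I W pv low t).val k < 2 ^ (arrays I W pv low t).width := by
  refine array_cases hpv ?_ ?_ (fun k _ => I.pre_lt k) (fun k _ => I.hiOf_lt k)
    (fun k _ => I.lo_lt k) (fun k _ => I.inCell_lt k)
    (fun k _ => (I.selRegion_lt k).trans_le ?_) (fun k _ => (I.selExtra_lt k).trans_le ?_)
    (fun k _ => I.selCell_lt k) ?_ ?_ ?_
  · intro k hk
    change k < 2 * (M / F ^ 8 + 2) at hk
    refine (cnt_le _ _ _).trans_lt (lt_of_le_of_lt ?_ hM)
    calc k / 2 * F ^ 8 ≤ (M / F ^ 8 + 1) * F ^ 8 := Nat.mul_le_mul_right _ (by omega)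
      _ = M / F ^ 8 * F ^ 8 + F ^ 8 := by ring
      _ ≤ M + F ^ 8 := Nat.add_le_add_right (Nat.div_mul_le_self _ _) _
  · intro k _
    change cnt B true (k * F ^ 3) - cnt B true (k / F ^ 5 * F ^ 8) < 2 ^ relWidth F
    refine lt_of_le_of_lt ?_ (pow_lt_relWidth (show 0 < F by omega) (le_refl 8))
    have h1 : k * F ^ 3 = k / F ^ 5 * F ^ 8 + k % F ^ 5 * F ^ 3 := by
      conv_lhs => rw [← Nat.div_add_mod k (F ^ 5)]
      ring
    have h2 : k % F ^ 5 * F ^ 3 ≤ F ^ 8 := by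
      calc k % F ^ 5 * F ^ 3 ≤ F ^ 5 * F ^ 3 :=
            Nat.mul_le_mul_right _ (Nat.mod_lt _ (Nat.pow_pos (by omega))).le
        _ = F ^ 8 := by ring
    have h3 := cnt_add_le B true (k / F ^ 5 * F ^ 8) (k % F ^ 5 * F ^ 3)
    rw [h1]
    omega
  · change M + 1 ≤ 2 ^ W; omega
  · change M + 1 ≤ 2 ^ W; omega
  · intro e he
    rw [arrays_node e he]
    exact fun k _ => I.node_lt e k
  · intro e he
    rw [arrays_child e he]
    exact fun k _ => I.child_lt e k
  · intro e he
    rw [arrays_childPre e he]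
    exact fun k _ => I.childPre_lt e k

/-- An array of positive width has at most as many elements as bits. The exception is array `5`,
whose width `F ^ 2 - 2 * bitLen F` vanishes for `F = 2`; its length is bounded by the size of array
`10`. -/
theorem arrays_len_le (hF : 2 ≤ F) (hW : 8 * F ^ 2 ≤ W) :
    ∀ t < 28, (arrays I W pv low t).len ≤ (arrsBits (arrays I W pv low) 28).length := by
  have hsum : ∀ t < 28, (arrays I W pv low t).len * (arrays I W pv low t).width ≤
      (arrsBits (arrays I W pv low) 28).length := fun t ht => by
    rw [length_arrsBits]
    exact Finset.single_le_sum (f := fun t => (arrays I W pv low t).len *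
      (arrays I W pv low t).width) (fun _ _ => Nat.zero_le _) (Finset.mem_range.2 ht)
  have key : ∀ t < 28, 0 < (arrays I W pv low t).width →
      (arrays I W pv low t).len ≤ (arrsBits (arrays I W pv low) 28).length :=
    fun t ht h => (Nat.le_mul_of_pos_right _ h).trans (hsum t ht)
  have hr : 0 < relWidth F := by rw [relWidth, bitLen]; omega
  have hF2 : 0 < F ^ 2 := Nat.pow_pos (by omega)
  have hW0 : 0 < W := by omega
  refine array_cases (key 0 (by omega) hW0) (key 1 (by omega) hW0) (key 2 (by omega) hr)
    (key 3 (by omega) hr) (key 4 (by omega) (Nat.succ_pos _)) ?_ (key 6 (by omega) hr)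
    (key 7 (by omega) hW0) (key 8 (by omega) hW0) (key 9 (by omega) hr) ?_ ?_ ?_
  · refine le_trans ?_ (hsum 10 (by omega))
    change (M / F ^ 8 + 1) * F ^ 6 ≤ (M / F ^ 8 + 1) * F ^ 5 * (F * (2 * bitLen F + 1))
    calc (M / F ^ 8 + 1) * F ^ 6 = (M / F ^ 8 + 1) * F ^ 6 * 1 := (mul_one _).symm
      _ ≤ (M / F ^ 8 + 1) * F ^ 6 * (2 * bitLen F + 1) := Nat.mul_le_mul_left _ (by omega)
      _ = _ := by ring
  · intro e he
    refine key _ (by omega) ?_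
    rw [arrays_node e he]
    refine Nat.mul_pos (by omega) ?_
    rw [labWidth]
    split_ifs <;> omega
  · intro e he
    refine key _ (by omega) ?_
    rw [arrays_child e he]; exact hr
  · intro e he
    refine key _ (by omega) ?_
    rw [arrays_childPre e he]; exact hr

theorem served_memory (hF : 2 ≤ F) (hW : 8 * F ^ 2 ≤ W) (hpv : ∀ k < 9, pv k < 2 ^ W)
    (hM : M + F ^ 8 < 2 ^ W) (hWw : W ≤ w) (hlit : 100 < 2 ^ w)
    (hbase : 2 * 29 * W + (arrsBits (arrays I W pv low) 28).length < 2 ^ W)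
    (hlen : (memory W (arrays I W pv low) 29).length < 2 ^ w) :
    Served w (memory W (arrays I W pv low) 29) W (arrays I W pv low) M where
  isTab t ht := isTab_memory hWw hlen (by omega) (by omega) hbase (arrays_width_le hF hW t ht)
    (arrays_val_lt hF hpv hM t ht)
  len_lt t ht := by
    have h1 := arrays_len_le (I := I) (pv := pv) (low := low) hF hW t ht
    have h2 : 2 ^ W ≤ 2 ^ w := Nat.pow_le_pow_right (by omega) hWw
    omega
  lit_lt := hlit
  size_lt := by
    have h2 : 2 ^ W ≤ 2 ^ w := Nat.pow_le_pow_right (by omega) hWw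
    omega

end

/-! ### Assembling the data structure -/

/-- The parameters stored in the data structure. -/
def params (F ℓ u : ℕ) : ℕ → ℕ
  | 0 => F
  | 1 => F ^ 2
  | 2 => F ^ 3
  | 3 => F ^ 4
  | 4 => F ^ 8
  | 5 => 2 ^ (F ^ 2 - 2 * bitLen F)
  | 6 => 2 ^ relWidth F
  | 7 => ℓ
  | _ => u

theorem isParam_params (F ℓ u : ℕ) : IsParam F (params F ℓ u) := ⟨rfl, rfl, rfl, rfl, rfl, rfl, rfl⟩

theorem params_lt {F ℓ u W : ℕ} (hF : 2 ≤ F) (hW : 8 * F ^ 2 < W) (hM : F ^ 8 < 2 ^ W)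
    (hℓ : ℓ < 2 ^ W) (hu : u < 2 ^ W) : ∀ k < 9, params F ℓ u k < 2 ^ W := by
  have hp : ∀ k ≤ 8, F ^ k < 2 ^ W := fun k hk =>
    (Nat.pow_le_pow_right (by omega) hk).trans_lt hM
  have h2 := relWidth_le hF
  have h3 : 2 * F ≤ F ^ 2 := by rw [pow_two]; exact Nat.mul_le_mul_right F hF
  intro k hk
  interval_cases k
  · exact (pow_one F).symm.trans_lt (hp 1 (by omega))
  · exact hp 2 (by omega)
  · exact hp 3 (by omega)
  · exact hp 4 (by omega)
  · exact hM
  · exact Nat.pow_lt_pow_right (by omega) (by omega)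
  · exact Nat.pow_lt_pow_right (by omega) (by omega)
  · exact hℓ
  · exact hu

/-- The time of a query, divided by the number of levels. -/
def timeFactor : ℕ := (setupP headerFactor).cost + searchBody.cost + rangeP.cost +
  countBody.cost + findBody.cost + ascentBody.cost + 17

/-- Explains the exponent: since `2 ^ (log2 n + 1) ≤ 2 * n ≤ (n + σ) ^ 2`, the factor `(n + σ) ^ (2
* headerFactor)` covers `2 ^ W`, and the fourth power left over makes room for the low bits, which
take at most `(n + σ) ^ 2` bits. -/
theorem two_pow_add_sq_lt {n σ w W : ℕ} (hn : 1 ≤ n) (hσ : 1 ≤ σ)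
    (hW : W = headerFactor * (Nat.log2 n + 1)) (hw : (n + σ) ^ (2 * headerFactor + 4) ≤ 2 ^ w) :
    2 ^ W + (n + σ) ^ 2 < 2 ^ w := by
  have hPX : 2 ^ W * (n + σ) ^ 4 ≤ 2 ^ w := by
    refine le_trans ?_ hw
    rw [pow_add, pow_mul, hW, mul_comm headerFactor, pow_mul]
    refine Nat.mul_le_mul_right _ (Nat.pow_le_pow_left ?_ _)
    calc 2 ^ (Nat.log2 n + 1) ≤ 2 * n := log2_pow_le hn
      _ ≤ (n + σ) * (n + σ) := Nat.mul_le_mul (by omega) (by omega)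
      _ = (n + σ) ^ 2 := by ring
  have hY : 4 ≤ (n + σ) ^ 2 := Nat.pow_le_pow_left (show 2 ≤ n + σ by omega) 2
  have hP : 1 ≤ 2 ^ W := Nat.one_le_two_pow
  rw [show (n + σ) ^ 4 = (n + σ) ^ 2 * (n + σ) ^ 2 by ring] at hPX
  refine lt_of_lt_of_le ?_ hPX
  generalize (n + σ) ^ 2 = Y at *
  generalize 2 ^ W = P at *
  nlinarith [Nat.mul_le_mul hP hY, Nat.mul_le_mul hP (Nat.mul_le_mul hY hY)]

theorem exists_data {n σ : ℕ} (hn : 1 ≤ n) {S : ℕ → ℕ} (hS : ∀ k, 1 ≤ k → k ≤ n → 1 ≤ S k ∧ S k ≤ σ) :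
    ∃ D : List Bool,
      0 < numDistinct S n ∧ numDistinct S n ≤ n ∧ numDistinct S n ≤ σ ∧
      D.length ≤ n * Nat.clog 2 (numDistinct S n) + 2 ^ 150 * n +
        numDistinct S n * Nat.log2 (σ / numDistinct S n) ∧
      ∀ w : ℕ, (n + σ) ^ (2 * headerFactor + 4) ≤ 2 ^ w → ∀ i j x : ℕ, 1 ≤ i → i ≤ j → j ≤ n → x < 2 ^ w →
        ∃ s t, Exec w D (onVars (queryP headerFactor)) (initState w [n, σ, i, j, x]) s t ∧
          t ≤ (Nat.clog 2 (numDistinct S n) + 1) * timeFactor ∧ Answers S i j x s.reg := by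
  obtain ⟨S', val, hval, hS'u, hSval, hex⟩ := exists_ranks S n
  have hun : numDistinct S n ≤ n := Finset.card_image_le.trans (by simp)
  set u := numDistinct S n with hu
  have hu0 : 0 < u := (Nat.zero_le _).trans_lt (hS'u 0 (by omega))
  have hvalσ : ∀ k < u, 1 ≤ val k ∧ val k ≤ σ := fun k hk => by
    obtain ⟨p, h1, h2, h3⟩ := hex k hk
    rw [← h3]; exact hS p h1 h2
  have huσ : u ≤ σ := by
    have : u ≤ (Finset.Icc 1 σ).card := by
      refine Finset.card_le_card fun v hv => ?_
      obtain ⟨p, hp, rfl⟩ := Finset.mem_image.1 hv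
      rw [Finset.mem_Icc] at hp ⊢
      exact hS p hp.1 hp.2
    simpa using this
  set ℓ := Nat.clog 2 u with hℓdef
  set lw := Nat.log2 (σ / u) with hlw
  have huℓ : u ≤ 2 ^ ℓ := Nat.le_pow_clog (by omega) u
  set L := Nat.log2 n + 1 with hLdef
  have hnL : n < 2 ^ L := Nat.lt_log2_self
  have hℓL : ℓ ≤ L := Nat.clog_le_of_le_pow (by omega)
  have hdiv : 1 ≤ σ / u := (Nat.one_le_div_iff hu0).2 huσ
  have hlwσ : 2 ^ lw ≤ σ := (Nat.log2_self_le (by omega)).trans (Nat.div_le_self _ _)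
  -- As `2 ^ lw` is within a factor two of `σ / u`, high parts are below `2 * u`. Hence `g k < 3 *
  -- u` for `k < u`, and `M` provides `3 * u` bits for the unary code.
  have hhi : ∀ k < u, val k / 2 ^ lw < 2 * u := fun k hk => by
    have h1 : σ / u < 2 ^ (lw + 1) := Nat.lt_log2_self
    rw [Nat.div_lt_iff_lt_mul hu0] at h1
    rw [Nat.div_lt_iff_lt_mul (Nat.two_pow_pos _)]
    calc val k ≤ σ := (hvalσ k hk).2
      _ < 2 ^ (lw + 1) * u := h1
      _ = 2 * u * 2 ^ lw := by ring
  let g : ℕ → ℕ := fun k => k + val k / 2 ^ lw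
  have hg : ∀ a b, a < b → b < u → g a < g b := fun a b hab hb =>
    Nat.add_lt_add_of_lt_of_le hab (Nat.div_le_div_right (hval a b hab hb).le)
  let B := codeBits n ℓ S' u g
  let F := cellParam n
  let M := n * ℓ + 3 * u
  have hF : 2 ≤ F := two_le_cellParam n
  obtain ⟨I⟩ := exists_bitIndex B F M hF
  obtain ⟨W, hW⟩ : ∃ W, W = headerFactor * L := ⟨_, rfl⟩
  let pv := params F ℓ u
  let low : Arr := ⟨u, lw, fun k => val k % 2 ^ lw⟩
  have hMle : M ≤ n * ℓ + 3 * n := by simp only [M]; omega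
  have hspace := length_index_le I pv low hn hℓL hMle
  have hpow := index_lt_two_pow hℓL
  have hlength : (memory W (arrays I W pv low) 29).length =
      2 * 29 * W + (arrsBits (arrays I W pv low) 28).length + u * lw := by
    rw [length_memory, length_arrsBits, Finset.sum_range_succ, add_assoc]
    rfl
  rw [← hLdef, ← hW] at hspace
  change 58 * W + (arrsBits (arrays I W pv low) 28).length ≤ _ at hspace
  rw [← hLdef, ← hW] at hpow
  have hbase : 2 * 29 * W + (arrsBits (arrays I W pv low) 28).length < 2 ^ W := by omega
  refine ⟨memory W (arrays I W pv low) 29, hu0, hun, huσ, by rw [hlength]; omega, ?_⟩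
  intro w hw i j x hi hij hj hx
  have hbig := two_pow_add_sq_lt hn (hu0.trans_le huσ) hW hw
  have hP' : 100 < 2 ^ W := lt_of_lt_of_le (by norm_num)
    (Nat.pow_le_pow_right (by norm_num) (show 7 ≤ W by rw [hW, headerFactor]; omega))
  have hWw : W ≤ w := ((Nat.pow_lt_pow_iff_right (show 1 < 2 by omega)).1 (by omega)).le
  have hsq : 2 * (n + σ) ≤ (n + σ) ^ 2 := by
    rw [pow_two]; exact Nat.mul_le_mul_right _ (by omega)
  have hulw : u * lw ≤ (n + σ) ^ 2 := by
    have h1 : lw ≤ σ := Nat.lt_two_pow_self.le.trans hlwσ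
    calc u * lw ≤ n * σ := Nat.mul_le_mul hun h1
      _ ≤ (n + σ) * (n + σ) := Nat.mul_le_mul (by omega) (by omega)
      _ = (n + σ) ^ 2 := (pow_two _).symm
  have hlen : (memory W (arrays I W pv low) 29).length < 2 ^ w := by omega
  have hL2 : 2 ^ L ≤ 2 ^ W := Nat.pow_le_pow_right (by omega) (by rw [hW, headerFactor]; omega)
  have hℓ2 : 2 ^ ℓ ≤ 2 ^ L := Nat.pow_le_pow_right (by omega) hℓL
  have hF8 : F ^ 8 ≤ 2 ^ 126 * n := (pow_le_tableBound le_rfl).trans (tableBound_cellParam_le hn)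
  have hMF : M + F ^ 8 < 2 ^ W := by omega
  have hFW : 8 * F ^ 2 < W := by
    have := cellParam_sq_le n
    rw [hW, headerFactor]
    change 8 * F ^ 2 ≤ 72 * L at this
    omega
  have hserved : Served w (memory W (arrays I W pv low) 29) W (arrays I W pv low) M :=
    served_memory hF hFW.le (params_lt hF hFW (by omega)
      (by have := Nat.lt_two_pow_self (n := ℓ); omega) (by omega)) hMF hWw (by omega) hbase hlen
  have hI : Indexed w (memory W (arrays I W pv low) 29) W I pv low n ℓ S' := {
    served := hserved
    param := isParam_params F ℓ u
    two_le := hF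
    levels := levels_codeBits (by omega)
    lt := fun p hp => (hS'u p hp).trans_le huℓ
    n_lt := by omega
    ell_lt := by omega }
  have hV : Values w (memory W (arrays I W pv low) 29) W B M (n * ℓ) u lw val := {
    -- The width `lw` may exceed what a header word can hold when `σ` is huge compared to `n`; it is
    -- therefore taken from variable `30`, computed from `σ` and `u`.
    low := fun ρ e k hρ hlwρ he hk => by
      have := Nat.lt_two_pow_self (n := lw)
      have hlww : lw ≤ w := ((Nat.pow_lt_pow_iff_right (show 1 < 2 by omega)).1
        (show 2 ^ lw < 2 ^ w by omega)).le
      exact tabW_eval (arr := arrays I W pv low) (t := 28) hWw hlen (by omega) (by omega) hbase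
        hlww hρ he hlwρ hk (Nat.mod_lt _ (Nat.two_pow_pos _))
    bit := fun k hk => by rw [add_assoc]; exact codeBits_unary (g := g) hk
    cnt := fun k hk => by rw [add_assoc]; exact cnt_codeBits (g := g) hg hk
    lt := fun k hk => by
      have := hhi k hk
      simp only [M]; omega
    val_lt := fun k hk => by
      have := (hvalσ k hk).2
      omega }
  obtain ⟨s, t, ρ', hex', ht, hres, h0, h1, h2, h3⟩ := exec_onVars (w := w)
    (D := memory W (arrays I W pv low) 29) (P := queryP headerFactor) (a := n) (b := σ) (c := i)
    (d := j) (e := x) (by omega) (by omega) (by omega) (by omega) hx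
    (fun ρ r0 r1 r2 r3 r4 => query_runs hI hV r0 r1 r2 r3 r4 hW
      (by have := Nat.lt_two_pow_self (n := w); omega)
      (by
        have : headerFactor ≤ W := by rw [hW]; exact Nat.le_mul_of_pos_right _ (by omega)
        have := Nat.lt_two_pow_self (n := w)
        omega) rfl rfl hlw (by omega) hi hij hj hS'u
      hun huℓ hval)
  refine ⟨s, t, hex', ht.trans ?_, hres.answers hi hj hval hS'u hSval h0 h1 h2 h3⟩
  rw [timeFactor]
  have key : ∀ a, (ℓ + 1) * (a + 10) + 7 ≤ (ℓ + 1) * (a + 17) := fun a => by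
    rw [show a + 17 = a + 10 + 7 from rfl, Nat.mul_add (ℓ + 1) (a + 10)]
    omega
  exact key _

theorem clog_le_logb {u : ℕ} (hu : 0 < u) : (Nat.clog 2 u : ℝ) ≤ Real.logb 2 u + 1 := by
  have h0 : 0 ≤ Real.logb 2 u := Real.logb_nonneg (by norm_num) (by exact_mod_cast hu)
  have h := Nat.ceil_lt_add_one h0
  have h2 := Real.natCeil_logb_natCast 2 u
  rw [Nat.cast_ofNat] at h2
  rw [h2] at h
  exact h.le

theorem log2_div_add_logb_le {σ u : ℕ} (hu : 0 < u) (huσ : u ≤ σ) :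
    (Nat.log2 (σ / u) : ℝ) + Real.logb 2 u ≤ Real.logb 2 σ := by
  have h1 : 1 ≤ σ / u := (Nat.one_le_div_iff hu).2 huσ
  have h2 : 2 ^ Nat.log2 (σ / u) * u ≤ σ :=
    (Nat.mul_le_mul_right u (Nat.log2_self_le (by omega))).trans (Nat.div_mul_le_self _ _)
  have h3 : (2 : ℝ) ^ Nat.log2 (σ / u) * u ≤ σ := by exact_mod_cast h2
  have hu' : (0 : ℝ) < u := by exact_mod_cast hu
  have h4 := Real.logb_le_logb_of_le (b := 2) (by norm_num) (by positivity) h3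
  rwa [Real.logb_mul (by positivity) hu'.ne', Real.logb_pow, Real.logb_self_eq_one (by norm_num),
    mul_one] at h4

end RangeNextValue

theorem theorem2 :
    ∃ (P : WordRAM.Prog) (C c : ℕ),
      ∀ (n σ : ℕ) (S : ℕ → ℕ), (∀ k, 1 ≤ k → k ≤ n → 1 ≤ S k ∧ S k ≤ σ) →
        ∃ D : List Bool,
          (D.length : ℝ) ≤ n * Real.logb 2 σ + C * n ∧
          ∀ w : ℕ, (n + σ) ^ c ≤ 2 ^ w →
            ∀ i j x : ℕ, 1 ≤ i → i ≤ j → j ≤ n → x < 2 ^ w →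
              ∃ (s : WordRAM.State) (t : ℕ),
                WordRAM.Exec w D P (WordRAM.initState w [n, σ, i, j, x]) s t ∧
                (t : ℝ) ≤ C * max 1 (Real.logb 2 (RangeNextValue.numDistinct S n)) ∧
                RangeNextValue.Answers S i j x s.reg := by
  -- In the constant, `2 ^ 151` covers the `2 ^ 150 * n` bits of the index plus the `n` bits lost by
  -- rounding up `log u`. The factor `3` comes from `clog 2 u + 1 ≤ log u + 2`, which is at most
  -- three times the maximum of `1` and `log u`.
  refine ⟨WordRAM.onVars (RangeNextValue.queryP RangeNextValue.headerFactor),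
    2 ^ 151 + 3 * RangeNextValue.timeFactor, 2 * RangeNextValue.headerFactor + 4,
    fun n σ S hS => ?_⟩
  rcases Nat.eq_zero_or_pos n with rfl | hn
  -- The empty sequence admits no query.
  · exact ⟨[], by simp, fun w _ i j x h1 h2 h3 _ => by omega⟩
  obtain ⟨D, hu, hun, huσ, hD, hq⟩ := RangeNextValue.exists_data hn hS
  set u := RangeNextValue.numDistinct S n
  have hu' : (1 : ℝ) ≤ u := by exact_mod_cast hu
  have hun' : (u : ℝ) ≤ n := by exact_mod_cast hun
  have hclog := RangeNextValue.clog_le_logb hu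
  have hlog := RangeNextValue.log2_div_add_logb_le hu huσ
  have hlogu : 0 ≤ Real.logb 2 u := Real.logb_nonneg (by norm_num) hu'
  refine ⟨D, ?_, fun w hw i j x hi hij hj hx => ?_⟩
  · have hD' : (D.length : ℝ) ≤ n * Nat.clog 2 u + 2 ^ 150 * n + u * Nat.log2 (σ / u) := by
      exact_mod_cast hD
    have h1 : (n : ℝ) * Nat.clog 2 u ≤ n * (Real.logb 2 u + 1) :=
      mul_le_mul_of_nonneg_left hclog (Nat.cast_nonneg n)
    -- Enlarging the factor `u` to `n` is harmless: the resulting `- n log u` cancels against the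
    -- levels of the wavelet matrix.
    have h2 : (u : ℝ) * Nat.log2 (σ / u) ≤ n * (Real.logb 2 σ - Real.logb 2 u) :=
      mul_le_mul hun' (by linarith) (Nat.cast_nonneg _) (Nat.cast_nonneg n)
    have h3 : 0 ≤ (RangeNextValue.timeFactor : ℝ) * n := by positivity
    have hn' : (0 : ℝ) ≤ n := Nat.cast_nonneg n
    push_cast
    linarith
  · obtain ⟨s, t, hs, ht, ha⟩ := hq w hw i j x hi hij hj hx
    refine ⟨s, t, hs, ?_, ha⟩
    have ht' : (t : ℝ) ≤ (Nat.clog 2 u + 1) * RangeNextValue.timeFactor := by exact_mod_cast ht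
    have hmax : (Nat.clog 2 u : ℝ) + 1 ≤ 3 * max 1 (Real.logb 2 u) := by
      linarith [le_max_left 1 (Real.logb 2 u), le_max_right 1 (Real.logb 2 u)]
    have hT : (0 : ℝ) ≤ RangeNextValue.timeFactor := Nat.cast_nonneg _
    have h1 := mul_le_mul_of_nonneg_right hmax hT
    have h2 : (0 : ℝ) ≤ max 1 (Real.logb 2 u) := zero_le_one.trans (le_max_left _ _)
    push_cast
    linarith
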